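/- Let $Q:[0,\infty)\to[0,\infty)$ satisfy $Q\in C^1([0,\infty))\cap C^2((0,\infty))$, and suppose that there are constants $C_1,C_2,F_0>0$ and $0<k_1,k_2,k_3<3/2$ such that - $Q(s)\ge C_1 s^{1+1/k_1}$ for $s\ge F_0$; - $Q(s)\le C_2 s^{1+1/k_2}$ for $0\le s\le F_0$; - $Q(\lambda s)\ge \lambda^{1+1/k_3}Q(s)$ for $s\ge 0$, $0\le\lambda\le 1$; - $Q''(s)>0$ for $s>0$, and $Q'(0)=0$. For a measurable $f=f(x,v)\ge 0$ on $\mathbb R^3\times\mathbb R^3$ put $\rho_f(x)=\int f(x,v)\,dv$, $U_f=-\rho_f*\frac1{|\cdot|}$, and $$\mathcal P(f)=\iint Q(f)\,dv\,dx+\frac12\iint|v|^2f\,dv\,dx,\qquad \mathcal H_C(f)=\mathcal P(f)-\frac1{8\pi}\int|\nabla U_f|^2\,dx ,$$ where $\nabla U_f$ is the weak gradient. For $M>0$ let $$\mathcal F_M=\Bigl\{f\in L^1(\mathbb R^6)\;\Big|\; f\ge 0,\ \iint f\,dv\,dx=M,\ \mathcal P(f)<\infty\Bigr\},\qquad h_M=\inf_{\mathcal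 F_M}\mathcal H_C .$$ Theorem (existence of minimizers). Let $M>0$. For every $f\in\mathcal F_M$ the potential $U_f$ is defined almost everywhere (the convolution integral converges absolutely) and is locally integrable, and it has a weak gradient $\nabla U_f\in L^2(\mathbb R^3)$. Let $(f_n)\subset\mathcal F_M$ be a minimizing sequence of $\mathcal H_C$, i.e. $\mathcal H_C(f_n)\to h_M$. Then there exist a function $f_0\in\mathcal F_M$, a subsequence $(f_{n_k})$ and a sequence $(a_k)\subset\mathbb R^3$ such that, with $f^a(x,v):=f(x+a,v)$, 1. $\mathcal H_C(f_0)=h_M$, i.e. $f_0$ is a minimizer of $\mathcal H_C$ over $\mathcal F_M$; 2. $f_{n_k}^{a_k}\rightharpoonup f_0$ weakly in $L^{1+1/k_1}(\mathbb R^6)$, i.e. all these functions lie in $L^{1+1/k_1}(\mathbb R^6)$ and $\iint f_{n_k}^{a_k}\,g\,dv\,dx\to\iint f_0\,g\,dv\,dx$ for every $g\in L^{1+k_1}(\mathbb R^6)$; 3. $\nabla U_{f_{n_k}^{a_k}}\to\nabla U_{f_0}$ strongly in $L^2(\mathbb R^3)$. No spherical symmetry is assumed. -/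

import Mathlib

open MeasureTheory Filter Set Topology
open scoped ENNReal ContDiff Convolution

namespace VlasovPoisson

noncomputable section

/-- Euclidean space `ℝ³`. -/
abbrev E3 : Type := EuclideanSpace ℝ (Fin 3)

/-- Phase space `ℝ³ × ℝ³` with points `(x, v)` and Lebesgue (product) measure. -/
abbrev Phase : Type := E3 × E3

/-- `G` is the weak (distributional) gradient of `u` on `ℝ³`:
`∫ u ∇φ = - ∫ φ G` for all smooth compactly supported `φ`. -/
structure HasWeakGradient (u : E3 → ℝ) (G : E3 → E3) : Prop where
  locallyIntegrable : LocallyIntegrable u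
  locallyIntegrable_grad : LocallyIntegrable G
  integral_eq : ∀ φ : E3 → ℝ, ContDiff ℝ ∞ φ → HasCompactSupport φ →
    ∫ x, u x • gradient φ x = - ∫ x, φ x • G x

/-- A weak gradient is unique almost everywhere. -/
theorem HasWeakGradient.ae_unique {u : E3 → ℝ} {G G' : E3 → E3}
    (h : HasWeakGradient u G) (h' : HasWeakGradient u G') : G =ᵐ[volume] G' :=
  ae_eq_of_integral_contDiff_smul_eq h.locallyIntegrable_grad h'.locallyIntegrable_grad
    fun φ hφ hc => neg_injective
      ((h.integral_eq φ hφ hc).symm.trans (h'.integral_eq φ hφ hc))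

open Classical in
/-- The weak gradient of `u` (a representative of its almost-everywhere class),
with value `0` if `u` has no weak gradient. -/
def weakGradient (u : E3 → ℝ) : E3 → E3 :=
  if h : ∃ G, HasWeakGradient u G then h.choose else 0

/-- If `u` has a weak gradient, then `weakGradient u` is one. -/
theorem hasWeakGradient_weakGradient {u : E3 → ℝ} (h : ∃ G, HasWeakGradient u G) :
    HasWeakGradient u (weakGradient u) := by
  rw [weakGradient, dif_pos h]
  exact h.choose_spec

/-- Spatial mass density `ρ_f(x) = ∫ f(x,v) dv`. -/
def density (f : Phase → ℝ) (x : E3) : ℝ := ∫ v, f (x, v)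

/-- The kernel `1 / |x|`. -/
def newtonKernel (x : E3) : ℝ := ‖x‖⁻¹

/-- Induced potential `U_f = - ρ_f ∗ (1 / |·|)`. -/
def potential (f : Phase → ℝ) (x : E3) : ℝ := - (density f ⋆ newtonKernel) x

/-- `∇ U_f`, in the weak sense. -/
def gradPotential (f : Phase → ℝ) : E3 → E3 := weakGradient (potential f)

/-- The induced potential and its field are well defined: the convolution integral defining
`U_f(x)` converges for almost every `x`, and `U_f` has a weak gradient, lying in `L²`. -/
structure PotentialWellDefined (f : Phase → ℝ) : Prop where
  convolutionExists : ∀ᵐ x : E3, ConvolutionExistsAt (density f) newtonKernel x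
    (ContinuousLinearMap.lsmul ℝ ℝ) volume
  hasWeakGradient : HasWeakGradient (potential f) (gradPotential f)
  memLp_grad : MemLp (gradPotential f) 2 volume

/-- Kinetic energy `(1/2) ∫∫ |v|² f dv dx` of a nonnegative `f`, in `[0, ∞]`. -/
def kineticEnergy (f : Phase → ℝ) : ℝ≥0∞ :=
  ENNReal.ofReal (1 / 2) * ∫⁻ z : Phase, ENNReal.ofReal (‖z.2‖ ^ 2 * f z)

/-- Casimir functional `∫∫ Q(f) dv dx` for `Q ≥ 0`, in `[0, ∞]`. -/
def casimir (Q : ℝ → ℝ) (f : Phase → ℝ) : ℝ≥0∞ :=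
  ∫⁻ z : Phase, ENNReal.ofReal (Q (f z))

/-- The positive part `P(f) = C(f) + E_kin(f)` of the energy-Casimir functional. -/
def positivePart (Q : ℝ → ℝ) (f : Phase → ℝ) : ℝ≥0∞ := casimir Q f + kineticEnergy f

/-- Potential energy `- (1/8π) ∫ |∇ U_f|² dx`. -/
def potentialEnergy (f : Phase → ℝ) : EReal :=
  - ((ENNReal.ofReal (1 / (8 * Real.pi)) * ∫⁻ x, ‖gradPotential f x‖ₑ ^ 2 : ℝ≥0∞) : EReal)

/-- Energy-Casimir functional `H_C(f) = C(f) + E_kin(f) + E_pot(f)`. -/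
def energyCasimir (Q : ℝ → ℝ) (f : Phase → ℝ) : EReal :=
  (positivePart Q f : EReal) + potentialEnergy f

/-- The constraint set `F_M`: nonnegative integrable `f` of mass `M` with `P(f) < ∞`. -/
def constraintSet (Q : ℝ → ℝ) (M : ℝ) : Set (Phase → ℝ) :=
  {f | Integrable f ∧ 0 ≤ᵐ[volume] f ∧ ∫ z, f z = M ∧ positivePart Q f < ⊤}

/-- `h_M`, the infimum of `H_C` over `F_M`. -/
def minEnergy (Q : ℝ → ℝ) (M : ℝ) : EReal := ⨅ f ∈ constraintSet Q M, energyCasimir Q f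

/-- The assumptions on `Q`; only the values of `Q` on `[0, ∞)` matter. -/
structure CasimirAssumptions (Q : ℝ → ℝ) (C₁ C₂ F₀ k₁ k₂ k₃ : ℝ) : Prop where
  contDiffOn_one : ContDiffOn ℝ 1 Q (Ici 0)
  contDiffOn_two : ContDiffOn ℝ 2 Q (Ioi 0)
  nonneg : ∀ s, 0 ≤ s → 0 ≤ Q s
  C₁_pos : 0 < C₁
  C₂_pos : 0 < C₂
  F₀_pos : 0 < F₀
  k₁_pos : 0 < k₁
  k₁_lt : k₁ < 3 / 2
  k₂_pos : 0 < k₂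
  k₂_lt : k₂ < 3 / 2
  k₃_pos : 0 < k₃
  k₃_lt : k₃ < 3 / 2
  growth_large : ∀ s, F₀ ≤ s → C₁ * s ^ (1 + 1 / k₁) ≤ Q s
  growth_small : ∀ s, 0 ≤ s → s ≤ F₀ → Q s ≤ C₂ * s ^ (1 + 1 / k₂)
  scaling : ∀ s l, 0 ≤ s → 0 ≤ l → l ≤ 1 → l ^ (1 + 1 / k₃) * Q s ≤ Q (l * s)
  second_deriv_pos : ∀ s, 0 < s → 0 < deriv (deriv Q) s
  deriv_zero : derivWithin Q (Ici 0) 0 = 0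

/-- Translation in `x`: `f^a(x,v) = f(x + a, v)`. -/
def shift (a : E3) (f : Phase → ℝ) : Phase → ℝ := fun z => f (z.1 + a, z.2)

/-- Weak convergence in `L^p(ℝ⁶)`, `1 < p < ∞`: all functions lie in `L^p`, and integrals against
each function of the dual space `L^{p'}`, `1/p + 1/p' = 1`, converge. -/
def WeaklyConvergesInLp (p : ℝ≥0∞) (g : ℕ → Phase → ℝ) (g₀ : Phase → ℝ) : Prop :=
  (∀ k, MemLp (g k) p volume) ∧ MemLp g₀ p volume ∧
    ∀ φ : Phase → ℝ, MemLp φ p.conjExponent volume →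
      Tendsto (fun k => ∫ z, g k z * φ z) atTop (𝓝 (∫ z, g₀ z * φ z))

/-- Strong (norm) convergence in `L²(ℝ³; ℝ³)`. -/
def StronglyConvergesInL2 (G : ℕ → E3 → E3) (G₀ : E3 → E3) : Prop :=
  (∀ k, MemLp (G k) 2 volume) ∧ MemLp G₀ 2 volume ∧
    Tendsto (fun k => eLpNorm (G k - G₀) 2 volume) atTop (𝓝 0)

end

end VlasovPoisson

namespace VlasovPoisson

noncomputable section

/-! Write D(ρ, σ) for `coulombEnergy`. The gradients of two potentials have L² inner product c
D(ρ_f, ρ_g) with a positive constant c (`integral_inner_field`, `fieldConst_pos`); its value 4π is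
never needed. The functional thus becomes P(f) - κ D(ρ_f, ρ_f), the real number `energy`, and
questions about weak gradients become questions about nonnegative double integrals.

Bounds: since 1 + 1/k₁ > 5/3, mass and P control ∫ f^(5/3), and interpolation with the kinetic
energy controls ∫ ρ_f^(4/3), with an arbitrarily small factor in front of P
(`CasimirAssumptions.exists_fourThirds_le`). As D(ρ, ρ) is at most a constant times (∫ ρ)^(2/3) ∫
ρ^(4/3), the energy is at least P/2 - K. So h_M is finite and P is bounded along minimizing
sequences. Widely spread densities show h_M < 0 (`exists_energy_neg`).

Compactness: because h_M < 0, D stays away from zero along the sequence, so some ball of fixed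
radius carries a fixed amount of mass (`exists_ball_lintegral_ge`). Moving these balls to the origin
gives a nonzero weak limit f₀ (`exists_vagueLimit_shift`). No mass is lost: dilation in x shows that
mass xM, 0 ≤ x ≤ 1, costs at least x^(5/3) h_M (`rpow_mul_le_energy`). Cut the sequence at a ball of
radius R, pass to the limit in the sequence and then in R. The interaction of the two pieces
vanishes, leaving (x^(5/3) + (1 - x)^(5/3)) h_M ≤ h_M for the mass fraction x > 0 of f₀. As h_M < 0
and the bracket is below 1 for 0 < x < 1, x = 1 (`VagueLimit.totalMass_limit_eq`).

With full mass, D(ρ_n, ρ_n) and D(ρ_n, ρ₀) both tend to D(ρ₀, ρ₀), which is strong L² convergence of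
the fields once the square is expanded. P is lower semicontinuous by convexity of Q
(`positivePart_le_of_vagueTendsto`), so f₀ is a minimizer. The uniform bound in L^(1+1/k₁) upgrades
the convergence to weak convergence in that space. -/

/-! ### The Coulomb kernel: scaling and local integrals. -/

/-- The Newton kernel `1 / |x|` with values in `[0, ∞]`. -/
def coulomb (x : E3) : ℝ≥0∞ := ENNReal.ofReal ‖x‖⁻¹

@[fun_prop]
theorem measurable_coulomb : Measurable coulomb := by
  unfold coulomb; fun_prop

theorem coulomb_neg (x : E3) : coulomb (-x) = coulomb x := by simp [coulomb]

theorem coulomb_sub_comm (x y : E3) : coulomb (x - y) = coulomb (y - x) := by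
  rw [← coulomb_neg, neg_sub]

theorem coulomb_lt_top (x : E3) : coulomb x < ⊤ := ENNReal.ofReal_lt_top

theorem coulomb_smul {r : ℝ} (hr : 0 ≤ r) (x : E3) :
    coulomb (r • x) = ENNReal.ofReal r⁻¹ * coulomb x := by
  rw [coulomb, coulomb, ← ENNReal.ofReal_mul (by positivity), norm_smul, mul_inv,
    Real.norm_of_nonneg hr]

theorem coulomb_le_of_le_norm {r : ℝ} (hr : 0 < r) {x : E3} (h : r ≤ ‖x‖) :
    coulomb x ≤ ENNReal.ofReal r⁻¹ :=
  ENNReal.ofReal_le_ofReal (inv_anti₀ hr h)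

theorem le_coulomb_of_norm_le {r : ℝ} {x : E3} (hx : x ≠ 0) (h : ‖x‖ ≤ r) :
    ENNReal.ofReal r⁻¹ ≤ coulomb x :=
  ENNReal.ofReal_le_ofReal (inv_anti₀ (norm_pos_iff.2 hx) h)

theorem coulomb_le_one_add_sq (x : E3) : coulomb x ≤ 1 + coulomb x ^ 2 := by
  rcases le_total (coulomb x) 1 with h | h
  · exact h.trans le_self_add
  · exact (le_self_pow₀ h two_ne_zero).trans le_add_self

theorem lintegral_comp_smul (f : E3 → ℝ≥0∞) {r : ℝ} (hr : 0 < r) :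
    ∫⁻ x, f (r • x) = ENNReal.ofReal (r ^ 3)⁻¹ * ∫⁻ x, f x := by
  have e := (Homeomorph.smulOfNeZero r hr.ne' : E3 ≃ₜ E3).measurableEmbedding
  have h := e.lintegral_map (μ := volume) f
  have h2 : Measure.map (fun x : E3 => r • x) volume = _ := Measure.map_addHaar_smul volume hr.ne'
  simp only [Homeomorph.smulOfNeZero_apply] at h
  change ∫⁻ a, f a ∂(Measure.map (fun x : E3 => r • x) volume) = _ at h
  rw [h2, lintegral_smul_measure, finrank_euclideanSpace_fin, abs_of_pos (by positivity)] at h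
  exact h.symm

theorem lintegral_ball_comp_smul (f : E3 → ℝ≥0∞) {r : ℝ} (hr : 0 < r) :
    ∫⁻ x in Metric.ball 0 1, f (r • x) = ENNReal.ofReal (r ^ 3)⁻¹ * ∫⁻ x in Metric.ball 0 r, f x := by
  rw [← lintegral_indicator Metric.isOpen_ball.measurableSet,
    ← lintegral_indicator Metric.isOpen_ball.measurableSet, ← lintegral_comp_smul _ hr]
  congr 1 with x
  have : x ∈ Metric.ball (0 : E3) 1 ↔ r • x ∈ Metric.ball (0 : E3) r := by
    simp [norm_smul, abs_of_pos hr, hr]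
  by_cases hx : x ∈ Metric.ball (0 : E3) 1
  · rw [indicator_of_mem hx, indicator_of_mem (this.1 hx)]
  · rw [indicator_of_notMem hx, indicator_of_notMem (fun h => hx (this.2 h))]

/-- The integral of `|x|⁻²` over the unit ball. -/
def coulombSqBall : ℝ≥0∞ := ∫⁻ x in Metric.ball (0 : E3) 1, coulomb x ^ 2

/-- In polar coordinates the weight r² cancels the singularity r⁻². -/
theorem coulombSqBall_lt_top : coulombSqBall < ⊤ := by
  have h : IntegrableOn (fun x : E3 => (fun t : ℝ => t⁻¹ ^ 2) ‖x‖) (Metric.ball 0 1) := by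
    refine (integrableOn_fun_norm_addHaar (volume : Measure E3) (f := fun t : ℝ => t⁻¹ ^ 2)).2 ?_
    have : IntegrableOn (fun _ : ℝ => (1 : ℝ)) (Ioo 0 1) := by simp
    refine this.congr_fun (fun y hy => ?_) measurableSet_Ioo
    have : y ≠ 0 := hy.1.ne'
    simp
    field_simp
  have h2 := h.2
  rw [hasFiniteIntegral_iff_ofReal (by filter_upwards with x; positivity)] at h2
  refine lt_of_eq_of_lt ?_ h2
  simp_rw [coulombSqBall, coulomb, ENNReal.ofReal_pow (inv_nonneg.2 (norm_nonneg _))]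

/-- Volume scales like r³ and the integrand like r⁻², so one power of r survives. Its smallness as r
→ 0 is what later makes interactions at short distance negligible. -/
theorem lintegral_ball_coulomb_sq {r : ℝ} (hr : 0 < r) :
    ∫⁻ x in Metric.ball (0 : E3) r, coulomb x ^ 2 = ENNReal.ofReal r * coulombSqBall := by
  have h := lintegral_ball_comp_smul (fun x => coulomb x ^ 2) hr
  simp_rw [coulomb_smul hr.le, mul_pow] at h
  rw [lintegral_const_mul _ (by fun_prop)] at h
  change _ * coulombSqBall = _ at h
  have h3 : ENNReal.ofReal (r ^ 3) * (ENNReal.ofReal (r ^ 3)⁻¹ *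
      ∫⁻ x in Metric.ball (0 : E3) r, coulomb x ^ 2) = ∫⁻ x in Metric.ball (0 : E3) r, coulomb x ^ 2 := by
    rw [← mul_assoc, ← ENNReal.ofReal_mul (by positivity), mul_inv_cancel₀ (by positivity)]
    simp
  rw [← h3, ← h, ← mul_assoc, ← ENNReal.ofReal_pow (by positivity),
    ← ENNReal.ofReal_mul (by positivity)]
  congr 2
  field_simp

theorem setLIntegral_ball_coulomb_sq {r : ℝ} (hr : 0 < r) (y : E3) :
    ∫⁻ x in Metric.ball y r, coulomb (x - y) ^ 2 = ENNReal.ofReal r * coulombSqBall := by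
  rw [← lintegral_ball_coulomb_sq hr, ← lintegral_indicator Metric.isOpen_ball.measurableSet,
    ← lintegral_indicator Metric.isOpen_ball.measurableSet,
    ← lintegral_sub_right_eq_self (fun x => (Metric.ball (0 : E3) r).indicator _ x) y]
  congr 1 with x
  simp [indicator, dist_eq_norm]

/-- Beyond distance 1 from the pole the kernel is at most 1. The point is that the bound does not
depend on y. -/
theorem setLIntegral_coulomb_sq_le (s : Set E3) (y : E3) :
    ∫⁻ x in s, coulomb (x - y) ^ 2 ≤ coulombSqBall + volume s := by
  calc ∫⁻ x in s, coulomb (x - y) ^ 2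
      ≤ ∫⁻ x in s, ((Metric.ball y 1).indicator (fun x => coulomb (x - y) ^ 2) x + 1) := by
        refine lintegral_mono fun x => ?_
        by_cases hx : x ∈ Metric.ball y 1
        · simp [indicator_of_mem hx]
        · rw [indicator_of_notMem hx, zero_add]
          have : (1 : ℝ) ≤ ‖x - y‖ := by simpa [dist_eq_norm] using hx
          have := coulomb_le_of_le_norm one_pos this
          exact pow_le_one₀ zero_le (by simpa using this)
    _ = (∫⁻ x in s, (Metric.ball y 1).indicator (fun x => coulomb (x - y) ^ 2) x) + volume s := by
        rw [lintegral_add_right _ measurable_const, setLIntegral_const, one_mul]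
    _ ≤ _ := by
        refine add_le_add_left ?_ _
        refine (setLIntegral_le_lintegral _ _).trans ?_
        rw [lintegral_indicator Metric.isOpen_ball.measurableSet, setLIntegral_ball_coulomb_sq one_pos]
        simp

theorem setLIntegral_coulomb_le (s : Set E3) (y : E3) :
    ∫⁻ x in s, coulomb (x - y) ≤ coulombSqBall + 2 * volume s := by
  calc ∫⁻ x in s, coulomb (x - y) ≤ ∫⁻ x in s, (1 + coulomb (x - y) ^ 2) :=
        lintegral_mono fun x => coulomb_le_one_add_sq _
    _ = volume s + ∫⁻ x in s, coulomb (x - y) ^ 2 := by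
        rw [lintegral_add_left measurable_const]; simp
    _ ≤ volume s + (coulombSqBall + volume s) := by gcongr; exact setLIntegral_coulomb_sq_le s y
    _ = _ := by ring

/-- The convolution of `|x|⁻²` with itself is finite off the origin, with a bound on the sphere. -/
theorem exists_lintegral_coulomb_sq_mul_le : ∃ C : ℝ≥0∞, C < ⊤ ∧ ∀ e : E3, ‖e‖ = 1 →
    ∫⁻ z, coulomb z ^ 2 * coulomb (z - e) ^ 2 ≤ C := by
  have hfar : ∫⁻ x : E3, ENNReal.ofReal ((1 + ‖x‖) ^ (-4 : ℝ)) < ⊤ :=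
    finite_integral_one_add_norm (r := 4) (by rw [finrank_euclideanSpace_fin]; norm_num)
  refine ⟨4 * coulombSqBall + 4 * coulombSqBall + ENNReal.ofReal 1296 *
    ∫⁻ x : E3, ENNReal.ofReal ((1 + ‖x‖) ^ (-4 : ℝ)), ?_, fun e he => ?_⟩
  · have := coulombSqBall_lt_top
    refine ENNReal.add_lt_top.2 ⟨ENNReal.add_lt_top.2 ⟨?_, ?_⟩, ?_⟩ <;>
    apply ENNReal.mul_lt_top <;> first | exact hfar | simp [*]
  have hhalf : ∀ w : E3, 1 / 2 ≤ ‖w‖ → coulomb w ^ 2 ≤ 4 := fun w hw => by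
    have := coulomb_le_of_le_norm (by norm_num) hw
    calc coulomb w ^ 2 ≤ (ENNReal.ofReal (1 / 2)⁻¹) ^ 2 := by gcongr
      _ = 4 := by norm_num
  -- The poles are at distance 1, so near one of them the other factor is at most 4. Elsewhere both
  -- distances are at least 1/2, hence at least (1 + |z|)/6, which gives the constant 6⁴ = 1296.
  have hpt : ∀ z : E3, coulomb z ^ 2 * coulomb (z - e) ^ 2 ≤
      4 * (Metric.ball (0 : E3) 1).indicator (fun z => coulomb (z - 0) ^ 2) z +
      4 * (Metric.ball e 1).indicator (fun z => coulomb (z - e) ^ 2) z +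
      ENNReal.ofReal 1296 * ENNReal.ofReal ((1 + ‖z‖) ^ (-4 : ℝ)) := by
    intro z
    have tri : ‖e‖ ≤ ‖z‖ + ‖z - e‖ := by
      simpa using norm_sub_le z (z - e)
    have tri2 : ‖z‖ ≤ ‖z - e‖ + ‖e‖ := by
      simpa using norm_add_le (z - e) e
    by_cases h1 : ‖z‖ < 1 / 2
    · refine le_trans ?_ (le_self_add.trans le_self_add)
      have : z ∈ Metric.ball (0 : E3) 1 := by simp; linarith
      rw [indicator_of_mem this, sub_zero, mul_comm]
      gcongr
      exact hhalf _ (by linarith)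
    by_cases h2 : ‖z - e‖ < 1 / 2
    · refine le_trans ?_ (le_add_self.trans le_self_add)
      have : z ∈ Metric.ball e 1 := by simp [dist_eq_norm]; linarith
      rw [indicator_of_mem this]
      gcongr
      exact hhalf _ (by linarith)
    refine le_trans ?_ le_add_self
    push Not at h1 h2
    rw [coulomb, coulomb, ← ENNReal.ofReal_pow (by positivity), ← ENNReal.ofReal_pow (by positivity),
      ← ENNReal.ofReal_mul (by positivity), ← ENNReal.ofReal_mul (by positivity)]
    apply ENNReal.ofReal_le_ofReal
    have hz : 0 < ‖z‖ := by linarith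
    have hze : 0 < ‖z - e‖ := by linarith
    have e1 : (1 + ‖z‖) ^ (-4 : ℝ) = ((1 + ‖z‖) ^ 4)⁻¹ := by
      rw [Real.rpow_neg (by positivity)]; norm_cast
    have b1 : ‖z‖⁻¹ ≤ 6 * (1 + ‖z‖)⁻¹ := by
      rw [← div_eq_mul_inv, inv_eq_one_div, div_le_div_iff₀ hz (by positivity)]; linarith
    have b2 : ‖z - e‖⁻¹ ≤ 6 * (1 + ‖z‖)⁻¹ := by
      rw [← div_eq_mul_inv, inv_eq_one_div, div_le_div_iff₀ hze (by positivity)]; linarith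
    calc ‖z‖⁻¹ ^ 2 * ‖z - e‖⁻¹ ^ 2 ≤ (6 * (1 + ‖z‖)⁻¹) ^ 2 * (6 * (1 + ‖z‖)⁻¹) ^ 2 := by gcongr
      _ = _ := by rw [e1]; field_simp; norm_num
  refine (lintegral_mono hpt).trans ?_
  rw [lintegral_add_right _ (by fun_prop), lintegral_add_right _ (Measurable.const_mul
    (Measurable.indicator (by fun_prop) Metric.isOpen_ball.measurableSet) _),
    lintegral_const_mul _ (Measurable.indicator (by fun_prop) Metric.isOpen_ball.measurableSet),
    lintegral_const_mul _ (Measurable.indicator (by fun_prop) Metric.isOpen_ball.measurableSet),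
    lintegral_const_mul _ (by fun_prop), lintegral_indicator Metric.isOpen_ball.measurableSet,
    lintegral_indicator Metric.isOpen_ball.measurableSet, setLIntegral_ball_coulomb_sq one_pos,
    setLIntegral_ball_coulomb_sq one_pos]
  simp

/-! ### The field of a point mass and its weak formulation. -/

/-- The field `x / |x|³`. -/
def newtonField (x : E3) : E3 := ‖x‖⁻¹ ^ 3 • x

@[fun_prop]
theorem measurable_newtonField : Measurable newtonField := by
  unfold newtonField; fun_prop

@[fun_prop]
theorem measurable_newtonKernel : Measurable newtonKernel := by
  unfold newtonKernel; fun_prop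

theorem norm_newtonField (x : E3) : ‖newtonField x‖ = ‖x‖⁻¹ ^ 2 := by
  rw [newtonField, norm_smul, norm_pow, norm_inv, norm_norm]
  rcases eq_or_ne x 0 with rfl | h
  · simp
  · have := norm_ne_zero_iff.2 h
    field_simp

theorem enorm_newtonField (x : E3) : ‖newtonField x‖ₑ = coulomb x ^ 2 := by
  rw [← ofReal_norm, norm_newtonField, coulomb, ENNReal.ofReal_pow (by positivity)]

theorem enorm_newtonKernel (x : E3) : ‖newtonKernel x‖ₑ = coulomb x := by
  rw [newtonKernel, Real.enorm_eq_ofReal (by positivity), coulomb]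

section Kernel

variable {F : Type*} [NormedAddCommGroup F]

theorem locallyIntegrable_of_lintegral_ball {f : E3 → F} (hf : AEStronglyMeasurable f)
    (h : ∀ R : ℝ, 0 < R → ∫⁻ x in Metric.ball 0 R, ‖f x‖ₑ < ⊤) : LocallyIntegrable f := by
  refine locallyIntegrable_iff.2 fun K hK => ?_
  obtain ⟨R, hR, hKR⟩ := hK.isBounded.subset_ball_lt 0 0
  exact IntegrableOn.mono_set ⟨hf.restrict, h R hR⟩ hKR

theorem setLIntegral_ball_newtonField_lt_top (y : E3) (R : ℝ) :
    ∫⁻ x in Metric.ball 0 R, ‖newtonField (x - y)‖ₑ ≤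
      coulombSqBall + 2 * volume (Metric.ball (0 : E3) R) := by
  simp_rw [enorm_newtonField]
  refine (setLIntegral_coulomb_sq_le _ y).trans ?_
  gcongr
  exact le_mul_of_one_le_left' one_le_two

theorem setLIntegral_ball_newtonKernel_lt_top (y : E3) (R : ℝ) :
    ∫⁻ x in Metric.ball 0 R, ‖newtonKernel (x - y)‖ₑ ≤
      coulombSqBall + 2 * volume (Metric.ball (0 : E3) R) := by
  simp_rw [enorm_newtonKernel]
  exact setLIntegral_coulomb_le _ y

theorem coulombSqBall_add_volume_lt_top (R : ℝ) :
    coulombSqBall + 2 * volume (Metric.ball (0 : E3) R) < ⊤ :=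
  ENNReal.add_lt_top.2 ⟨coulombSqBall_lt_top,
    ENNReal.mul_lt_top (by simp) measure_ball_lt_top⟩

theorem locallyIntegrable_newtonField (y : E3) :
    LocallyIntegrable fun x => newtonField (x - y) :=
  locallyIntegrable_of_lintegral_ball
    (measurable_newtonField.comp (measurable_id.sub_const y)).aestronglyMeasurable
    fun R _ => (setLIntegral_ball_newtonField_lt_top y R).trans_lt
      (coulombSqBall_add_volume_lt_top R)

theorem locallyIntegrable_newtonKernel (y : E3) :
    LocallyIntegrable fun x => newtonKernel (x - y) :=
  locallyIntegrable_of_lintegral_ball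
    (measurable_newtonKernel.comp (measurable_id.sub_const y)).aestronglyMeasurable
    fun R _ => (setLIntegral_ball_newtonKernel_lt_top y R).trans_lt
      (coulombSqBall_add_volume_lt_top R)

theorem hasFDerivAt_inv_sqrt_norm_sub_sq_add (y x : E3) {ε : ℝ} (hε : 0 < ε) :
    HasFDerivAt (fun x => (√(‖x - y‖ ^ 2 + ε))⁻¹)
      (-((√(‖x - y‖ ^ 2 + ε))⁻¹ ^ 3) • innerSL ℝ (x - y)) x := by
  have hpos : 0 < ‖x - y‖ ^ 2 + ε := by positivity
  have h1 : HasFDerivAt (fun x => ‖x - y‖ ^ 2 + ε) (2 • (innerSL ℝ (x - y))) x := by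
    have := ((hasStrictFDerivAt_norm_sq (x - y)).hasFDerivAt.comp x
      ((hasFDerivAt_id x).sub_const y)).add_const ε
    simpa using this
  have h2 := (hasDerivAt_inv (Real.sqrt_pos.2 hpos).ne').comp_hasFDerivAt x (h1.sqrt hpos.ne')
  refine h2.congr_fderiv ?_
  ext v
  have : √(‖x - y‖ ^ 2 + ε) ≠ 0 := (Real.sqrt_pos.2 hpos).ne'
  simp
  field_simp

/-- Classical integration by parts applies to the smooth kernel (|x - y|² + ε)^(-1/2). It and its
gradient are dominated by |x - y|⁻¹ and |x - y|⁻², which are locally integrable, so ε = 1/(n+1) can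
be sent to zero. -/
theorem integral_newtonKernel_mul_fderiv (y v : E3) {φ : E3 → ℝ} (hφ : ContDiff ℝ ∞ φ)
    (hc : HasCompactSupport φ) :
    ∫ x, newtonKernel (x - y) * fderiv ℝ φ x v = ∫ x, inner ℝ (newtonField (x - y)) v * φ x := by
  set g : ℕ → E3 → ℝ := fun n x => (√(‖x - y‖ ^ 2 + 1 / ((n : ℝ) + 1)))⁻¹
  set g' : ℕ → E3 → ℝ := fun n x => g n x ^ 3 * inner ℝ (x - y) v
  have hε : ∀ n : ℕ, (0 : ℝ) < 1 / ((n : ℝ) + 1) := fun n => by positivity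
  have hgc : ∀ n, Continuous (g n) := fun n => by
    have : ∀ x, √(‖x - y‖ ^ 2 + 1 / ((n : ℝ) + 1)) ≠ 0 := fun x =>
      (Real.sqrt_pos.2 (by have := hε n; positivity)).ne'
    fun_prop (disch := assumption)
  have hφ' : Continuous fun x => fderiv ℝ φ x v :=
    (hφ.continuous_fderiv (by simp)).clm_apply continuous_const
  have hc' : HasCompactSupport fun x => fderiv ℝ φ x v := hc.fderiv_apply ℝ v
  have hgd : ∀ n x, HasFDerivAt (g n) (-(g n x ^ 3) • innerSL ℝ (x - y)) x := fun n x =>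
    hasFDerivAt_inv_sqrt_norm_sub_sq_add y x (hε n)
  have hgd' : ∀ n x, fderiv ℝ (g n) x v = -g' n x := fun n x => by
    rw [(hgd n x).fderiv]; simp [g', inner_sub_left]
  have hbyparts : ∀ n, ∫ x, g n x * fderiv ℝ φ x v = ∫ x, g' n x * φ x := fun n => by
    rw [integral_mul_fderiv_eq_neg_fderiv_mul_of_integrable]
    · simp_rw [hgd', neg_mul, integral_neg, neg_neg]
    · simp_rw [hgd']
      refine Continuous.integrable_of_hasCompactSupport ?_ hc.mul_left
      have := hφ.continuous
      simp only [g']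
      fun_prop
    · exact Continuous.integrable_of_hasCompactSupport ((hgc n).mul hφ') hc'.mul_left
    · exact Continuous.integrable_of_hasCompactSupport ((hgc n).mul hφ.continuous) hc.mul_left
    · exact fun x _ => (hgd n x).differentiableAt
    · exact fun x _ => hφ.differentiable (by simp) x
  -- With the convention 0⁻¹ = 0 the bound fails at the pole, which is therefore discarded as a null
  -- set.
  have hgle : ∀ n x, g n x ≤ ‖x - y‖⁻¹ ∨ x = y := fun n x => by
    rcases eq_or_ne x y with h | h
    · exact Or.inr h
    · refine Or.inl (inv_anti₀ (norm_pos_iff.2 (sub_ne_zero.2 h)) ?_)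
      exact Real.le_sqrt_of_sq_le (by have := hε n; linarith)
  have hg0 : ∀ n x, 0 ≤ g n x := fun n x => by positivity
  have hne : ∀ᵐ x : E3, x ≠ y := by simp [ae_iff]
  have hlim : ∀ x, x ≠ y → Tendsto (fun n => g n x) atTop (𝓝 ‖x - y‖⁻¹) := fun x hx => by
    have h0 : Tendsto (fun n : ℕ => ‖x - y‖ ^ 2 + 1 / ((n : ℝ) + 1)) atTop (𝓝 (‖x - y‖ ^ 2 + 0)) :=
      tendsto_const_nhds.add tendsto_one_div_add_atTop_nhds_zero_nat
    have h1 := (Real.continuous_sqrt.tendsto _).comp h0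
    rw [add_zero, Real.sqrt_sq (norm_nonneg _)] at h1
    exact h1.inv₀ (norm_ne_zero_iff.2 (sub_ne_zero.2 hx))
  have hL : Tendsto (fun n => ∫ x, g n x * fderiv ℝ φ x v) atTop
      (𝓝 (∫ x, newtonKernel (x - y) * fderiv ℝ φ x v)) := by
    refine tendsto_integral_of_dominated_convergence
      (fun x => ‖newtonKernel (x - y) * fderiv ℝ φ x v‖)
      (fun n => ((hgc n).mul hφ').aestronglyMeasurable) ?_ ?_ ?_
    · exact ((locallyIntegrable_newtonKernel y).integrable_smul_right_of_hasCompactSupport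
        hφ' hc').norm
    · intro n
      filter_upwards [hne] with x hx
      rw [norm_mul, norm_mul, Real.norm_of_nonneg (hg0 n x), newtonKernel, norm_inv, norm_norm]
      gcongr
      exact (hgle n x).resolve_right hx
    · filter_upwards [hne] with x hx
      exact (hlim x hx).mul_const _
  have hR : Tendsto (fun n => ∫ x, g' n x * φ x) atTop
      (𝓝 (∫ x, inner ℝ (newtonField (x - y)) v * φ x)) := by
    refine tendsto_integral_of_dominated_convergence
      (fun x => ‖φ x • newtonField (x - y)‖ * ‖v‖)
      (fun n => ?_) ?_ ?_ ?_
    · have := hφ.continuous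
      simp only [g']
      exact Continuous.aestronglyMeasurable (by fun_prop)
    · exact ((locallyIntegrable_newtonField y).integrable_smul_left_of_hasCompactSupport
        hφ.continuous hc).norm.mul_const _
    · intro n
      filter_upwards [hne] with x hx
      rw [norm_mul, norm_smul, norm_newtonField]
      have h1 := (hgle n x).resolve_right hx
      have h2 : |inner ℝ (x - y) v| ≤ ‖x - y‖ * ‖v‖ := abs_real_inner_le_norm _ _
      have h3 : ‖g' n x‖ ≤ ‖x - y‖⁻¹ ^ 2 * ‖v‖ := by
        simp only [g']
        rw [norm_mul, norm_pow, Real.norm_of_nonneg (hg0 n x), Real.norm_eq_abs]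
        have hp := norm_ne_zero_iff.2 (sub_ne_zero.2 hx)
        calc g n x ^ 3 * |inner ℝ (x - y) v| ≤ ‖x - y‖⁻¹ ^ 3 * (‖x - y‖ * ‖v‖) := by
              gcongr
          _ = _ := by field_simp
      calc ‖g' n x‖ * ‖φ x‖ ≤ (‖x - y‖⁻¹ ^ 2 * ‖v‖) * ‖φ x‖ := by gcongr
        _ = _ := by ring
    · filter_upwards [hne] with x hx
      refine Tendsto.mul_const _ ?_
      rw [newtonField, real_inner_smul_left]
      exact ((hlim x hx).pow 3).mul_const _
  simp_rw [hbyparts] at hL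
  exact tendsto_nhds_unique hL hR

theorem continuous_gradient {φ : E3 → ℝ} (hφ : ContDiff ℝ ∞ φ) : Continuous (gradient φ) :=
  (InnerProductSpace.toDual ℝ E3).symm.continuous.comp (hφ.continuous_fderiv (by simp))

theorem hasCompactSupport_gradient {φ : E3 → ℝ} (hc : HasCompactSupport φ) :
    HasCompactSupport (gradient φ) :=
  (hc.fderiv ℝ).comp_left (g := (InnerProductSpace.toDual ℝ E3).symm) (map_zero _)

theorem integral_newtonKernel_smul_gradient (y : E3) {φ : E3 → ℝ} (hφ : ContDiff ℝ ∞ φ)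
    (hc : HasCompactSupport φ) :
    ∫ x, newtonKernel (x - y) • gradient φ x = ∫ x, φ x • newtonField (x - y) := by
  refine ext_inner_left ℝ fun v => ?_
  rw [← integral_inner, ← integral_inner]
  · have h := integral_newtonKernel_mul_fderiv y v hφ hc
    simp_rw [real_inner_smul_right]
    refine (integral_congr_ae (.of_forall fun x => ?_)).trans
      (h.trans (integral_congr_ae (.of_forall fun x => ?_)))
    · rw [real_inner_comm, gradient, InnerProductSpace.toDual_symm_apply]
    · exact mul_comm _ _ |>.trans (congrArg _ (real_inner_comm _ _))
  · exact (locallyIntegrable_newtonField y).integrable_smul_left_of_hasCompactSupport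
        hφ.continuous hc
  · exact (locallyIntegrable_newtonKernel y).integrable_smul_right_of_hasCompactSupport
        (continuous_gradient hφ) (hasCompactSupport_gradient hc)

variable [NormedSpace ℝ F]

/-- Tonelli with x restricted to s: the kernels in use are not integrable over the whole space, but
their integrals over bounded sets are bounded uniformly in the pole. -/
theorem integrable_prod_smul_sub {ρ : E3 → ℝ} (hρ : Integrable ρ) {G : E3 → F}
    (hG : StronglyMeasurable G) {s : Set E3} {C : ℝ≥0∞} (hC : C < ⊤)
    (h : ∀ y, ∫⁻ x in s, ‖G (x - y)‖ₑ ≤ C) :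
    Integrable (fun p : E3 × E3 => ρ p.2 • G (p.1 - p.2)) ((volume.restrict s).prod volume) := by
  have hm : AEStronglyMeasurable (fun p : E3 × E3 => ρ p.2 • G (p.1 - p.2))
      ((volume.restrict s).prod volume) :=
    hρ.1.comp_snd.smul (hG.comp_measurable (measurable_fst.sub measurable_snd)).aestronglyMeasurable
  refine ⟨hm, ?_⟩
  rw [HasFiniteIntegral, lintegral_prod_symm _ hm.enorm]
  calc ∫⁻ y, ∫⁻ x in s, ‖ρ y • G (x - y)‖ₑ = ∫⁻ y, ‖ρ y‖ₑ * ∫⁻ x in s, ‖G (x - y)‖ₑ := by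
        refine lintegral_congr fun y => ?_
        simp_rw [enorm_smul]
        rw [lintegral_const_mul]
        exact (hG.comp_measurable (measurable_id.sub_const y)).enorm
    _ ≤ ∫⁻ y, ‖ρ y‖ₑ * C := lintegral_mono fun y => by gcongr; exact h y
    _ = (∫⁻ y, ‖ρ y‖ₑ) * C := lintegral_mul_const'' _ hρ.1.enorm
    _ < ⊤ := ENNReal.mul_lt_top hρ.2 hC

theorem ae_integrable_smul_sub {ρ : E3 → ℝ} {G : E3 → F}
    (h : ∀ R : ℝ, Integrable (fun p : E3 × E3 => ρ p.2 • G (p.1 - p.2))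
      ((volume.restrict (Metric.ball 0 R)).prod volume)) :
    ∀ᵐ x : E3, Integrable fun y => ρ y • G (x - y) := by
  have h1 : ∀ n : ℕ, ∀ᵐ x : E3, x ∈ Metric.ball (0 : E3) n → Integrable fun y => ρ y • G (x - y) :=
    fun n => (ae_restrict_iff' Metric.isOpen_ball.measurableSet).1 (h n).prod_right_ae
  filter_upwards [ae_all_iff.2 h1] with x hx
  obtain ⟨n, hn⟩ := exists_nat_gt ‖x‖
  exact hx n (by simpa using hn)

theorem locallyIntegrable_integral_smul_sub {ρ : E3 → ℝ} {G : E3 → F}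
    (h : ∀ R : ℝ, Integrable (fun p : E3 × E3 => ρ p.2 • G (p.1 - p.2))
      ((volume.restrict (Metric.ball 0 R)).prod volume)) :
    LocallyIntegrable fun x => ∫ y, ρ y • G (x - y) := by
  refine locallyIntegrable_iff.2 fun K hK => ?_
  obtain ⟨R, hKR⟩ := hK.isBounded.subset_ball 0
  exact IntegrableOn.mono_set (h R).integral_prod_left hKR

/-- Fubini's theorem for a convolution tested against a continuous function of compact support,
where `B` is the pairing. -/
theorem integral_integral_smul_sub_comm {H K : Type*} [NormedAddCommGroup H] [NormedSpace ℝ H]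
    [NormedAddCommGroup K] [NormedSpace ℝ K] [CompleteSpace F] [CompleteSpace K]
    (B : F →L[ℝ] H →L[ℝ] K) {ρ : E3 → ℝ} {G : E3 → F}
    (h : ∀ R : ℝ, Integrable (fun p : E3 × E3 => ρ p.2 • G (p.1 - p.2))
      ((volume.restrict (Metric.ball 0 R)).prod volume))
    {ψ : E3 → H} (hψ : Continuous ψ) (hc : HasCompactSupport ψ) :
    ∫ x, B (∫ y, ρ y • G (x - y)) (ψ x) = ∫ y, ρ y • ∫ x, B (G (x - y)) (ψ x) := by
  obtain ⟨R, hR⟩ := hc.isCompact.isBounded.subset_ball 0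
  have hz : ∀ x, x ∉ Metric.ball (0 : E3) R → ψ x = 0 := fun x hx =>
    image_eq_zero_of_notMem_tsupport fun h => hx (hR h)
  obtain ⟨C, hC⟩ := hψ.bounded_above_of_compact_support hc
  have hint : Integrable (fun p : E3 × E3 => B (ρ p.2 • G (p.1 - p.2)) (ψ p.1))
      ((volume.restrict (Metric.ball 0 R)).prod volume) := by
    refine Integrable.mono' (((h R).norm.const_mul ‖B‖).mul_const C) ?_ (.of_forall fun p => ?_)
    · exact B.aestronglyMeasurable_comp₂ (h R).1 (hψ.comp continuous_fst).aestronglyMeasurable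
    · refine (B.le_opNorm₂ _ _).trans ?_
      gcongr
      exact hC _
  have e1 : ∫ x, B (∫ y, ρ y • G (x - y)) (ψ x) =
      ∫ x in Metric.ball 0 R, ∫ y, B (ρ y • G (x - y)) (ψ x) := by
    rw [← setIntegral_eq_integral_of_forall_compl_eq_zero (s := Metric.ball 0 R)
      (fun x hx => by rw [hz x hx, map_zero])]
    refine integral_congr_ae ?_
    filter_upwards [(h R).prod_right_ae] with x hx
    exact ((B.flip (ψ x)).integral_comp_comm hx).symm
  rw [e1, integral_integral_swap hint]
  refine integral_congr_ae (.of_forall fun y => ?_)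
  simp only
  rw [setIntegral_eq_integral_of_forall_compl_eq_zero (s := Metric.ball 0 R)
      (fun x hx => by rw [hz x hx, map_zero]), ← integral_smul]
  simp

end Kernel

/-! ### Fields of integrable densities are weak gradients of their potentials. -/

/-- The field `∫ ρ(y) (x - y) / |x - y|³ dy` generated by `ρ`. -/
def field (ρ : E3 → ℝ) (x : E3) : E3 := ∫ y, ρ y • newtonField (x - y)

section WeakGradient

variable {ρ : E3 → ℝ}

theorem integrable_prod_newtonField (hρ : Integrable ρ) (R : ℝ) :
    Integrable (fun p : E3 × E3 => ρ p.2 • newtonField (p.1 - p.2))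
      ((volume.restrict (Metric.ball 0 R)).prod volume) :=
  integrable_prod_smul_sub hρ measurable_newtonField.stronglyMeasurable
    (coulombSqBall_add_volume_lt_top R) fun y => setLIntegral_ball_newtonField_lt_top y R

theorem integrable_prod_newtonKernel (hρ : Integrable ρ) (R : ℝ) :
    Integrable (fun p : E3 × E3 => ρ p.2 • newtonKernel (p.1 - p.2))
      ((volume.restrict (Metric.ball 0 R)).prod volume) :=
  integrable_prod_smul_sub hρ measurable_newtonKernel.stronglyMeasurable
    (coulombSqBall_add_volume_lt_top R) fun y => setLIntegral_ball_newtonKernel_lt_top y R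

theorem ae_integrable_field (hρ : Integrable ρ) :
    ∀ᵐ x : E3, Integrable fun y => ρ y • newtonField (x - y) :=
  ae_integrable_smul_sub (integrable_prod_newtonField hρ)

/-- Fubini moves the test function onto the kernel, where the identity for a single point mass
applies. -/
theorem hasWeakGradient_field (hρ : Integrable ρ) :
    HasWeakGradient (fun x => -(ρ ⋆ newtonKernel) x) (field ρ) where
  locallyIntegrable :=
    (locallyIntegrable_integral_smul_sub (integrable_prod_newtonKernel hρ)).neg
  locallyIntegrable_grad :=
    locallyIntegrable_integral_smul_sub (integrable_prod_newtonField hρ)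
  integral_eq φ hφ hc := by
    have h1 := integral_integral_smul_sub_comm (ContinuousLinearMap.lsmul ℝ ℝ)
      (integrable_prod_newtonKernel hρ) (continuous_gradient hφ) (hasCompactSupport_gradient hc)
    have h2 := integral_integral_smul_sub_comm (ContinuousLinearMap.lsmul ℝ ℝ).flip
      (integrable_prod_newtonField hρ) hφ.continuous hc
    simp only [ContinuousLinearMap.lsmul_apply, ContinuousLinearMap.flip_apply,
      integral_newtonKernel_smul_gradient _ hφ hc] at h1 h2
    simp only [neg_smul, integral_neg, neg_inj]
    exact h1.trans h2.symm

theorem integrable_density {f : Phase → ℝ} (hf : Integrable f) : Integrable (density f) :=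
  hf.integral_prod_left

theorem hasWeakGradient_potential {f : Phase → ℝ} (hf : Integrable f) :
    HasWeakGradient (potential f) (field (density f)) :=
  hasWeakGradient_field (integrable_density hf)

/-- `gradPotential` is an arbitrary choice; uniqueness of weak gradients ties it to the explicit
field. -/
theorem gradPotential_ae_eq {f : Phase → ℝ} (hf : Integrable f) :
    gradPotential f =ᵐ[volume] field (density f) :=
  (hasWeakGradient_weakGradient ⟨_, hasWeakGradient_potential hf⟩).ae_unique
    (hasWeakGradient_potential hf)

theorem potentialWellDefined_of_memLp {f : Phase → ℝ} (hf : Integrable f)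
    (h : MemLp (field (density f)) 2) : PotentialWellDefined f where
  convolutionExists := ae_integrable_smul_sub (integrable_prod_newtonKernel (integrable_density hf))
  hasWeakGradient := hasWeakGradient_weakGradient ⟨_, hasWeakGradient_potential hf⟩
  memLp_grad := (memLp_congr_ae (gradPotential_ae_eq hf)).2 h

end WeakGradient

/-! ### Inner product of the fields of two point masses. -/

section FieldKernel

theorem newtonField_smul {r : ℝ} (hr : 0 < r) (x : E3) :
    newtonField (r • x) = r⁻¹ ^ 2 • newtonField x := by
  rw [newtonField, newtonField, norm_smul, Real.norm_of_nonneg hr.le, smul_smul, smul_smul]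
  congr 1
  field_simp

theorem newtonField_map (R : E3 ≃ₗᵢ[ℝ] E3) (x : E3) : newtonField (R x) = R (newtonField x) := by
  simp [newtonField]

/-- The value at a unit vector of the inner products of the fields of two point masses. -/
def fieldConst : ℝ :=
  ∫ z, inner ℝ (newtonField z) (newtonField (z - EuclideanSpace.single (0 : Fin 3) (1 : ℝ)))

/-- A reflection carries the reference unit vector to e; it preserves Lebesgue measure and commutes
with the field. -/
theorem integral_inner_newtonField_of_norm_eq_one {e : E3} (he : ‖e‖ = 1) :
    ∫ z, inner ℝ (newtonField z) (newtonField (z - e)) = fieldConst := by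
  set e₀ : E3 := EuclideanSpace.single (0 : Fin 3) (1 : ℝ)
  have h0 : ‖e₀‖ = ‖e‖ := by simp [e₀, he]
  set R : E3 ≃ₗᵢ[ℝ] E3 := (Submodule.reflection (Submodule.span ℝ {e₀ - e})ᗮ)
  have hR : R e₀ = e := Submodule.reflection_sub h0
  have := (R.measurePreserving).integral_comp R.toHomeomorph.measurableEmbedding
    (fun z => inner ℝ (newtonField z) (newtonField (z - e)))
  rw [← this, fieldConst]
  refine integral_congr_ae (.of_forall fun z => ?_)
  simp only
  rw [← hR, ← map_sub, newtonField_map, newtonField_map, R.inner_map_map]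

/-- Translate x to the origin and scale by r = |x - y|: two factors r⁻² against the volume factor r³
leave r⁻¹. -/
theorem integral_inner_newtonField {x y : E3} (h : x ≠ y) :
    ∫ z, inner ℝ (newtonField (z - x)) (newtonField (z - y)) = fieldConst * newtonKernel (x - y) := by
  set r := ‖y - x‖
  have hr : 0 < r := norm_pos_iff.2 (sub_ne_zero.2 h.symm)
  set e := r⁻¹ • (y - x)
  have he : ‖e‖ = 1 := by simp [e, norm_smul, r]; exact inv_mul_cancel₀ hr.ne'
  have hre : r • e = y - x := by simp [e, smul_smul, mul_inv_cancel₀ hr.ne']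
  have h1 : ∫ z, inner ℝ (newtonField (z - x)) (newtonField (z - y)) =
      ∫ z, inner ℝ (newtonField z) (newtonField (z - r • e)) := by
    rw [← integral_sub_right_eq_self (fun z => inner ℝ (newtonField z) (newtonField (z - r • e))) x]
    simp [hre]
  have h2 := Measure.integral_comp_smul volume
    (fun z => inner ℝ (newtonField z) (newtonField (z - r • e))) r
  simp_rw [← smul_sub, newtonField_smul hr, real_inner_smul_left, real_inner_smul_right,
    integral_const_mul, integral_inner_newtonField_of_norm_eq_one he] at h2
  rw [h1]
  rw [finrank_euclideanSpace_fin, abs_of_pos (by positivity), smul_eq_mul] at h2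
  rw [newtonKernel, norm_sub_rev]
  change _ = fieldConst * r⁻¹
  field_simp at h2
  rw [h2]; field_simp

/-- The absolute version of the same scaling, needed to justify Fubini. The diagonal must be
excluded because `coulomb 0 = 0`. -/
theorem exists_lintegral_coulomb_sq_mul_sub_le : ∃ C : ℝ≥0∞, C < ⊤ ∧ ∀ x y : E3, x ≠ y →
    ∫⁻ z, coulomb (z - x) ^ 2 * coulomb (z - y) ^ 2 ≤ C * coulomb (x - y) := by
  obtain ⟨C, hC, hb⟩ := exists_lintegral_coulomb_sq_mul_le
  refine ⟨C, hC, fun x y h => ?_⟩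
  set r := ‖y - x‖
  have hr : 0 < r := norm_pos_iff.2 (sub_ne_zero.2 h.symm)
  set e := r⁻¹ • (y - x)
  have he : ‖e‖ = 1 := by simp [e, norm_smul, r]; exact inv_mul_cancel₀ hr.ne'
  have hre : r • e = y - x := by simp [e, smul_smul, mul_inv_cancel₀ hr.ne']
  have h1 : ∫⁻ z, coulomb (z - x) ^ 2 * coulomb (z - y) ^ 2 =
      ∫⁻ z, coulomb z ^ 2 * coulomb (z - r • e) ^ 2 := by
    rw [← lintegral_sub_right_eq_self (fun z => coulomb z ^ 2 * coulomb (z - r • e) ^ 2) x]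
    simp [hre]
  have h2 := lintegral_comp_smul (fun z => coulomb z ^ 2 * coulomb (z - r • e) ^ 2) hr
  simp_rw [← smul_sub, coulomb_smul hr.le, mul_pow] at h2
  have h3 : ∀ z : E3, ENNReal.ofReal r⁻¹ ^ 2 * coulomb z ^ 2 *
      (ENNReal.ofReal r⁻¹ ^ 2 * coulomb (z - e) ^ 2) =
      ENNReal.ofReal r⁻¹ ^ 4 * (coulomb z ^ 2 * coulomb (z - e) ^ 2) := fun z => by ring
  simp_rw [h3] at h2
  rw [lintegral_const_mul _ (by fun_prop)] at h2
  have h4 : coulomb (x - y) = ENNReal.ofReal r⁻¹ := by rw [coulomb_sub_comm]; rfl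
  rw [h1, h4]
  have h5 : ∀ X : ℝ≥0∞, X = ENNReal.ofReal (r ^ 3) * (ENNReal.ofReal (r ^ 3)⁻¹ * X) := fun X => by
    rw [← mul_assoc, ← ENNReal.ofReal_mul (by positivity), mul_inv_cancel₀ (by positivity)]
    simp
  rw [h5 (∫⁻ z, _), ← h2, ← mul_assoc, ← ENNReal.ofReal_pow (by positivity),
    ← ENNReal.ofReal_mul (by positivity), mul_comm C]
  refine mul_le_mul' (le_of_eq ?_) (hb e he)
  congr 1
  field_simp

end FieldKernel

/-! ### Coulomb energy as the L² inner product of fields. -/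

/-- The Coulomb energy `∫∫ ρ(x) σ(y) / |x - y| dx dy` of two densities. -/
def coulombEnergy (ρ σ : E3 → ℝ≥0∞) : ℝ≥0∞ := ∫⁻ x, ∫⁻ y, ρ x * σ y * coulomb (x - y)

section FieldEnergy

variable {ρ σ : E3 → ℝ}

/-- Integrating the absolute value over the field point first leaves a multiple of the Coulomb
energy of |ρ| and |σ|. -/
theorem integrable_inner_field_prod (hρ : Integrable ρ) (hσ : Integrable σ)
    (h : coulombEnergy (fun x => ‖ρ x‖ₑ) (fun x => ‖σ x‖ₑ) < ⊤) :
    Integrable (fun p : E3 × (E3 × E3) => ρ p.2.1 * σ p.2.2 *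
      inner ℝ (newtonField (p.1 - p.2.1)) (newtonField (p.1 - p.2.2))) := by
  obtain ⟨C, hC, hb⟩ := exists_lintegral_coulomb_sq_mul_sub_le
  have hm : AEStronglyMeasurable (fun p : E3 × (E3 × E3) => ρ p.2.1 * σ p.2.2 *
      inner ℝ (newtonField (p.1 - p.2.1)) (newtonField (p.1 - p.2.2))) := by
    refine ((hρ.1.comp_fst.mul hσ.1.comp_snd).comp_snd).mul ?_
    exact Measurable.aestronglyMeasurable (by fun_prop)
  refine ⟨hm, ?_⟩
  rw [HasFiniteIntegral]
  have hm2 : AEMeasurable (fun p : E3 × E3 => ‖ρ p.1‖ₑ * ‖σ p.2‖ₑ) :=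
    hρ.1.comp_fst.enorm.mul hσ.1.comp_snd.enorm
  calc ∫⁻ p : E3 × (E3 × E3), ‖ρ p.2.1 * σ p.2.2 *
      inner ℝ (newtonField (p.1 - p.2.1)) (newtonField (p.1 - p.2.2))‖ₑ
      ≤ ∫⁻ p : E3 × (E3 × E3), ‖ρ p.2.1‖ₑ * ‖σ p.2.2‖ₑ *
        (coulomb (p.1 - p.2.1) ^ 2 * coulomb (p.1 - p.2.2) ^ 2) := by
        refine lintegral_mono fun p => ?_
        simp only
        rw [enorm_mul, enorm_mul, ← enorm_newtonField, ← enorm_newtonField]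
        gcongr
        rw [← ofReal_norm, ← ofReal_norm, ← ofReal_norm, ← ENNReal.ofReal_mul (norm_nonneg _)]
        exact ENNReal.ofReal_le_ofReal (norm_inner_le_norm _ _)
    _ = ∫⁻ p : E3 × E3, ∫⁻ z, ‖ρ p.1‖ₑ * ‖σ p.2‖ₑ *
        (coulomb (z - p.1) ^ 2 * coulomb (z - p.2) ^ 2) :=
        lintegral_prod_symm _ (hm2.comp_snd.mul (Measurable.aemeasurable (by fun_prop)))
    _ = ∫⁻ p : E3 × E3, ‖ρ p.1‖ₑ * ‖σ p.2‖ₑ *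
        ∫⁻ z, (coulomb (z - p.1) ^ 2 * coulomb (z - p.2) ^ 2) := by
        refine lintegral_congr fun p => ?_
        rw [lintegral_const_mul _ (by fun_prop)]
    _ = ∫⁻ x, ∫⁻ y, ‖ρ x‖ₑ * ‖σ y‖ₑ *
        ∫⁻ z, (coulomb (z - x) ^ 2 * coulomb (z - y) ^ 2) := by
        refine lintegral_prod _ (hm2.mul (Measurable.aemeasurable ?_))
        exact Measurable.lintegral_prod_left' (f := fun q : E3 × (E3 × E3) =>
          coulomb (q.1 - q.2.1) ^ 2 * coulomb (q.1 - q.2.2) ^ 2) (by fun_prop)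
    _ ≤ ∫⁻ x, ∫⁻ y, C * (‖ρ x‖ₑ * ‖σ y‖ₑ * coulomb (x - y)) := by
        refine lintegral_mono fun x => lintegral_mono_ae ?_
        have hne : ∀ᵐ y : E3, y ≠ x := by simp [ae_iff]
        filter_upwards [hne] with y hy
        calc _ ≤ ‖ρ x‖ₑ * ‖σ y‖ₑ * (C * coulomb (x - y)) := by
              gcongr
              exact hb x y hy.symm
          _ = _ := by ring
    _ = C * coulombEnergy (fun x => ‖ρ x‖ₑ) (fun x => ‖σ x‖ₑ) := by
        simp_rw [lintegral_const_mul' _ _ hC.ne, coulombEnergy]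
    _ < ⊤ := ENNReal.mul_lt_top hC h

theorem ae_integral_inner_field_prod (hρ : Integrable ρ) (hσ : Integrable σ)
    (h : coulombEnergy (fun x => ‖ρ x‖ₑ) (fun x => ‖σ x‖ₑ) < ⊤) :
    (fun z => ∫ p : E3 × E3, ρ p.1 * σ p.2 *
      inner ℝ (newtonField (z - p.1)) (newtonField (z - p.2))) =ᵐ[volume]
      fun z => inner ℝ (field ρ z) (field σ z) := by
  filter_upwards [ae_integrable_field hρ, ae_integrable_field hσ,
    (integrable_inner_field_prod hρ hσ h).prod_right_ae] with z h1 h2 h3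
  rw [Measure.volume_eq_prod, integral_prod _ h3, field, ← real_inner_comm, ← integral_inner h1]
  refine integral_congr_ae (.of_forall fun x => ?_)
  simp only
  rw [real_inner_comm, field, ← integral_inner h2]
  refine integral_congr_ae (.of_forall fun y => ?_)
  simp only
  rw [real_inner_smul_left, real_inner_smul_right, mul_assoc]

/-- Multiply out the two convolutions and integrate over z first; each pair of points off the
diagonal then contributes `fieldConst` / |x - y|. -/
theorem integral_inner_field (hρ : Integrable ρ) (hσ : Integrable σ)
    (h : coulombEnergy (fun x => ‖ρ x‖ₑ) (fun x => ‖σ x‖ₑ) < ⊤) (hρ0 : 0 ≤ᵐ[volume] ρ)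
    (hσ0 : 0 ≤ᵐ[volume] σ) :
    ∫ z, inner ℝ (field ρ z) (field σ z) =
      fieldConst * (coulombEnergy (fun x => ‖ρ x‖ₑ) (fun x => ‖σ x‖ₑ)).toReal := by
  have hint := integrable_inner_field_prod hρ hσ h
  have hint2 : Integrable (fun p : E3 × E3 =>
      ∫ z, ρ p.1 * σ p.2 * inner ℝ (newtonField (z - p.1)) (newtonField (z - p.2))) :=
    hint.integral_prod_right
  have hm2 : AEMeasurable (fun p : E3 × E3 => ‖ρ p.1‖ₑ * ‖σ p.2‖ₑ * coulomb (p.1 - p.2)) :=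
    (hρ.1.comp_fst.enorm.mul hσ.1.comp_snd.enorm).mul (Measurable.aemeasurable (by fun_prop))
  have hE : coulombEnergy (fun x => ‖ρ x‖ₑ) (fun x => ‖σ x‖ₑ) =
      ∫⁻ p : E3 × E3, ‖ρ p.1‖ₑ * ‖σ p.2‖ₑ * coulomb (p.1 - p.2) := (lintegral_prod _ hm2).symm
  rw [← integral_congr_ae (ae_integral_inner_field_prod hρ hσ h)]
  rw [integral_integral_swap (f := fun z (p : E3 × E3) => ρ p.1 * σ p.2 *
      inner ℝ (newtonField (z - p.1)) (newtonField (z - p.2))) hint]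
  rw [hE, ← integral_toReal hm2 (ae_lt_top' hm2 (hE ▸ h).ne), ← integral_const_mul,
    Measure.volume_eq_prod, integral_prod _ hint2, integral_prod]
  · refine integral_congr_ae ?_
    filter_upwards [hρ0] with x hx
    refine integral_congr_ae ?_
    have hne : ∀ᵐ y : E3, y ≠ x := by simp [ae_iff]
    filter_upwards [hσ0, hne] with y hy hxy
    rw [integral_const_mul, integral_inner_newtonField hxy.symm, ← enorm_newtonKernel,
      ENNReal.toReal_mul, ENNReal.toReal_mul, toReal_enorm, toReal_enorm, toReal_enorm,
      Real.norm_of_nonneg hx, Real.norm_of_nonneg hy, Real.norm_of_nonneg]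
    · ring
    · exact inv_nonneg.2 (norm_nonneg _)
  · refine Integrable.const_mul ?_ _
    exact integrable_toReal_of_lintegral_ne_top hm2 (hE ▸ h).ne

theorem memLp_field (hρ : Integrable ρ)
    (h : coulombEnergy (fun x => ‖ρ x‖ₑ) (fun x => ‖ρ x‖ₑ) < ⊤) : MemLp (field ρ) 2 := by
  have hF := (hasWeakGradient_field hρ).locallyIntegrable_grad.aestronglyMeasurable
  rw [memLp_two_iff_integrable_sq_norm hF]
  have h1 : Integrable fun z => ∫ p : E3 × E3, ρ p.1 * ρ p.2 *
      inner ℝ (newtonField (z - p.1)) (newtonField (z - p.2)) :=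
    (integrable_inner_field_prod hρ hρ h).integral_prod_left
  refine (h1.congr (ae_integral_inner_field_prod hρ hρ h)).congr (.of_forall fun z => ?_)
  exact real_inner_self_eq_norm_sq _

/-- The indicator function of the unit ball. -/
def unitBallDensity : E3 → ℝ := (Metric.ball 0 1).indicator fun _ => 1

theorem integrable_unitBallDensity : Integrable unitBallDensity :=
  (integrable_indicator_iff Metric.isOpen_ball.measurableSet).2
    (integrableOn_const measure_ball_lt_top.ne)

theorem coulombEnergy_unitBallDensity_lt_top :
    coulombEnergy (fun x => ‖unitBallDensity x‖ₑ) (fun x => ‖unitBallDensity x‖ₑ) < ⊤ := by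
  set B : Set E3 := Metric.ball 0 1
  have hB : MeasurableSet B := Metric.isOpen_ball.measurableSet
  have he : ∀ x, ‖unitBallDensity x‖ₑ = B.indicator 1 x := fun x => by
    by_cases hx : x ∈ B
    · rw [unitBallDensity, indicator_of_mem hx, indicator_of_mem hx]; simp
    · rw [unitBallDensity, indicator_of_notMem hx, indicator_of_notMem hx]; simp
  have h1 : ∀ x y, ‖unitBallDensity x‖ₑ * ‖unitBallDensity y‖ₑ * coulomb (x - y) =
      B.indicator (fun _ => B.indicator (fun y => coulomb (y - x)) y) x := fun x y => by
    rw [he, he, coulomb_sub_comm]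
    by_cases hx : x ∈ B <;> by_cases hy : y ∈ B <;> simp [hx, hy]
  have h2 : ∀ x, ∫⁻ y, ‖unitBallDensity x‖ₑ * ‖unitBallDensity y‖ₑ * coulomb (x - y) ≤
      B.indicator (fun _ => coulombSqBall + 2 * volume B) x := fun x => by
    simp_rw [h1]
    by_cases hx : x ∈ B
    · simp only [indicator_of_mem hx]
      rw [lintegral_indicator hB]
      exact setLIntegral_coulomb_le B x
    · simp [hx]
  refine (lintegral_mono h2).trans_lt ?_
  rw [lintegral_indicator hB, setLIntegral_const]
  exact ENNReal.mul_lt_top (coulombSqBall_add_volume_lt_top 1) measure_ball_lt_top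

theorem inner_newtonField_pos {y z : E3} (hy : ‖y‖ < 1) (hz : 1 < z 0) :
    0 < inner ℝ (EuclideanSpace.single (0 : Fin 3) (1 : ℝ)) (newtonField (z - y)) := by
  have hy1 : y 0 < 1 := (le_abs_self _).trans_lt ((PiLp.norm_apply_le y 0).trans_lt hy)
  have hyz : 0 < (z - y) 0 := by rw [PiLp.sub_apply]; linarith
  have hne : z - y ≠ 0 := fun h => by rw [h] at hyz; simp at hyz
  have : 0 < ‖z - y‖ := norm_pos_iff.2 hne
  rw [newtonField, real_inner_smul_right, EuclideanSpace.inner_single_left]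
  simp only [map_one, one_mul]
  positivity

theorem field_unitBallDensity_ne_zero {z : E3} (hz : 1 < z 0)
    (hint : Integrable fun y => unitBallDensity y • newtonField (z - y)) :
    field unitBallDensity z ≠ 0 := by
  intro hz0
  set e : E3 := EuclideanSpace.single (0 : Fin 3) (1 : ℝ)
  have h3 : ∫ y, inner ℝ e (unitBallDensity y • newtonField (z - y)) = 0 := by
    rw [integral_inner hint]
    change inner ℝ e (field unitBallDensity z) = 0
    rw [hz0, inner_zero_right]
  have h4 : ∀ y ∈ Metric.ball (0 : E3) 1,
      0 < inner ℝ e (unitBallDensity y • newtonField (z - y)) := fun y hy => by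
    rw [unitBallDensity, indicator_of_mem hy, one_smul]
    exact inner_newtonField_pos (by simpa using hy) hz
  have h5 : ∀ y, 0 ≤ inner ℝ e (unitBallDensity y • newtonField (z - y)) := fun y => by
    by_cases hy : y ∈ Metric.ball (0 : E3) 1
    · exact (h4 y hy).le
    · rw [unitBallDensity, indicator_of_notMem hy, zero_smul, inner_zero_right]
  rw [integral_eq_zero_iff_of_nonneg h5 (hint.const_inner e)] at h3
  have h6 : volume (Metric.ball (0 : E3) 1) = 0 :=
    measure_mono_null (fun y hy => (h4 y hy).ne') h3
  exact (Metric.measure_ball_pos volume (0 : E3) one_pos).ne' h6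

/-- Otherwise the field of the unit ball would have L² norm zero. But on the half-space z₀ > 1 every
point of the ball lies on the same side of z, so the first component of the field is positive there.
No integral has to be evaluated. -/
theorem fieldConst_pos : 0 < fieldConst := by
  have hρ := integrable_unitBallDensity
  have hρ0 : 0 ≤ᵐ[volume] unitBallDensity :=
    .of_forall fun x => indicator_nonneg (fun _ _ => zero_le_one) x
  have hE := coulombEnergy_unitBallDensity_lt_top
  by_contra! hc
  have h1 := integral_inner_field hρ hρ hE hρ0 hρ0
  simp_rw [real_inner_self_eq_norm_sq] at h1
  have h2 : ∫ z, ‖field unitBallDensity z‖ ^ 2 = 0 :=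
    le_antisymm (h1 ▸ mul_nonpos_of_nonpos_of_nonneg hc ENNReal.toReal_nonneg)
      (integral_nonneg fun z => by positivity)
  have hF := (hasWeakGradient_field hρ).locallyIntegrable_grad.aestronglyMeasurable
  rw [integral_eq_zero_iff_of_nonneg (fun z => by positivity)
    ((memLp_two_iff_integrable_sq_norm hF).1 (memLp_field hρ hE))] at h2
  have hU : IsOpen {z : E3 | 1 < z 0} :=
    isOpen_lt continuous_const (by fun_prop)
  have hpos : 0 < volume {z : E3 | 1 < z 0} :=
    hU.measure_pos volume ⟨EuclideanSpace.single (0 : Fin 3) (2 : ℝ), by simp⟩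
  have hall : ∀ᵐ z : E3, ¬ 1 < z 0 := by
    filter_upwards [h2, ae_integrable_field hρ] with z hz hint h
    refine field_unitBallDensity_ne_zero h hint ?_
    simpa using hz
  simp only [ae_iff, not_not] at hall
  exact hpos.ne' hall

end FieldEnergy

/-! ### Bounds on interaction energies by mass and the 4/3 integral. -/

section Interaction

variable {ρ σ ρ' σ' : E3 → ℝ≥0∞} {κ κ' : E3 → ℝ≥0∞}

/-- The interaction energy of two densities for the pair interaction `κ`. -/
def kernelEnergy (κ : E3 → ℝ≥0∞) (ρ σ : E3 → ℝ≥0∞) : ℝ≥0∞ := ∫⁻ x, ∫⁻ y, ρ x * σ y * κ (x - y)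

theorem kernelEnergy_mono (hκ : κ ≤ κ') (hρ : ρ ≤ ρ') (hσ : σ ≤ σ') :
    kernelEnergy κ ρ σ ≤ kernelEnergy κ' ρ' σ' :=
  lintegral_mono fun x => lintegral_mono fun y =>
    mul_le_mul' (mul_le_mul' (hρ x) (hσ y)) (hκ (x - y))

theorem coulombEnergy_mono (hρ : ρ ≤ ρ') (hσ : σ ≤ σ') :
    coulombEnergy ρ σ ≤ coulombEnergy ρ' σ' := kernelEnergy_mono le_rfl hρ hσ

theorem coulombEnergy_comm (hρ : Measurable ρ) (hσ : Measurable σ) :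
    coulombEnergy ρ σ = coulombEnergy σ ρ := by
  rw [coulombEnergy, coulombEnergy, lintegral_lintegral_swap]
  · refine lintegral_congr fun x => lintegral_congr fun y => ?_
    rw [coulomb_sub_comm, mul_comm (ρ y)]
  · exact Measurable.aemeasurable (by fun_prop)

theorem kernelEnergy_add_kernel (hρ : Measurable ρ) (hσ : Measurable σ) (hκ : Measurable κ) :
    kernelEnergy (fun x => κ x + κ' x) ρ σ = kernelEnergy κ ρ σ + kernelEnergy κ' ρ σ := by
  simp_rw [kernelEnergy, mul_add]
  rw [← lintegral_add_left]
  · refine lintegral_congr fun x => lintegral_add_left (by fun_prop) _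
  · exact Measurable.lintegral_prod_right' (f := fun p : E3 × E3 => ρ p.1 * σ p.2 * κ (p.1 - p.2))
      (by fun_prop)

theorem coulombEnergy_add_left (hρ : Measurable ρ) (hσ : Measurable σ) :
    coulombEnergy (fun x => ρ x + ρ' x) σ = coulombEnergy ρ σ + coulombEnergy ρ' σ := by
  simp_rw [coulombEnergy, add_mul]
  rw [← lintegral_add_left]
  · refine lintegral_congr fun x => lintegral_add_left (by fun_prop) _
  · exact Measurable.lintegral_prod_right' (f := fun p : E3 × E3 => ρ p.1 * σ p.2 *
      coulomb (p.1 - p.2)) (by fun_prop)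

theorem coulombEnergy_add_right (hρ : Measurable ρ) (hσ : Measurable σ) (hσ' : Measurable σ') :
    coulombEnergy ρ (fun x => σ x + σ' x) = coulombEnergy ρ σ + coulombEnergy ρ σ' := by
  rw [coulombEnergy_comm hρ (by fun_prop), coulombEnergy_add_left hσ hρ, coulombEnergy_comm hσ hρ,
    coulombEnergy_comm hσ' hρ]

theorem coulombEnergy_add_self (hρ : Measurable ρ) (hσ : Measurable σ) :
    coulombEnergy (fun x => ρ x + σ x) (fun x => ρ x + σ x) =
      coulombEnergy ρ ρ + 2 * coulombEnergy ρ σ + coulombEnergy σ σ := by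
  rw [coulombEnergy_add_left hρ (by fun_prop), coulombEnergy_add_right hρ hρ hσ,
    coulombEnergy_add_right hσ hρ hσ, coulombEnergy_comm hσ hρ]
  ring

theorem kernelEnergy_le_of_le {c : ℝ≥0∞} (hc : ∀ x, κ x ≤ c) (hρ : Measurable ρ)
    (hσ : Measurable σ) : kernelEnergy κ ρ σ ≤ c * ((∫⁻ x, ρ x) * ∫⁻ x, σ x) := by
  calc kernelEnergy κ ρ σ ≤ ∫⁻ x, ∫⁻ y, ρ x * σ y * c :=
        lintegral_mono fun x => lintegral_mono fun y => by gcongr; exact hc _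
    _ = ∫⁻ x, ρ x * ((∫⁻ y, σ y) * c) := by
        refine lintegral_congr fun x => ?_
        simp_rw [mul_assoc]
        rw [lintegral_const_mul _ (by fun_prop), lintegral_mul_const _ hσ]
    _ = _ := by rw [lintegral_mul_const _ hρ]; ring

/-- Weighted AM–GM for a²b² and abk, followed by a²b² ≤ a⁴ + b⁴. Cubes and fourth powers stand for ρ
and ρ^(4/3), which keeps the inequality polynomial. -/
theorem real_cube_mul_cube_mul_le {a b k t : ℝ} (ht : 0 < t) :
    a ^ 3 * b ^ 3 * k ≤ t * (a ^ 4 * b ^ 4) + t⁻¹ * ((a ^ 4 + b ^ 4) * k ^ 2) := by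
  have h1 : a ^ 3 * b ^ 3 * k ≤ t * (a ^ 4 * b ^ 4) + t⁻¹ * (a ^ 2 * b ^ 2 * k ^ 2) := by
    have h := sq_nonneg (t * (a ^ 2 * b ^ 2) - a * b * k)
    have h0 : 0 ≤ t * (a ^ 4 * b ^ 4) + t⁻¹ * (a ^ 2 * b ^ 2 * k ^ 2) := by positivity
    have e : (t * (a ^ 2 * b ^ 2) - a * b * k) ^ 2 =
      t * (t * (a ^ 4 * b ^ 4) + t⁻¹ * (a ^ 2 * b ^ 2 * k ^ 2) - 2 * (a ^ 3 * b ^ 3 * k)) := by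
      field_simp; ring
    rw [e] at h
    have := nonneg_of_mul_nonneg_right h ht
    linarith
  have h2 : a ^ 2 * b ^ 2 ≤ a ^ 4 + b ^ 4 := by
    nlinarith [sq_nonneg (a ^ 2 - b ^ 2), sq_nonneg (a ^ 2), sq_nonneg (b ^ 2)]
  have h3 : t⁻¹ * (a ^ 2 * b ^ 2 * k ^ 2) ≤ t⁻¹ * ((a ^ 4 + b ^ 4) * k ^ 2) := by gcongr
  linarith

theorem mul_mul_le_rpow_four_thirds (a b : ℝ≥0∞) {k : ℝ≥0∞} (hk : k ≠ ⊤) {t : ℝ} (ht : 0 < t) :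
    a * b * k ≤ ENNReal.ofReal t * (a ^ (4 / 3 : ℝ) * b ^ (4 / 3 : ℝ)) +
      ENNReal.ofReal t⁻¹ * ((a ^ (4 / 3 : ℝ) + b ^ (4 / 3 : ℝ)) * k ^ 2) := by
  have htop : ∀ c : ℝ≥0∞, c ≠ 0 → c ^ (4 / 3 : ℝ) ≠ 0 := fun c hc h => hc
    ((ENNReal.rpow_eq_zero_iff_of_pos (by norm_num)).1 h)
  have ht' : ENNReal.ofReal t ≠ 0 := by simpa using ht
  rcases eq_or_ne a 0 with rfl | ha0
  · simp
  rcases eq_or_ne b 0 with rfl | hb0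
  · simp
  rcases eq_or_ne a ⊤ with rfl | ha
  · rw [ENNReal.top_rpow_of_pos (by norm_num), ENNReal.top_mul (htop b hb0), ENNReal.mul_top ht']
    simp
  rcases eq_or_ne b ⊤ with rfl | hb
  · rw [ENNReal.top_rpow_of_pos (by norm_num), ENNReal.mul_top (htop a ha0), ENNReal.mul_top ht']
    simp
  have hcube : ∀ c : ℝ≥0∞, c ≠ ⊤ → ∃ d : ℝ, 0 ≤ d ∧ c = ENNReal.ofReal (d ^ 3) ∧
      c ^ (4 / 3 : ℝ) = ENNReal.ofReal (d ^ 4) := fun c hc => by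
    refine ⟨c.toReal ^ (1 / 3 : ℝ), by positivity, ?_, ?_⟩
    · rw [← Real.rpow_natCast, ← Real.rpow_mul (by positivity)]
      norm_num [ENNReal.ofReal_toReal hc]
    · rw [← Real.rpow_natCast, ← Real.rpow_mul (by positivity),
        ← ENNReal.ofReal_rpow_of_nonneg (by positivity) (by norm_num), ENNReal.ofReal_toReal hc]
      norm_num
  obtain ⟨α, hα, ea, ea'⟩ := hcube a ha
  obtain ⟨β, hβ, eb, eb'⟩ := hcube b hb
  rw [ea', eb', ea, eb, ← ENNReal.ofReal_toReal hk]
  have hk0 : 0 ≤ k.toReal := ENNReal.toReal_nonneg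
  rw [← ENNReal.ofReal_mul (by positivity), ← ENNReal.ofReal_mul (by positivity),
    ← ENNReal.ofReal_mul (by positivity), ← ENNReal.ofReal_mul (by positivity),
    ← ENNReal.ofReal_add (by positivity) (by positivity), ← ENNReal.ofReal_pow (by positivity),
    ← ENNReal.ofReal_mul (by positivity), ← ENNReal.ofReal_mul (by positivity),
    ← ENNReal.ofReal_add (by positivity) (by positivity)]
  exact ENNReal.ofReal_le_ofReal (real_cube_mul_cube_mul_le ht)

/-- The integral of `ρ ^ (4/3)`. -/
def fourThirds (ρ : E3 → ℝ≥0∞) : ℝ≥0∞ := ∫⁻ x, ρ x ^ (4 / 3 : ℝ)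

/-- The Coulomb kernel cut off at distance `η`. -/
def nearCoulomb (η : ℝ) : E3 → ℝ≥0∞ := (Metric.ball 0 η).indicator coulomb

/-- The part of the Coulomb kernel at distance at least `L`. -/
def farCoulomb (L : ℝ) : E3 → ℝ≥0∞ := (Metric.ball 0 L)ᶜ.indicator coulomb

@[fun_prop]
theorem measurable_nearCoulomb (η : ℝ) : Measurable (nearCoulomb η) :=
  measurable_coulomb.indicator Metric.isOpen_ball.measurableSet

theorem nearCoulomb_lt_top (η : ℝ) (x : E3) : nearCoulomb η x < ⊤ :=
  (indicator_le_self _ _ x).trans_lt (coulomb_lt_top x)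

theorem nearCoulomb_add_farCoulomb (L : ℝ) (x : E3) :
    nearCoulomb L x + farCoulomb L x = coulomb x := indicator_self_add_compl_apply _ _ _

theorem farCoulomb_le {L : ℝ} (hL : 0 < L) (x : E3) : farCoulomb L x ≤ ENNReal.ofReal L⁻¹ := by
  by_cases hx : x ∈ Metric.ball (0 : E3) L
  · simp [farCoulomb, hx]
  · rw [farCoulomb, indicator_of_mem (by simpa using hx)]
    exact coulomb_le_of_le_norm hL (by simpa using hx)

theorem lintegral_nearCoulomb_sq {η : ℝ} (hη : 0 < η) :
    ∫⁻ x, nearCoulomb η x ^ 2 = ENNReal.ofReal η * coulombSqBall := by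
  rw [← lintegral_ball_coulomb_sq hη, ← lintegral_indicator Metric.isOpen_ball.measurableSet]
  refine lintegral_congr fun x => ?_
  by_cases hx : x ∈ Metric.ball (0 : E3) η <;> simp [nearCoulomb, hx]

/-- An elementary substitute for the Hardy–Littlewood–Sobolev inequality: the truncated kernel is
square integrable, with integral of order η. The free parameter t makes the first term small, after
which η takes care of the second. -/
theorem kernelEnergy_nearCoulomb_le (hρ : Measurable ρ) (hσ : Measurable σ) {t η : ℝ} (ht : 0 < t)
    (hη : 0 < η) : kernelEnergy (nearCoulomb η) ρ σ ≤
      ENNReal.ofReal t * (fourThirds ρ * fourThirds σ) +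
      ENNReal.ofReal t⁻¹ * ((fourThirds ρ + fourThirds σ) * (ENNReal.ofReal η * coulombSqBall)) := by
  have e1 : ∫⁻ x, ∫⁻ y, ρ x ^ (4 / 3 : ℝ) * σ y ^ (4 / 3 : ℝ) = fourThirds ρ * fourThirds σ := by
    simp_rw [lintegral_const_mul _ (hσ.pow_const (4 / 3 : ℝ))]
    rw [lintegral_mul_const _ (hρ.pow_const (4 / 3 : ℝ))]; rfl
  have e2 : ∀ τ : E3 → ℝ≥0∞, Measurable τ →
      ∫⁻ x, ∫⁻ y, τ x ^ (4 / 3 : ℝ) * nearCoulomb η (x - y) ^ 2 =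
      fourThirds τ * (ENNReal.ofReal η * coulombSqBall) := fun τ hτ => by
    have : ∀ x : E3, ∫⁻ y, nearCoulomb η (x - y) ^ 2 = ENNReal.ofReal η * coulombSqBall := fun x => by
      rw [lintegral_sub_left_eq_self (fun y => nearCoulomb η y ^ 2), lintegral_nearCoulomb_sq hη]
    have h2 : ∀ x : E3, ∫⁻ y, τ x ^ (4 / 3 : ℝ) * nearCoulomb η (x - y) ^ 2 =
        τ x ^ (4 / 3 : ℝ) * (ENNReal.ofReal η * coulombSqBall) := fun x => by
      rw [lintegral_const_mul _ (by fun_prop), this]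
    simp_rw [h2]
    rw [lintegral_mul_const _ (hτ.pow_const (4 / 3 : ℝ))]; rfl
  have e3 : ∫⁻ x, ∫⁻ y, σ y ^ (4 / 3 : ℝ) * nearCoulomb η (x - y) ^ 2 =
      fourThirds σ * (ENNReal.ofReal η * coulombSqBall) := by
    rw [← e2 σ hσ, lintegral_lintegral_swap (Measurable.aemeasurable (by fun_prop))]
    refine lintegral_congr fun x => lintegral_congr fun y => ?_
    rw [nearCoulomb]
    by_cases h : x - y ∈ Metric.ball (0 : E3) η
    · rw [indicator_of_mem h, indicator_of_mem (by simpa [norm_sub_rev] using h), coulomb_sub_comm]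
    · rw [indicator_of_notMem h, indicator_of_notMem (by simpa [norm_sub_rev] using h)]
  calc kernelEnergy (nearCoulomb η) ρ σ
      ≤ ∫⁻ x, ∫⁻ y, (ENNReal.ofReal t * (ρ x ^ (4 / 3 : ℝ) * σ y ^ (4 / 3 : ℝ)) +
        ENNReal.ofReal t⁻¹ * (ρ x ^ (4 / 3 : ℝ) * nearCoulomb η (x - y) ^ 2 +
          σ y ^ (4 / 3 : ℝ) * nearCoulomb η (x - y) ^ 2)) := by
        refine lintegral_mono fun x => lintegral_mono fun y => ?_
        simp only
        rw [← add_mul]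
        exact mul_mul_le_rpow_four_thirds _ _ (nearCoulomb_lt_top η _).ne ht
    _ = _ := by
        rw [add_mul, ← e1, ← e2 ρ hρ, ← e3, ← lintegral_const_mul' _ _ ENNReal.ofReal_ne_top,
          ← lintegral_add_left, ← lintegral_const_mul' _ _ ENNReal.ofReal_ne_top,
          ← lintegral_add_left]
        · refine lintegral_congr fun x => ?_
          rw [lintegral_add_left (by fun_prop), lintegral_const_mul' _ _ ENNReal.ofReal_ne_top,
            lintegral_const_mul' _ _ ENNReal.ofReal_ne_top, lintegral_add_left (by fun_prop)]
        · exact (Measurable.lintegral_prod_right' (f := fun p : E3 × E3 =>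
            ρ p.1 ^ (4 / 3 : ℝ) * σ p.2 ^ (4 / 3 : ℝ)) (by fun_prop)).const_mul _
        · exact (Measurable.lintegral_prod_right' (f := fun p : E3 × E3 =>
            ρ p.1 ^ (4 / 3 : ℝ) * nearCoulomb η (p.1 - p.2) ^ 2) (by fun_prop))

theorem exists_coulombEnergy_self_le : ∃ K : ℝ, 0 < K ∧ ∀ (ρ : E3 → ℝ≥0∞) (m a : ℝ), Measurable ρ →
    0 < m → 0 < a → ∫⁻ x, ρ x ≤ ENNReal.ofReal (m ^ 3) → fourThirds ρ ≤ ENNReal.ofReal a →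
    coulombEnergy ρ ρ ≤ ENNReal.ofReal (K * m ^ 2 * a) := by
  set J := coulombSqBall.toReal
  have hJ : coulombSqBall = ENNReal.ofReal J := (ENNReal.ofReal_toReal coulombSqBall_lt_top.ne).symm
  have hJ0 : 0 ≤ J := ENNReal.toReal_nonneg
  refine ⟨2 + 2 * J, by positivity, fun ρ m a hρ hm ha h1 h2 => ?_⟩
  -- With these choices t a², t⁻¹ a L and m⁶ / L are all equal to m² a. Here m is the cube root of a
  -- mass bound, so m² stands for its power 2/3.
  set L := m ^ 4 / a
  set t := m ^ 2 / a
  have hL : 0 < L := by positivity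
  have ht : 0 < t := by positivity
  calc coulombEnergy ρ ρ = kernelEnergy (fun x => nearCoulomb L x + farCoulomb L x) ρ ρ := by
        simp_rw [nearCoulomb_add_farCoulomb]; rfl
    _ = kernelEnergy (nearCoulomb L) ρ ρ + kernelEnergy (farCoulomb L) ρ ρ :=
        kernelEnergy_add_kernel hρ hρ (by fun_prop)
    _ ≤ (ENNReal.ofReal t * (fourThirds ρ * fourThirds ρ) +
          ENNReal.ofReal t⁻¹ * ((fourThirds ρ + fourThirds ρ) *
            (ENNReal.ofReal L * coulombSqBall))) +
        ENNReal.ofReal L⁻¹ * ((∫⁻ x, ρ x) * ∫⁻ x, ρ x) :=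
        add_le_add (kernelEnergy_nearCoulomb_le hρ hρ ht hL)
          (kernelEnergy_le_of_le (farCoulomb_le hL) hρ hρ)
    _ ≤ (ENNReal.ofReal t * (ENNReal.ofReal a * ENNReal.ofReal a) +
          ENNReal.ofReal t⁻¹ * ((ENNReal.ofReal a + ENNReal.ofReal a) *
            (ENNReal.ofReal L * ENNReal.ofReal J))) +
        ENNReal.ofReal L⁻¹ * (ENNReal.ofReal (m ^ 3) * ENNReal.ofReal (m ^ 3)) := by
        rw [hJ]; gcongr
    _ = ENNReal.ofReal (t * (a * a) + t⁻¹ * ((a + a) * (L * J)) + L⁻¹ * (m ^ 3 * m ^ 3)) := by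
        rw [ENNReal.ofReal_add (by positivity) (by positivity),
          ENNReal.ofReal_add (by positivity) (by positivity), ENNReal.ofReal_mul (by positivity),
          ENNReal.ofReal_mul (by positivity), ENNReal.ofReal_mul (by positivity),
          ENNReal.ofReal_mul (by positivity), ENNReal.ofReal_add (by positivity) (by positivity),
          ENNReal.ofReal_mul (by positivity), ENNReal.ofReal_mul (by positivity),
          ENNReal.ofReal_mul (by positivity)]
    _ = _ := by
        congr 1
        simp only [t, L]
        field_simp
        ring

end Interaction

/-! ### Limits in `[0, ∞]` by uniform approximation. -/

section ENNRealLimits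

theorem tendsto_of_approx {ι : Type*} {l : Filter ι} {a : ι → ℝ≥0∞} {a₀ : ℝ≥0∞}
    (h : ∀ ε : ℝ≥0∞, 0 < ε → ∃ (b : ι → ℝ≥0∞) (b₀ : ℝ≥0∞), Tendsto b l (𝓝 b₀) ∧
      (∀ i, b i ≤ a i ∧ a i ≤ b i + ε) ∧ b₀ ≤ a₀ ∧ a₀ ≤ b₀ + ε) : Tendsto a l (𝓝 a₀) := by
  refine tendsto_of_le_liminf_of_limsup_le ?_ ?_
  · refine ENNReal.le_of_forall_pos_le_add fun ε hε _ => ?_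
    obtain ⟨b, b₀, hb, h1, -, h3⟩ := h ε (by simpa using hε)
    refine h3.trans (add_le_add_left ?_ _)
    rcases l.eq_or_neBot with rfl | hl
    · simp
    rw [← hb.liminf_eq]
    exact liminf_le_liminf (.of_forall fun i => (h1 i).1)
  · rcases l.eq_or_neBot with rfl | hl
    · simp
    refine ENNReal.le_of_forall_pos_le_add fun ε hε _ => ?_
    obtain ⟨b, b₀, hb, h1, h2, -⟩ := h ε (by simpa using hε)
    calc limsup a l ≤ limsup (fun i => b i + ε) l :=
          limsup_le_limsup (.of_forall fun i => (h1 i).2)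
      _ = b₀ + ε := (hb.add_const _).limsup_eq
      _ ≤ a₀ + ε := by gcongr

theorem tendsto_of_le_add_of_le_add {ι : Type*} {l : Filter ι} {a b e : ι → ℝ≥0∞} {b₀ : ℝ≥0∞}
    (hb : Tendsto b l (𝓝 b₀)) (he : Tendsto e l (𝓝 0)) (hb₀ : b₀ ≠ ⊤)
    (h1 : ∀ i, a i ≤ b i + e i) (h2 : ∀ i, b i ≤ a i + e i) : Tendsto a l (𝓝 b₀) := by
  refine tendsto_of_tendsto_of_tendsto_of_le_of_le (g := fun i => b i - e i)
    (h := fun i => b i + e i) ?_ ?_ (fun i => tsub_le_iff_right.2 (h2 i)) h1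
  · simpa using ENNReal.Tendsto.sub hb he (Or.inl hb₀)
  · simpa using hb.add he

end ENNRealLimits

/-! ### Vague convergence of densities. -/

section VagueConvergence

variable {α : Type*} [NormedAddCommGroup α] [MeasureSpace α]

/-- Convergence of densities against bounded nonnegative measurable functions of bounded
support. -/
def VagueTendsto (ρ : ℕ → α → ℝ≥0∞) (ρ₀ : α → ℝ≥0∞) : Prop :=
  ∀ (ψ : α → ℝ≥0∞) (C : ℝ≥0∞) (R : ℝ), Measurable ψ → C < ⊤ → (∀ x, ψ x ≤ C) →
    (∀ x, R ≤ ‖x‖ → ψ x = 0) →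
    Tendsto (fun n => ∫⁻ x, ρ n x * ψ x) atTop (𝓝 (∫⁻ x, ρ₀ x * ψ x))

/-- Test functions need not be continuous, so a sharp cutoff yields another test function. -/
theorem VagueTendsto.indicator [OpensMeasurableSpace α] {ρ : ℕ → α → ℝ≥0∞} {ρ₀ : α → ℝ≥0∞}
    (h : VagueTendsto ρ ρ₀) {s : Set α} (hs : MeasurableSet s) :
    VagueTendsto (fun n => s.indicator (ρ n)) (s.indicator ρ₀) := by
  intro ψ C R hψ hC hb hz
  have e : ∀ τ : α → ℝ≥0∞, ∫⁻ x, s.indicator τ x * ψ x = ∫⁻ x, τ x * s.indicator ψ x := fun τ => by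
    refine lintegral_congr fun x => ?_
    by_cases hx : x ∈ s <;> simp [hx]
  simp_rw [e]
  refine h _ C R (hψ.indicator hs) hC (fun x => (indicator_le_self _ _ x).trans (hb x)) ?_
  intro x hx
  by_cases hxs : x ∈ s <;> simp [hxs, hz x hx]

theorem VagueTendsto.tendsto_setLIntegral [OpensMeasurableSpace α] {ρ : ℕ → α → ℝ≥0∞}
    {ρ₀ : α → ℝ≥0∞} (h : VagueTendsto ρ ρ₀) (R : ℝ) :
    Tendsto (fun n => ∫⁻ x in Metric.ball 0 R, ρ n x) atTop
      (𝓝 (∫⁻ x in Metric.ball 0 R, ρ₀ x)) := by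
  have hm : MeasurableSet (Metric.ball (0 : α) R) := Metric.isOpen_ball.measurableSet
  have e : ∀ τ : α → ℝ≥0∞, ∫⁻ x in Metric.ball 0 R, τ x =
      ∫⁻ x, τ x * (Metric.ball 0 R).indicator 1 x := fun τ => by
    rw [← lintegral_indicator hm]
    refine lintegral_congr fun x => ?_
    by_cases hx : x ∈ Metric.ball (0 : α) R
    · rw [indicator_of_mem hx, indicator_of_mem hx]; simp
    · rw [indicator_of_notMem hx, indicator_of_notMem hx]; simp
  simp_rw [e]
  refine h _ 1 R (measurable_one.indicator hm) (by simp) (fun x => ?_) fun x hx => ?_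
  · exact (indicator_le_self _ _ x)
  · exact indicator_of_notMem (by simpa using hx) _

end VagueConvergence

/-! ### Continuity of the Coulomb energy when one factor has bounded support. -/

section Compactness

variable {ρ σ : ℕ → E3 → ℝ≥0∞} {ρ₀ σ₀ : E3 → ℝ≥0∞}

/-- Since y ↦ κ(x - y) is a test function, the potentials g(σ_n) converge pointwise, and they are
uniformly bounded. On the ball carrying all ρ_n they therefore converge in L⁴, the dual of the space
L^(4/3) in which ρ_n is bounded. So σ_n may be replaced by σ₀, and then g(σ₀), cut to that ball,
serves as a test function for ρ_n. -/
theorem tendsto_kernelEnergy {κ : E3 → ℝ≥0∞} {C M A : ℝ≥0∞} {r L : ℝ} (hκ : Measurable κ)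
    (hC : C < ⊤) (hκC : ∀ x, κ x ≤ C) (hκL : ∀ x, L ≤ ‖x‖ → κ x = 0)
    (hρ : VagueTendsto ρ ρ₀) (hσ : VagueTendsto σ σ₀)
    (hρm : ∀ n, Measurable (ρ n)) (hσm : ∀ n, Measurable (σ n)) (hρ₀m : Measurable ρ₀)
    (hσ₀m : Measurable σ₀) (hM : M < ⊤) (hA : A < ⊤)
    (hσM : ∀ n, ∫⁻ x, σ n x ≤ M) (hσ₀M : ∫⁻ x, σ₀ x ≤ M) (hρ₀M : ∫⁻ x, ρ₀ x ≤ M)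
    (hρA : ∀ n, fourThirds (ρ n) ≤ A)
    (hρr : ∀ n x, r ≤ ‖x‖ → ρ n x = 0) (hρ₀r : ∀ x, r ≤ ‖x‖ → ρ₀ x = 0) :
    Tendsto (fun n => kernelEnergy κ (ρ n) (σ n)) atTop (𝓝 (kernelEnergy κ ρ₀ σ₀)) := by
  set B : Set E3 := Metric.ball 0 r
  have hB : MeasurableSet B := Metric.isOpen_ball.measurableSet
  set g : (E3 → ℝ≥0∞) → E3 → ℝ≥0∞ := fun τ x => ∫⁻ y, τ y * κ (x - y)
  have hg : ∀ τ, Measurable τ → Measurable (g τ) := fun τ hτ =>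
    Measurable.lintegral_prod_right' (f := fun p : E3 × E3 => τ p.2 * κ (p.1 - p.2)) (by fun_prop)
  have hgb : ∀ τ : E3 → ℝ≥0∞, Measurable τ → ∫⁻ x, τ x ≤ M → ∀ x, g τ x ≤ M * C := fun τ hτ h x => by
    calc g τ x ≤ ∫⁻ y, τ y * C := lintegral_mono fun y => by gcongr; exact hκC _
      _ = (∫⁻ y, τ y) * C := lintegral_mul_const _ hτ
      _ ≤ M * C := by gcongr
  have hMC : M * C < ⊤ := ENNReal.mul_lt_top hM hC
  have hlim : ∀ x, Tendsto (fun n => g (σ n) x) atTop (𝓝 (g σ₀ x)) := fun x => by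
    refine hσ (fun y => κ (x - y)) C (‖x‖ + L) (by fun_prop) hC (fun y => hκC _) fun y hy => hκL _ ?_
    have := norm_sub_norm_le y x
    rw [norm_sub_rev]; linarith
  -- Subtraction in `ℝ≥0∞` is truncated, so the sum of the two one-sided differences is the absolute
  -- difference.
  set d : ℕ → E3 → ℝ≥0∞ := fun n x => (g (σ n) x - g σ₀ x) + (g σ₀ x - g (σ n) x)
  have hdm : ∀ n, Measurable (d n) := fun n =>
    ((hg _ (hσm n)).sub (hg _ hσ₀m)).add ((hg _ hσ₀m).sub (hg _ (hσm n)))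
  have hdb : ∀ n x, d n x ≤ M * C + M * C := fun n x => add_le_add
    (tsub_le_self.trans (hgb _ (hσm n) (hσM n) x)) (tsub_le_self.trans (hgb _ hσ₀m hσ₀M x))
  have hdlim : ∀ x, Tendsto (fun n => d n x) atTop (𝓝 0) := fun x => by
    have hf : g σ₀ x ≠ ⊤ := ((hgb _ hσ₀m hσ₀M x).trans_lt hMC).ne
    have h1 := ENNReal.Tendsto.sub (hlim x) (tendsto_const_nhds (x := g σ₀ x)) (Or.inr hf)
    have h2 := ENNReal.Tendsto.sub (tendsto_const_nhds (x := g σ₀ x)) (hlim x) (Or.inl hf)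
    simpa using h1.add h2
  have he : ∀ τ υ : E3 → ℝ≥0∞, Measurable τ → Measurable υ →
      kernelEnergy κ τ υ = ∫⁻ x, τ x * g υ x := fun τ υ hτ hυ => by
    refine lintegral_congr fun x => ?_
    simp_rw [mul_assoc]
    rw [lintegral_const_mul _ (by fun_prop)]
  have hI : ∀ n, (∫⁻ x, ρ n x * d n x) ≤
      A ^ (3 / 4 : ℝ) * (∫⁻ x in B, d n x ^ (4 : ℝ)) ^ (1 / 4 : ℝ) := fun n => by
    have h1 : ∫⁻ x, ρ n x * d n x = ∫⁻ x in B, ρ n x * d n x := by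
      rw [← lintegral_indicator hB]
      refine lintegral_congr fun x => ?_
      by_cases hx : x ∈ B
      · rw [indicator_of_mem hx]
      · rw [indicator_of_notMem hx, hρr n x (by simpa [B] using hx), zero_mul]
    rw [h1]
    refine (ENNReal.lintegral_mul_le_Lp_mul_Lq (volume.restrict B) (p := 4 / 3) (q := 4)
      ⟨by norm_num, by norm_num, by norm_num⟩ (hρm n).aemeasurable (hdm n).aemeasurable).trans ?_
    norm_num only
    gcongr
    exact (setLIntegral_le_lintegral _ _).trans (hρA n)
  have hBlim : Tendsto (fun n => ∫⁻ x in B, d n x ^ (4 : ℝ)) atTop (𝓝 0) := by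
    have := tendsto_lintegral_of_dominated_convergence (μ := volume.restrict B)
      (F := fun n x => d n x ^ (4 : ℝ)) (f := fun _ => 0) (fun _ => (M * C + M * C) ^ (4 : ℝ))
      (fun n => (hdm n).pow_const _) (fun n => .of_forall fun x => ENNReal.rpow_le_rpow (hdb n x) (by norm_num)) ?_ ?_
    · simpa using this
    · rw [setLIntegral_const]
      exact (ENNReal.mul_lt_top (ENNReal.rpow_lt_top_of_nonneg (by norm_num)
        (ENNReal.add_lt_top.2 ⟨hMC, hMC⟩).ne) measure_ball_lt_top).ne
    · refine .of_forall fun x => ?_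
      have := (ENNReal.continuous_rpow_const (y := 4)).tendsto 0 |>.comp (hdlim x)
      simpa [Function.comp_def] using this
  have herr : Tendsto (fun n => ∫⁻ x, ρ n x * d n x) atTop (𝓝 0) := by
    refine tendsto_of_tendsto_of_tendsto_of_le_of_le tendsto_const_nhds ?_ (fun n => zero_le) hI
    have h1 := (ENNReal.continuous_rpow_const (y := 1 / 4)).tendsto 0 |>.comp hBlim
    have h2 := ENNReal.Tendsto.const_mul (a := A ^ (3 / 4 : ℝ)) h1
      (Or.inr (ENNReal.rpow_lt_top_of_nonneg (by norm_num) hA.ne).ne)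
    simpa using h2
  have hmain : Tendsto (fun n => ∫⁻ x, ρ n x * g σ₀ x) atTop (𝓝 (∫⁻ x, ρ₀ x * g σ₀ x)) := by
    have h := hρ (B.indicator (g σ₀)) (M * C) r ((hg _ hσ₀m).indicator hB) hMC
      (fun x => (indicator_le_self _ _ x).trans (hgb _ hσ₀m hσ₀M x))
      (fun x hx => indicator_of_notMem (by simpa [B] using hx) _)
    have e : ∀ τ : E3 → ℝ≥0∞, (∀ x, r ≤ ‖x‖ → τ x = 0) →
        ∫⁻ x, τ x * B.indicator (g σ₀) x = ∫⁻ x, τ x * g σ₀ x := fun τ hτ => by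
      refine lintegral_congr fun x => ?_
      by_cases hx : x ∈ B
      · rw [indicator_of_mem hx]
      · rw [hτ x (by simpa [B] using hx), zero_mul, zero_mul]
    simpa only [e _ hρ₀r, e _ (hρr _)] using h
  rw [he _ _ hρ₀m hσ₀m]
  simp_rw [fun n => he _ _ (hρm n) (hσm n)]
  refine tendsto_of_le_add_of_le_add hmain herr ?_ (fun n => ?_) (fun n => ?_)
  · refine ((lintegral_mono fun x => mul_le_mul_right (hgb _ hσ₀m hσ₀M x) (ρ₀ x)).trans_lt ?_).ne
    rw [lintegral_mul_const _ hρ₀m]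
    exact ENNReal.mul_lt_top (hρ₀M.trans_lt hM) hMC
  · have hm : Measurable fun x => ρ n x * g σ₀ x := (hρm n).mul (hg _ hσ₀m)
    rw [← lintegral_add_left hm]
    refine lintegral_mono fun x => ?_
    rw [← mul_add]
    gcongr
    exact le_add_tsub.trans (by rw [← add_assoc]; exact le_self_add)
  · have hm : Measurable fun x => ρ n x * g (σ n) x := (hρm n).mul (hg _ (hσm n))
    rw [← lintegral_add_left hm]
    refine lintegral_mono fun x => ?_
    rw [← mul_add]
    gcongr
    exact le_add_tsub.trans (add_le_add_right le_add_self _)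

/-- The part of the Coulomb kernel at distances between `η` and `L`. -/
def midCoulomb (η L : ℝ) : E3 → ℝ≥0∞ := (Metric.ball 0 η)ᶜ.indicator (nearCoulomb L)

theorem midCoulomb_le (η L : ℝ) : midCoulomb η L ≤ coulomb := fun x =>
  (indicator_le_self _ _ x).trans (indicator_le_self _ _ x)

theorem coulomb_le_near_add_mid_add_far (η L : ℝ) :
    coulomb ≤ fun x => midCoulomb η L x + (nearCoulomb η x + farCoulomb L x) := fun x => by
  change coulomb x ≤ midCoulomb η L x + (nearCoulomb η x + farCoulomb L x)
  by_cases h1 : x ∈ Metric.ball (0 : E3) η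
  · rw [nearCoulomb, indicator_of_mem h1]
    exact le_self_add.trans le_add_self
  · by_cases h2 : x ∈ Metric.ball (0 : E3) L
    · rw [midCoulomb, indicator_of_mem (mem_compl h1), nearCoulomb, indicator_of_mem h2]
      exact le_self_add
    · rw [farCoulomb, indicator_of_mem (mem_compl h2)]
      exact le_add_self.trans le_add_self

/-- Small `η` and large `L` make the near and far interactions small, uniformly on bounded sets
of densities. -/
theorem exists_near_add_far_le {M A ε : ℝ≥0∞} (hM : M < ⊤) (hA : A < ⊤) (hε : 0 < ε) :
    ∃ η L : ℝ, 0 < η ∧ 0 < L ∧ ∀ ρ σ : E3 → ℝ≥0∞, Measurable ρ → Measurable σ →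
      ∫⁻ x, ρ x ≤ M → ∫⁻ x, σ x ≤ M → fourThirds ρ ≤ A → fourThirds σ ≤ A →
      kernelEnergy (nearCoulomb η) ρ σ + kernelEnergy (farCoulomb L) ρ σ ≤ ε := by
  have hlim : ∀ c : ℝ≥0∞, c < ⊤ → ∀ δ : ℝ≥0∞, 0 < δ → ∃ t : ℝ, 0 < t ∧ ENNReal.ofReal t * c < δ := by
    intro c hc δ hδ
    have h1 : Tendsto (fun t : ℝ => ENNReal.ofReal t * c) (𝓝[>] 0) (𝓝 0) := by
      have := ENNReal.Tendsto.mul_const (b := c)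
        ((ENNReal.continuous_ofReal.tendsto 0).mono_left nhdsWithin_le_nhds)
        (Or.inr hc.ne) (f := 𝓝[>] (0 : ℝ))
      simpa using this
    obtain ⟨t, h2, h3⟩ := ((h1.eventually_lt_const hδ).and self_mem_nhdsWithin).exists
    exact ⟨t, h3, h2⟩
  have hε3 : 0 < ε / 3 := ENNReal.div_pos hε.ne' (by simp)
  -- The order matters: t is fixed first, since η has to beat the factor t⁻¹.
  obtain ⟨t, ht, ht2⟩ := hlim (A * A) (ENNReal.mul_lt_top hA hA) _ hε3
  obtain ⟨η, hη, hη2⟩ := hlim (ENNReal.ofReal t⁻¹ * ((A + A) * coulombSqBall))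
    (ENNReal.mul_lt_top ENNReal.ofReal_lt_top (ENNReal.mul_lt_top
      (ENNReal.add_lt_top.2 ⟨hA, hA⟩) coulombSqBall_lt_top)) _ hε3
  obtain ⟨l, hl, hl2⟩ := hlim (M * M) (ENNReal.mul_lt_top hM hM) _ hε3
  refine ⟨η, l⁻¹, hη, inv_pos.2 hl, fun ρ σ hρ hσ hρM hσM hρA hσA => ?_⟩
  calc kernelEnergy (nearCoulomb η) ρ σ + kernelEnergy (farCoulomb l⁻¹) ρ σ
      ≤ (ENNReal.ofReal t * (fourThirds ρ * fourThirds σ) +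
          ENNReal.ofReal t⁻¹ * ((fourThirds ρ + fourThirds σ) *
            (ENNReal.ofReal η * coulombSqBall))) +
        ENNReal.ofReal l⁻¹⁻¹ * ((∫⁻ x, ρ x) * ∫⁻ x, σ x) :=
        add_le_add (kernelEnergy_nearCoulomb_le hρ hσ ht hη)
          (kernelEnergy_le_of_le (farCoulomb_le (inv_pos.2 hl)) hρ hσ)
    _ ≤ (ENNReal.ofReal t * (A * A) + ENNReal.ofReal t⁻¹ * ((A + A) *
            (ENNReal.ofReal η * coulombSqBall))) + ENNReal.ofReal l * (M * M) := by
        rw [inv_inv]; gcongr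
    _ = (ENNReal.ofReal t * (A * A) + ENNReal.ofReal η * (ENNReal.ofReal t⁻¹ * ((A + A) *
            coulombSqBall))) + ENNReal.ofReal l * (M * M) := by ring
    _ ≤ ε / 3 + ε / 3 + ε / 3 := by gcongr
    _ = ε := ENNReal.add_thirds ε

/-- Short and long distances contribute little, uniformly in n; what remains of the kernel is
bounded with bounded support. -/
theorem tendsto_coulombEnergy {M A : ℝ≥0∞} {r : ℝ}
    (hρ : VagueTendsto ρ ρ₀) (hσ : VagueTendsto σ σ₀)
    (hρm : ∀ n, Measurable (ρ n)) (hσm : ∀ n, Measurable (σ n)) (hρ₀m : Measurable ρ₀)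
    (hσ₀m : Measurable σ₀) (hM : M < ⊤) (hA : A < ⊤)
    (hρM : ∀ n, ∫⁻ x, ρ n x ≤ M) (hσM : ∀ n, ∫⁻ x, σ n x ≤ M)
    (hσ₀M : ∫⁻ x, σ₀ x ≤ M) (hρ₀M : ∫⁻ x, ρ₀ x ≤ M)
    (hρA : ∀ n, fourThirds (ρ n) ≤ A) (hσA : ∀ n, fourThirds (σ n) ≤ A)
    (hρ₀A : fourThirds ρ₀ ≤ A) (hσ₀A : fourThirds σ₀ ≤ A)
    (hρr : ∀ n x, r ≤ ‖x‖ → ρ n x = 0) (hρ₀r : ∀ x, r ≤ ‖x‖ → ρ₀ x = 0) :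
    Tendsto (fun n => coulombEnergy (ρ n) (σ n)) atTop (𝓝 (coulombEnergy ρ₀ σ₀)) := by
  refine tendsto_of_approx fun ε hε => ?_
  obtain ⟨η, L, hη, hL, hnf⟩ := exists_near_add_far_le hM hA hε
  have hmid : Measurable (midCoulomb η L) :=
    (measurable_nearCoulomb L).indicator Metric.isOpen_ball.measurableSet.compl
  have hbound : ∀ τ υ : E3 → ℝ≥0∞, Measurable τ → Measurable υ → ∫⁻ x, τ x ≤ M → ∫⁻ x, υ x ≤ M →
      fourThirds τ ≤ A → fourThirds υ ≤ A →
      kernelEnergy (midCoulomb η L) τ υ ≤ coulombEnergy τ υ ∧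
      coulombEnergy τ υ ≤ kernelEnergy (midCoulomb η L) τ υ + ε :=
    fun τ υ hτ hυ h1 h2 h3 h4 => by
      refine ⟨kernelEnergy_mono (midCoulomb_le η L) le_rfl le_rfl, ?_⟩
      refine (kernelEnergy_mono (coulomb_le_near_add_mid_add_far η L) le_rfl le_rfl).trans ?_
      rw [kernelEnergy_add_kernel hτ hυ hmid,
        kernelEnergy_add_kernel hτ hυ (measurable_nearCoulomb η)]
      gcongr
      exact hnf τ υ hτ hυ h1 h2 h3 h4
  refine ⟨fun n => kernelEnergy (midCoulomb η L) (ρ n) (σ n), kernelEnergy (midCoulomb η L) ρ₀ σ₀,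
    ?_, fun n => hbound _ _ (hρm n) (hσm n) (hρM n) (hσM n) (hρA n) (hσA n),
    hbound _ _ hρ₀m hσ₀m hρ₀M hσ₀M hρ₀A hσ₀A⟩
  refine tendsto_kernelEnergy (C := ENNReal.ofReal η⁻¹) (L := L) hmid ENNReal.ofReal_lt_top
    (fun x => ?_) (fun x hx => ?_) hρ hσ hρm hσm hρ₀m hσ₀m hM hA hσM hσ₀M hρ₀M hρA hρr hρ₀r
  · by_cases hx : x ∈ Metric.ball (0 : E3) η
    · simp [midCoulomb, hx]
    · rw [midCoulomb, indicator_of_mem (by simpa using hx)]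
      exact (indicator_le_self _ _ x).trans (coulomb_le_of_le_norm hη (by simpa using hx))
  · have : nearCoulomb L x = 0 := indicator_of_notMem (by simpa using hx) _
    rw [midCoulomb]
    by_cases h : x ∈ (Metric.ball (0 : E3) η)ᶜ
    · rw [indicator_of_mem h, this]
    · rw [indicator_of_notMem h]

end Compactness

/-! ### Interpolation: the spatial density in L^(4/3). -/

/-- The spatial density of a phase space density, with values in `[0, ∞]`. -/
def spatialDensity (f : Phase → ℝ) (x : E3) : ℝ≥0∞ := ∫⁻ v, ENNReal.ofReal (f (x, v))

/-- The total mass of a phase space density, with values in `[0, ∞]`. -/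
def totalMass (f : Phase → ℝ) : ℝ≥0∞ := ∫⁻ z, ENNReal.ofReal (f z)

theorem measurable_spatialDensity {f : Phase → ℝ} (hf : Measurable f) :
    Measurable (spatialDensity f) :=
  Measurable.lintegral_prod_right' (f := fun z : Phase => ENNReal.ofReal (f z)) (by fun_prop)

theorem lintegral_spatialDensity {f : Phase → ℝ} (hf : Measurable f) :
    ∫⁻ x, spatialDensity f x = totalMass f :=
  (lintegral_prod (fun z : Phase => ENNReal.ofReal (f z)) (by fun_prop)).symm

section Interpolation

/-- For w ≥ b/e the first term suffices. For w < b/e either s ≤ (be)³ and the last term does, or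
s^(2/3) ≥ (be)² and the middle one does. -/
theorem real_sq_mul_le {b e w s : ℝ} (hb : 0 < b) (he : 0 < e) (hs : 0 ≤ s) :
    b ^ 2 * s ≤ e ^ 2 * (w ^ 2 * s) + (e ^ 2)⁻¹ * s ^ (5 / 3 : ℝ) +
      (if w < b / e then b ^ 5 * e ^ 3 else 0) := by
  have h0 : 0 ≤ s ^ (5 / 3 : ℝ) := by positivity
  split_ifs with h
  · have h1 : 0 ≤ e ^ 2 * (w ^ 2 * s) := by positivity
    rcases le_or_gt s (b ^ 3 * e ^ 3) with h2 | h2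
    · have : b ^ 2 * s ≤ b ^ 5 * e ^ 3 := by
        calc b ^ 2 * s ≤ b ^ 2 * (b ^ 3 * e ^ 3) := by gcongr
          _ = _ := by ring
      have : 0 ≤ (e ^ 2)⁻¹ * s ^ (5 / 3 : ℝ) := by positivity
      linarith
    · have hs' : 0 < s := lt_trans (by positivity) h2
      have h3 : b ^ 2 * e ^ 2 ≤ s ^ (2 / 3 : ℝ) := by
        have h4 : ((b * e) ^ 3) ^ (2 / 3 : ℝ) ≤ s ^ (2 / 3 : ℝ) := by
          apply Real.rpow_le_rpow (by positivity) (by rw [mul_pow]; exact h2.le) (by norm_num)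
        rw [← Real.rpow_natCast, ← Real.rpow_mul (by positivity)] at h4
        norm_num at h4
        rw [← mul_pow]
        exact_mod_cast h4
      have h5 : s ^ (5 / 3 : ℝ) = s ^ (2 / 3 : ℝ) * s := by
        rw [← Real.rpow_add_one hs'.ne']; norm_num
      have h6 : b ^ 2 * s ≤ (e ^ 2)⁻¹ * s ^ (5 / 3 : ℝ) := by
        rw [h5]
        calc b ^ 2 * s = (e ^ 2)⁻¹ * ((b ^ 2 * e ^ 2) * s) := by field_simp
          _ ≤ _ := by gcongr
      have : 0 ≤ b ^ 5 * e ^ 3 := by positivity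
      linarith
  · push Not at h
    have h1 : b ^ 2 ≤ e ^ 2 * w ^ 2 := by
      rw [← mul_pow]
      rw [div_le_iff₀ he] at h
      gcongr
      linarith
    have : 0 ≤ (e ^ 2)⁻¹ * s ^ (5 / 3 : ℝ) := by positivity
    nlinarith

/-- The volume of the unit ball. -/
def unitBallVolume : ℝ := (volume (Metric.ball (0 : E3) 1)).toReal

theorem unitBallVolume_pos : 0 < unitBallVolume :=
  ENNReal.toReal_pos (Metric.measure_ball_pos volume (0 : E3) one_pos).ne' measure_ball_lt_top.ne

theorem volume_ball_E3 (x : E3) {r : ℝ} (hr : 0 < r) :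
    volume (Metric.ball x r) = ENNReal.ofReal (r ^ 3 * unitBallVolume) := by
  rw [Measure.addHaar_ball_of_pos volume x hr, finrank_euclideanSpace_fin,
    ENNReal.ofReal_mul (by positivity), unitBallVolume, ENNReal.ofReal_toReal measure_ball_lt_top.ne]

/-- The pointwise inequality with w = |v|. The ball of radius b/e has volume proportional to (b/e)³,
so the error b⁵e³ integrates to a multiple of b⁸, independent of e. -/
theorem sq_mul_lintegral_le {g : E3 → ℝ} (hg : Measurable g) (hg0 : ∀ v, 0 ≤ g v) {b e : ℝ}
    (hb : 0 < b) (he : 0 < e) :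
    ENNReal.ofReal (b ^ 2) * ∫⁻ v, ENNReal.ofReal (g v) ≤
      ENNReal.ofReal (e ^ 2) * (∫⁻ v, ENNReal.ofReal (‖v‖ ^ 2 * g v)) +
      ENNReal.ofReal (e ^ 2)⁻¹ * (∫⁻ v, ENNReal.ofReal (g v ^ (5 / 3 : ℝ))) +
      ENNReal.ofReal (b ^ 8 * unitBallVolume) := by
  have hm : Measurable fun v => g v ^ (5 / 3 : ℝ) := hg.pow_const _
  have hB : MeasurableSet (Metric.ball (0 : E3) (b / e)) := Metric.isOpen_ball.measurableSet
  have hind : ∫⁻ v, (Metric.ball (0 : E3) (b / e)).indicator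
      (fun _ => ENNReal.ofReal (b ^ 5 * e ^ 3)) v = ENNReal.ofReal (b ^ 8 * unitBallVolume) := by
    rw [lintegral_indicator hB, setLIntegral_const, volume_ball_E3 _ (by positivity),
      ← ENNReal.ofReal_mul (by positivity)]
    congr 1
    field_simp
  rw [← hind, ← lintegral_const_mul' _ _ ENNReal.ofReal_ne_top,
    ← lintegral_const_mul' _ _ ENNReal.ofReal_ne_top,
    ← lintegral_const_mul' _ _ ENNReal.ofReal_ne_top, ← lintegral_add_left (by fun_prop),
    ← lintegral_add_left (by fun_prop)]
  refine lintegral_mono fun v => ?_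
  have h := real_sq_mul_le (w := ‖v‖) hb he (hg0 v)
  have hp : 0 ≤ g v ^ (5 / 3 : ℝ) := Real.rpow_nonneg (hg0 v) _
  have hv := hg0 v
  have e3 : (Metric.ball (0 : E3) (b / e)).indicator (fun _ => ENNReal.ofReal (b ^ 5 * e ^ 3)) v =
      ENNReal.ofReal (if ‖v‖ < b / e then b ^ 5 * e ^ 3 else 0) := by
    by_cases hv : v ∈ Metric.ball (0 : E3) (b / e)
    · rw [indicator_of_mem hv, if_pos (by simpa using hv)]
    · rw [indicator_of_notMem hv, if_neg (by simpa using hv), ENNReal.ofReal_zero]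
  rw [e3, ← ENNReal.ofReal_mul (by positivity), ← ENNReal.ofReal_mul (by positivity),
    ← ENNReal.ofReal_mul (by positivity), ← ENNReal.ofReal_add (by positivity) (by positivity),
    ← ENNReal.ofReal_add (by positivity) (by split_ifs <;> positivity)]
  exact ENNReal.ofReal_le_ofReal h

theorem exists_lintegral_rpow_four_thirds_le : ∃ C : ℝ, 0 < C ∧ ∀ (g : E3 → ℝ) (e : ℝ), Measurable g →
    (∀ v, 0 ≤ g v) → 0 < e → (∫⁻ v, ENNReal.ofReal (g v)) ^ (4 / 3 : ℝ) ≤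
      ENNReal.ofReal C * (ENNReal.ofReal (e ^ 2) * (∫⁻ v, ENNReal.ofReal (‖v‖ ^ 2 * g v)) +
      ENNReal.ofReal (e ^ 2)⁻¹ * (∫⁻ v, ENNReal.ofReal (g v ^ (5 / 3 : ℝ)))) := by
  have hω := unitBallVolume_pos
  set W := unitBallVolume
  refine ⟨2 * (2 * W) ^ (1 / 3 : ℝ), by positivity, fun g e hg hg0 he => ?_⟩
  set X := ENNReal.ofReal (e ^ 2) * (∫⁻ v, ENNReal.ofReal (‖v‖ ^ 2 * g v)) +
      ENNReal.ofReal (e ^ 2)⁻¹ * (∫⁻ v, ENNReal.ofReal (g v ^ (5 / 3 : ℝ)))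
  have key : ∀ b : ℝ, 0 < b → ENNReal.ofReal (b ^ 2) * ∫⁻ v, ENNReal.ofReal (g v) ≤
      X + ENNReal.ofReal (b ^ 8 * W) := fun b hb => sq_mul_lintegral_le hg hg0 hb he
  have hC : ENNReal.ofReal (2 * (2 * W) ^ (1 / 3 : ℝ)) ≠ 0 := by
    simp; positivity
  rcases eq_or_ne X ⊤ with hX | hX
  · rw [hX, ENNReal.mul_top hC]; exact le_top
  set ρ := ∫⁻ v, ENNReal.ofReal (g v)
  have hρ : ρ ≠ ⊤ := fun h => by
    have := key 1 one_pos
    rw [h] at this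
    simp [hX] at this
  rcases eq_or_ne ρ 0 with h0 | h0
  · rw [h0, ENNReal.zero_rpow_of_pos (by norm_num)]; exact zero_le
  set r := ρ.toReal
  have hr : 0 < r := ENNReal.toReal_pos h0 hρ
  have er : ρ = ENNReal.ofReal r := (ENNReal.ofReal_toReal hρ).symm
  have hx0 : 0 ≤ X.toReal := ENNReal.toReal_nonneg
  have ex : X = ENNReal.ofReal X.toReal := (ENNReal.ofReal_toReal hX).symm
  -- This b makes the error b⁸W equal to half of the left side b²r, so it is absorbed, while b²r is
  -- a multiple of r^(4/3).
  set b := (r / (2 * W)) ^ (1 / 6 : ℝ)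
  have hb : 0 < b := by positivity
  have hb6 : b ^ 6 = r / (2 * W) := by
    rw [← Real.rpow_natCast, ← Real.rpow_mul (by positivity)]; norm_num
  have hb2 : b ^ 2 = r ^ (1 / 3 : ℝ) / (2 * W) ^ (1 / 3 : ℝ) := by
    rw [← Real.rpow_natCast, ← Real.rpow_mul (by positivity),
      ← Real.div_rpow (by positivity) (by positivity)]
    norm_num
  have h := key b hb
  rw [er, ex, ← ENNReal.ofReal_mul (by positivity), ← ENNReal.ofReal_add hx0 (by positivity),
    ENNReal.ofReal_le_ofReal_iff (by positivity)] at h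
  have h8 : b ^ 8 * W = b ^ 2 * r / 2 := by
    calc b ^ 8 * W = b ^ 2 * b ^ 6 * W := by ring
      _ = _ := by rw [hb6]; field_simp
  have h43 : r ^ (4 / 3 : ℝ) = r ^ (1 / 3 : ℝ) * r := by
    rw [← Real.rpow_add_one hr.ne']; norm_num
  rw [er, ex, ← ENNReal.ofReal_mul (by positivity),
    ENNReal.ofReal_rpow_of_nonneg hr.le (by norm_num)]
  apply ENNReal.ofReal_le_ofReal
  have h9 : b ^ 2 * r ≤ 2 * X.toReal := by linarith
  rw [hb2, div_mul_eq_mul_div, div_le_iff₀ (by positivity), ← h43] at h9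
  linarith

theorem exists_fourThirds_spatialDensity_le : ∃ C : ℝ, 0 < C ∧ ∀ (f : Phase → ℝ) (e : ℝ),
    Measurable f → (∀ z, 0 ≤ f z) → 0 < e → fourThirds (spatialDensity f) ≤
      ENNReal.ofReal C * (ENNReal.ofReal (e ^ 2) * (∫⁻ z : Phase, ENNReal.ofReal (‖z.2‖ ^ 2 * f z)) +
      ENNReal.ofReal (e ^ 2)⁻¹ * (∫⁻ z, ENNReal.ofReal (f z ^ (5 / 3 : ℝ)))) := by
  obtain ⟨C, hC, h⟩ := exists_lintegral_rpow_four_thirds_le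
  refine ⟨C, hC, fun f e hf hf0 he => ?_⟩
  have hm : Measurable fun z => f z ^ (5 / 3 : ℝ) := hf.pow_const _
  have e1 : ∫⁻ z : Phase, ENNReal.ofReal (‖z.2‖ ^ 2 * f z) =
    ∫⁻ x, ∫⁻ v, ENNReal.ofReal (‖v‖ ^ 2 * f (x, v)) := lintegral_prod _ (by fun_prop)
  have e2 : ∫⁻ z : Phase, ENNReal.ofReal (f z ^ (5 / 3 : ℝ)) =
    ∫⁻ x, ∫⁻ v, ENNReal.ofReal (f (x, v) ^ (5 / 3 : ℝ)) := lintegral_prod _ (by fun_prop)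
  rw [e1, e2, ← lintegral_const_mul' _ _ ENNReal.ofReal_ne_top,
    ← lintegral_const_mul' _ _ ENNReal.ofReal_ne_top, ← lintegral_add_left,
    ← lintegral_const_mul' _ _ ENNReal.ofReal_ne_top]
  · exact lintegral_mono fun x => h (fun v => f (x, v)) e (by fun_prop) (fun v => hf0 _) he
  · exact (Measurable.lintegral_prod_right' (f := fun z : Phase => ENNReal.ofReal (‖z.2‖ ^ 2 * f z))
      (by fun_prop)).const_mul _

end Interpolation

/-! ### Control by the Casimir functional. -/

section Casimir

variable {Q : ℝ → ℝ} {C₁ C₂ F₀ k₁ k₂ k₃ : ℝ}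

/-- k₁ < 3/2 means that the growth exponent 1 + 1/k₁ exceeds 5/3: beyond a threshold N the function
Q wins with any prescribed factor, and below it s^(2/3) ≤ N^(2/3). -/
theorem CasimirAssumptions.exists_rpow_five_thirds_le (hQ : CasimirAssumptions Q C₁ C₂ F₀ k₁ k₂ k₃)
    {δ : ℝ} (hδ : 0 < δ) : ∃ C : ℝ, 0 < C ∧ ∀ s, 0 ≤ s → s ^ (5 / 3 : ℝ) ≤ δ * Q s + C * s := by
  have hk := hQ.k₁_pos
  have hC₁ := hQ.C₁_pos
  have hp : 0 < 1 + 1 / k₁ - 5 / 3 := by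
    have : 2 / 3 < 1 / k₁ := by
      rw [div_lt_div_iff₀ (by norm_num) hk]; linarith [hQ.k₁_lt]
    linarith
  set q := 1 + 1 / k₁ - 5 / 3
  obtain ⟨N, hN, hNF⟩ := (((tendsto_rpow_neg_atTop hp).eventually_lt_const
    (show 0 < δ * C₁ by positivity)).and (eventually_ge_atTop (max F₀ 1))).exists
  have hN1 : 0 < N := lt_of_lt_of_le one_pos ((le_max_right _ _).trans hNF)
  refine ⟨N ^ (2 / 3 : ℝ), by positivity, fun s hs => ?_⟩
  have hQs := hQ.nonneg s hs
  rcases le_or_gt N s with h | h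
  · have hs0 : 0 < s := hN1.trans_le h
    have h1 := hQ.growth_large s (((le_max_left _ _).trans hNF).trans h)
    have e1 : s ^ (5 / 3 : ℝ) = s ^ (1 + 1 / k₁) * s ^ (-q) := by
      rw [← Real.rpow_add hs0]; congr 1; simp only [q]; ring
    have h2 : s ^ (-q) ≤ N ^ (-q) := Real.rpow_le_rpow_of_nonpos hN1 h (by linarith)
    have h3 : 0 ≤ N ^ (2 / 3 : ℝ) * s := by positivity
    have h4 : s ^ (1 + 1 / k₁) * s ^ (-q) ≤ s ^ (1 + 1 / k₁) * (δ * C₁) := by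
      gcongr; exact h2.trans hN.le
    have h5 : δ * (C₁ * s ^ (1 + 1 / k₁)) ≤ δ * Q s := by gcongr
    rw [e1]; linarith
  · have h3 : 0 ≤ δ * Q s := by positivity
    rcases hs.eq_or_lt with rfl | hs0
    · rw [Real.zero_rpow (by norm_num)]; positivity
    have e1 : s ^ (5 / 3 : ℝ) = s ^ (2 / 3 : ℝ) * s := by
      rw [← Real.rpow_add_one hs0.ne']; norm_num
    have h4 : s ^ (2 / 3 : ℝ) * s ≤ N ^ (2 / 3 : ℝ) * s := by gcongr
    rw [e1]; linarith

theorem CasimirAssumptions.map_zero (hQ : CasimirAssumptions Q C₁ C₂ F₀ k₁ k₂ k₃) : Q 0 = 0 := by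
  have h1 := hQ.growth_small 0 le_rfl hQ.F₀_pos.le
  have hk := hQ.k₂_pos
  rw [Real.zero_rpow (by positivity), mul_zero] at h1
  exact le_antisymm h1 (hQ.nonneg 0 le_rfl)

theorem CasimirAssumptions.measurable_comp (hQ : CasimirAssumptions Q C₁ C₂ F₀ k₁ k₂ k₃)
    {α : Type*} [MeasurableSpace α] {f : α → ℝ} (hf : Measurable f) (hf0 : ∀ z, 0 ≤ f z) :
    Measurable fun z => Q (f z) := by
  -- Nothing is known about Q on negative arguments.
  have h1 : Continuous fun s : ℝ => Q (max s 0) :=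
    hQ.contDiffOn_one.continuousOn.comp_continuous (by fun_prop) fun s => mem_Ici.2 (le_max_right _ _)
  have h2 : (fun z => Q (f z)) = fun z => (fun s : ℝ => Q (max s 0)) (f z) := by
    funext z; simp [max_eq_left (hf0 z)]
  rw [h2]
  exact h1.measurable.comp hf

theorem kineticEnergy_eq (f : Phase → ℝ) : ∫⁻ z : Phase, ENNReal.ofReal (‖z.2‖ ^ 2 * f z) =
    ENNReal.ofReal 2 * kineticEnergy f := by
  rw [kineticEnergy, ← mul_assoc, ← ENNReal.ofReal_mul (by norm_num)]
  norm_num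

theorem CasimirAssumptions.lintegral_rpow_five_thirds_le
    (hQ : CasimirAssumptions Q C₁ C₂ F₀ k₁ k₂ k₃)
    {δ : ℝ} (hδ : 0 < δ) : ∃ C : ℝ, 0 < C ∧ ∀ f : Phase → ℝ, Measurable f → (∀ z, 0 ≤ f z) →
      ∫⁻ z, ENNReal.ofReal (f z ^ (5 / 3 : ℝ)) ≤
        ENNReal.ofReal δ * casimir Q f + ENNReal.ofReal C * totalMass f := by
  obtain ⟨C, hC, h⟩ := hQ.exists_rpow_five_thirds_le hδ
  refine ⟨C, hC, fun f hf hf0 => ?_⟩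
  rw [casimir, totalMass, ← lintegral_const_mul' _ _ ENNReal.ofReal_ne_top,
    ← lintegral_const_mul' _ _ ENNReal.ofReal_ne_top, ← lintegral_add_right _ (by fun_prop)]
  refine lintegral_mono fun z => ?_
  have := hQ.nonneg _ (hf0 z)
  have := hf0 z
  rw [← ENNReal.ofReal_mul hδ.le, ← ENNReal.ofReal_mul hC.le,
    ← ENNReal.ofReal_add (by positivity) (by positivity)]
  exact ENNReal.ofReal_le_ofReal (h _ (hf0 z))

theorem CasimirAssumptions.exists_fourThirds_le (hQ : CasimirAssumptions Q C₁ C₂ F₀ k₁ k₂ k₃)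
    {ε : ℝ} (hε : 0 < ε) : ∃ K : ℝ, 0 < K ∧ ∀ f : Phase → ℝ, Measurable f → (∀ z, 0 ≤ f z) →
      fourThirds (spatialDensity f) ≤
        ENNReal.ofReal ε * positivePart Q f + ENNReal.ofReal K * totalMass f := by
  obtain ⟨C, hC, h⟩ := exists_fourThirds_spatialDensity_le
  -- This e gives the kinetic energy the factor 2Ce² = ε; the choice δ = εe²/C below then gives the
  -- Casimir term the factor Ce⁻²δ = ε as well.
  set e := √(ε / (2 * C))
  have he : 0 < e := Real.sqrt_pos.2 (by positivity)
  have he2 : e ^ 2 = ε / (2 * C) := Real.sq_sqrt (by positivity)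
  obtain ⟨K, hK, h2⟩ := hQ.lintegral_rpow_five_thirds_le (δ := ε * e ^ 2 / C) (by positivity)
  refine ⟨C * (e ^ 2)⁻¹ * K, by positivity, fun f hf hf0 => (h f e hf hf0 he).trans ?_⟩
  calc _ ≤ ENNReal.ofReal C * (ENNReal.ofReal (e ^ 2) * (ENNReal.ofReal 2 * kineticEnergy f) +
        ENNReal.ofReal (e ^ 2)⁻¹ * (ENNReal.ofReal (ε * e ^ 2 / C) * casimir Q f +
          ENNReal.ofReal K * totalMass f)) := by
        rw [kineticEnergy_eq]
        gcongr
        exact h2 f hf hf0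
    _ = ENNReal.ofReal (C * (e ^ 2 * 2)) * kineticEnergy f +
        ENNReal.ofReal (C * (e ^ 2)⁻¹ * (ε * e ^ 2 / C)) * casimir Q f +
        ENNReal.ofReal (C * (e ^ 2)⁻¹ * K) * totalMass f := by
        rw [ENNReal.ofReal_mul hC.le, ENNReal.ofReal_mul (by positivity),
          ENNReal.ofReal_mul (by positivity), ENNReal.ofReal_mul hC.le,
          ENNReal.ofReal_mul (by positivity), ENNReal.ofReal_mul hC.le]
        ring
    _ = _ := by
        have e1 : C * (e ^ 2 * 2) = ε := by rw [he2]; field_simp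
        have e2 : C * (e ^ 2)⁻¹ * (ε * e ^ 2 / C) = ε := by field_simp
        rw [e1, e2, positivePart]
        ring

end Casimir

/-! ### Admissible densities and the energy as a real number. -/

/-- Phase space densities of finite mass and finite positive part of the energy, everywhere
measurable and nonnegative. -/
structure Admissible (Q : ℝ → ℝ) (f : Phase → ℝ) : Prop where
  measurable : Measurable f
  nonneg : ∀ z, 0 ≤ f z
  totalMass_lt_top : totalMass f < ⊤
  positivePart_lt_top : positivePart Q f < ⊤

/-- The Coulomb self-energy of a phase space density. -/
def selfEnergy (f : Phase → ℝ) : ℝ≥0∞ := coulombEnergy (spatialDensity f) (spatialDensity f)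

/-- The factor relating the potential energy to the Coulomb self-energy. -/
def couplingConst : ℝ := fieldConst / (8 * Real.pi)

theorem couplingConst_pos : 0 < couplingConst := div_pos fieldConst_pos (by positivity)

/-- The energy-Casimir functional as a real number. -/
def energy (Q : ℝ → ℝ) (f : Phase → ℝ) : ℝ :=
  (positivePart Q f).toReal - couplingConst * (selfEnergy f).toReal

theorem coulombEnergy_congr_ae {ρ ρ' σ σ' : E3 → ℝ≥0∞} (hρ : ρ =ᵐ[volume] ρ')
    (hσ : σ =ᵐ[volume] σ') : coulombEnergy ρ σ = coulombEnergy ρ' σ' := by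
  refine lintegral_congr_ae ?_
  filter_upwards [hρ] with x hx
  refine lintegral_congr_ae ?_
  filter_upwards [hσ] with y hy
  rw [hx, hy]

theorem coulombEnergy_eq_zero {ρ σ : E3 → ℝ≥0∞} (hρ : Measurable ρ) (h : ∫⁻ x, ρ x = 0) :
    coulombEnergy ρ σ = 0 := by
  rw [coulombEnergy_congr_ae ((lintegral_eq_zero_iff hρ).1 h) (ae_eq_refl σ)]
  simp [coulombEnergy]

namespace Admissible

variable {Q : ℝ → ℝ} {f g : Phase → ℝ} {C₁ C₂ F₀ k₁ k₂ k₃ : ℝ}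

theorem integrable (h : Admissible Q f) : Integrable f := by
  refine ⟨h.measurable.aestronglyMeasurable, ?_⟩
  rw [hasFiniteIntegral_iff_ofReal (.of_forall h.nonneg)]
  exact h.totalMass_lt_top

theorem ofReal_integral (h : Admissible Q f) : ENNReal.ofReal (∫ z, f z) = totalMass f :=
  ofReal_integral_eq_lintegral_ofReal h.integrable (.of_forall h.nonneg)

theorem density_eq (h : Admissible Q f) (x : E3) : density f x = (spatialDensity f x).toReal :=
  integral_eq_lintegral_of_nonneg_ae (.of_forall fun _ => h.nonneg _)
    (h.measurable.comp measurable_prodMk_left).aestronglyMeasurable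

theorem ae_spatialDensity_lt_top (h : Admissible Q f) : ∀ᵐ x, spatialDensity f x < ⊤ :=
  ae_lt_top (measurable_spatialDensity h.measurable)
    (by rw [lintegral_spatialDensity h.measurable]; exact h.totalMass_lt_top.ne)

theorem enorm_density (h : Admissible Q f) :
    (fun x => ‖density f x‖ₑ) =ᵐ[volume] spatialDensity f := by
  filter_upwards [h.ae_spatialDensity_lt_top] with x hx
  rw [h.density_eq, Real.enorm_eq_ofReal ENNReal.toReal_nonneg, ENNReal.ofReal_toReal hx.ne]

theorem density_nonneg (h : Admissible Q f) : 0 ≤ᵐ[volume] density f :=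
  .of_forall fun x => by rw [h.density_eq]; exact ENNReal.toReal_nonneg

/-- The self-energy is linear in the 4/3 integral at fixed mass, so the arbitrary factor available
there becomes the arbitrary η here. -/
theorem exists_selfEnergy_le (hQ : CasimirAssumptions Q C₁ C₂ F₀ k₁ k₂ k₃) {M η : ℝ} (hM : 0 < M)
    (hη : 0 < η) : ∃ K : ℝ, 0 < K ∧ ∀ f, Admissible Q f → totalMass f ≤ ENNReal.ofReal M →
      selfEnergy f ≤ ENNReal.ofReal (η * (positivePart Q f).toReal + K) := by
  obtain ⟨K, hK, h⟩ := exists_coulombEnergy_self_le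
  set m := M ^ (1 / 3 : ℝ)
  have hm : 0 < m := by positivity
  have hm3 : m ^ 3 = M := by
    rw [← Real.rpow_natCast, ← Real.rpow_mul hM.le]; norm_num
  obtain ⟨L, hL, hA⟩ := hQ.exists_fourThirds_le (ε := η / (K * m ^ 2)) (by positivity)
  refine ⟨K * m ^ 2 * (L * M), by positivity, fun f hf hfM => ?_⟩
  have hP0 : 0 ≤ (positivePart Q f).toReal := ENNReal.toReal_nonneg
  refine (h (spatialDensity f) m (η / (K * m ^ 2) * (positivePart Q f).toReal + L * M)
    (measurable_spatialDensity hf.measurable) hm (by positivity) ?_ ?_).trans (le_of_eq ?_)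
  · rw [lintegral_spatialDensity hf.measurable, hm3]; exact hfM
  · refine (hA f hf.measurable hf.nonneg).trans ?_
    rw [ENNReal.ofReal_add (by positivity) (by positivity), ENNReal.ofReal_mul (by positivity),
      ENNReal.ofReal_mul hL.le, ENNReal.ofReal_toReal hf.positivePart_lt_top.ne]
    gcongr
  · congr 1
    field_simp

theorem selfEnergy_lt_top (hQ : CasimirAssumptions Q C₁ C₂ F₀ k₁ k₂ k₃) (h : Admissible Q f) :
    selfEnergy f < ⊤ := by
  obtain ⟨K, -, hK⟩ := exists_selfEnergy_le hQ (M := (totalMass f).toReal + 1) (η := 1)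
    (by positivity) one_pos
  refine (hK f h ?_).trans_lt ENNReal.ofReal_lt_top
  rw [← ENNReal.ofReal_toReal h.totalMass_lt_top.ne]
  exact ENNReal.ofReal_le_ofReal (by simp)

theorem coulombEnergy_density (hf : Admissible Q f) (hg : Admissible Q g) :
    coulombEnergy (fun x => ‖density f x‖ₑ) (fun x => ‖density g x‖ₑ) =
      coulombEnergy (spatialDensity f) (spatialDensity g) :=
  coulombEnergy_congr_ae hf.enorm_density hg.enorm_density

theorem memLp_field (hQ : CasimirAssumptions Q C₁ C₂ F₀ k₁ k₂ k₃) (h : Admissible Q f) :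
    MemLp (field (density f)) 2 :=
  VlasovPoisson.memLp_field (integrable_density h.integrable)
    (by rw [h.coulombEnergy_density h]; exact h.selfEnergy_lt_top hQ)

theorem memLp_gradPotential (hQ : CasimirAssumptions Q C₁ C₂ F₀ k₁ k₂ k₃) (h : Admissible Q f) :
    MemLp (gradPotential f) 2 :=
  (memLp_congr_ae (gradPotential_ae_eq h.integrable)).2 (h.memLp_field hQ)

theorem potentialWellDefined (hQ : CasimirAssumptions Q C₁ C₂ F₀ k₁ k₂ k₃) (h : Admissible Q f) :
    PotentialWellDefined f :=
  potentialWellDefined_of_memLp h.integrable (h.memLp_field hQ)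

theorem integral_inner_gradPotential (hf : Admissible Q f)
    (hg : Admissible Q g) (h : coulombEnergy (spatialDensity f) (spatialDensity g) < ⊤) :
    ∫ x, inner ℝ (gradPotential f x) (gradPotential g x) =
      fieldConst * (coulombEnergy (spatialDensity f) (spatialDensity g)).toReal := by
  rw [← hf.coulombEnergy_density hg, ← integral_inner_field (integrable_density hf.integrable)
    (integrable_density hg.integrable) (by rwa [hf.coulombEnergy_density hg]) hf.density_nonneg
    hg.density_nonneg]
  refine integral_congr_ae ?_
  filter_upwards [gradPotential_ae_eq hf.integrable, gradPotential_ae_eq hg.integrable] with x h1 h2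
  rw [h1, h2]

/-- Both terms are finite, so extended arithmetic and weak gradients can be left behind. -/
theorem energyCasimir_eq (hQ : CasimirAssumptions Q C₁ C₂ F₀ k₁ k₂ k₃) (h : Admissible Q f) :
    energyCasimir Q f = (energy Q f : EReal) := by
  have hD := h.selfEnergy_lt_top hQ
  have h1 := h.integral_inner_gradPotential h hD
  simp_rw [real_inner_self_eq_norm_sq] at h1
  have hm := h.memLp_gradPotential hQ
  have h2 : ∫⁻ x, ‖gradPotential f x‖ₑ ^ 2 = ENNReal.ofReal (fieldConst * (selfEnergy f).toReal) := by
    rw [selfEnergy, ← h1, ofReal_integral_eq_lintegral_ofReal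
      ((memLp_two_iff_integrable_sq_norm hm.1).1 hm) (.of_forall fun x => by positivity)]
    refine lintegral_congr fun x => ?_
    rw [ENNReal.ofReal_pow (norm_nonneg _), ofReal_norm]
  have h3 : 0 ≤ fieldConst * (selfEnergy f).toReal :=
    mul_nonneg fieldConst_pos.le ENNReal.toReal_nonneg
  rw [energyCasimir, potentialEnergy, h2, ← ENNReal.ofReal_mul (by positivity),
    ← ENNReal.ofReal_toReal h.positivePart_lt_top.ne, EReal.coe_ennreal_ofReal,
    EReal.coe_ennreal_ofReal, max_eq_left ENNReal.toReal_nonneg, max_eq_left (by positivity), energy,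
    sub_eq_add_neg, EReal.coe_add, EReal.coe_neg]
  congr 3
  rw [couplingConst]
  ring

theorem exists_le_energy (hQ : CasimirAssumptions Q C₁ C₂ F₀ k₁ k₂ k₃) {M : ℝ} (hM : 0 < M) :
    ∃ K : ℝ, 0 < K ∧ ∀ f, Admissible Q f → totalMass f ≤ ENNReal.ofReal M →
      (positivePart Q f).toReal / 2 - K ≤ energy Q f := by
  have hc := couplingConst_pos
  -- With this η the negative term uses up at most half of P, apart from a constant.
  obtain ⟨K, hK, h⟩ := exists_selfEnergy_le hQ hM (η := 1 / (2 * couplingConst)) (by positivity)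
  refine ⟨couplingConst * K, by positivity, fun f hf hfM => ?_⟩
  have hP0 : 0 ≤ (positivePart Q f).toReal := ENNReal.toReal_nonneg
  have h1 := ENNReal.toReal_le_of_le_ofReal (by positivity) (h f hf hfM)
  have h2 : couplingConst * (selfEnergy f).toReal ≤
      couplingConst * (1 / (2 * couplingConst) * (positivePart Q f).toReal + K) := by gcongr
  have h3 : couplingConst * (1 / (2 * couplingConst) * (positivePart Q f).toReal + K) =
      (positivePart Q f).toReal / 2 + couplingConst * K := by field_simp
  rw [energy]
  linarith

theorem mem_constraintSet (h : Admissible Q f) {M : ℝ} (hM : 0 ≤ M)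
    (hf : totalMass f = ENNReal.ofReal M) : f ∈ constraintSet Q M := by
  refine ⟨h.integrable, .of_forall h.nonneg, ?_, h.positivePart_lt_top⟩
  rw [← h.ofReal_integral, ENNReal.ofReal_eq_ofReal_iff (integral_nonneg h.nonneg) hM] at hf
  exact hf

end Admissible

/-! ### Invariance under changes on null sets. -/

section Congr

variable {Q : ℝ → ℝ} {f g : Phase → ℝ}

theorem density_congr_ae (h : f =ᵐ[volume] g) : density f =ᵐ[volume] density g := by
  filter_upwards [Measure.ae_ae_of_ae_prod h] with x hx
  exact integral_congr_ae hx

theorem potential_congr_ae (h : f =ᵐ[volume] g) : potential f = potential g := by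
  funext x
  rw [potential, potential, convolution_def, convolution_def]
  congr 1
  refine integral_congr_ae ?_
  filter_upwards [density_congr_ae h] with y hy
  rw [hy]

theorem gradPotential_congr_ae (h : f =ᵐ[volume] g) : gradPotential f = gradPotential g := by
  rw [gradPotential, gradPotential, potential_congr_ae h]

theorem positivePart_congr_ae (h : f =ᵐ[volume] g) : positivePart Q f = positivePart Q g := by
  rw [positivePart, positivePart, casimir, casimir, kineticEnergy, kineticEnergy]
  congr 1
  · refine lintegral_congr_ae ?_
    filter_upwards [h] with z hz
    rw [hz]
  · congr 1
    refine lintegral_congr_ae ?_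
    filter_upwards [h] with z hz
    rw [hz]

theorem energyCasimir_congr_ae (h : f =ᵐ[volume] g) : energyCasimir Q f = energyCasimir Q g := by
  rw [energyCasimir, energyCasimir, positivePart_congr_ae h, potentialEnergy, potentialEnergy,
    gradPotential_congr_ae h]

theorem PotentialWellDefined.congr_ae (hf : PotentialWellDefined f) (h : f =ᵐ[volume] g) :
    PotentialWellDefined g where
  convolutionExists := by
    filter_upwards [hf.convolutionExists] with x hx
    refine Integrable.congr hx ?_
    filter_upwards [density_congr_ae h] with y hy
    rw [hy]
  hasWeakGradient := by
    rw [← potential_congr_ae h, ← gradPotential_congr_ae h]; exact hf.hasWeakGradient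
  memLp_grad := by rw [← gradPotential_congr_ae h]; exact hf.memLp_grad

theorem exists_admissible_ae_eq {M : ℝ} (hf : f ∈ constraintSet Q M) :
    ∃ g, f =ᵐ[volume] g ∧ Admissible Q g ∧ totalMass g = ENNReal.ofReal M := by
  obtain ⟨hint, h0, hM, hP⟩ := hf
  set g : Phase → ℝ := fun z => max (hint.1.mk f z) 0
  have hg : f =ᵐ[volume] g := by
    filter_upwards [hint.1.ae_eq_mk, h0] with z h1 h2
    simp only [g, ← h1]
    exact (max_eq_left h2).symm
  have hgm : Measurable g := hint.1.stronglyMeasurable_mk.measurable.max measurable_const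
  have hmass : totalMass g = ENNReal.ofReal M := by
    rw [← hM, integral_congr_ae hg, ofReal_integral_eq_lintegral_ofReal (hint.congr hg)
      (.of_forall fun z => le_max_right _ _)]
    rfl
  exact ⟨g, hg, ⟨hgm, fun z => le_max_right _ _, hmass ▸ ENNReal.ofReal_lt_top,
    positivePart_congr_ae hg ▸ hP⟩, hmass⟩

end Congr

/-! ### Dilation in the space variable. -/

section Dilation

variable {Q : ℝ → ℝ} {f : Phase → ℝ} {a : ℝ}

/-- Dilation of a phase space density in the space variable. -/
def dilate (a : ℝ) (f : Phase → ℝ) : Phase → ℝ := fun z => f (a • z.1, z.2)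

theorem lintegral_dilate {F : Phase → ℝ≥0∞} (hF : Measurable F) (ha : 0 < a) :
    ∫⁻ z : Phase, F (a • z.1, z.2) = ENNReal.ofReal (a ^ 3)⁻¹ * ∫⁻ z, F z := by
  rw [Measure.volume_eq_prod, lintegral_prod_symm _ (by fun_prop), lintegral_prod_symm _ (by fun_prop),
    ← lintegral_const_mul _ (hF.lintegral_prod_left' (μ := volume))]
  exact lintegral_congr fun v => lintegral_comp_smul (fun x => F (x, v)) ha

theorem totalMass_dilate (hf : Measurable f) (ha : 0 < a) :
    totalMass (dilate a f) = ENNReal.ofReal (a ^ 3)⁻¹ * totalMass f :=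
  lintegral_dilate (F := fun z => ENNReal.ofReal (f z)) (by fun_prop) ha

theorem positivePart_dilate (hf : Measurable f) (hQf : Measurable fun z => Q (f z)) (ha : 0 < a) :
    positivePart Q (dilate a f) = ENNReal.ofReal (a ^ 3)⁻¹ * positivePart Q f := by
  have h1 := lintegral_dilate (F := fun z => ENNReal.ofReal (Q (f z))) hQf.ennreal_ofReal ha
  have h2 := lintegral_dilate (F := fun z => ENNReal.ofReal (‖z.2‖ ^ 2 * f z)) (by fun_prop) ha
  simp only [positivePart, casimir, kineticEnergy, dilate, h1, h2, mul_add]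
  ring

/-- Each of the two space integrals gives a⁻³ and the kernel gives back one factor a. -/
theorem selfEnergy_dilate (hf : Measurable f) (ha : 0 < a) :
    selfEnergy (dilate a f) = ENNReal.ofReal (a ^ 5)⁻¹ * selfEnergy f := by
  have hρ := measurable_spatialDensity hf
  have h1 : ∀ x y : E3, spatialDensity (dilate a f) x * spatialDensity (dilate a f) y *
      coulomb (x - y) = ENNReal.ofReal a * (spatialDensity f (a • x) * spatialDensity f (a • y) *
        coulomb (a • x - a • y)) := fun x y => by
    have : ENNReal.ofReal a * ENNReal.ofReal a⁻¹ = 1 := by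
      rw [← ENNReal.ofReal_mul ha.le, mul_inv_cancel₀ ha.ne', ENNReal.ofReal_one]
    rw [← smul_sub, coulomb_smul ha.le]
    calc _ = (ENNReal.ofReal a * ENNReal.ofReal a⁻¹) * (spatialDensity f (a • x) *
          spatialDensity f (a • y) * coulomb (x - y)) := by rw [this, one_mul]; rfl
      _ = _ := by ring
  simp only [selfEnergy, coulombEnergy, h1]
  have h2 : ∀ x : E3, ∫⁻ y, ENNReal.ofReal a * (spatialDensity f (a • x) * spatialDensity f (a • y) *
        coulomb (a • x - a • y)) = ENNReal.ofReal a * (ENNReal.ofReal (a ^ 3)⁻¹ *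
        ∫⁻ y, spatialDensity f (a • x) * spatialDensity f y * coulomb (a • x - y)) := fun x => by
    rw [lintegral_const_mul' _ _ ENNReal.ofReal_ne_top,
      lintegral_comp_smul (fun y => spatialDensity f (a • x) * spatialDensity f y *
        coulomb (a • x - y)) ha]
  simp only [h2]
  rw [lintegral_const_mul' _ _ ENNReal.ofReal_ne_top,
    lintegral_const_mul' _ _ ENNReal.ofReal_ne_top,
    lintegral_comp_smul (fun x => ∫⁻ y, spatialDensity f x * spatialDensity f y *
        coulomb (x - y)) ha, ← mul_assoc, ← mul_assoc, ← ENNReal.ofReal_mul ha.le,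
    ← ENNReal.ofReal_mul (by positivity)]
  congr 2
  field_simp

end Dilation

/-! ### Test densities of negative energy. -/

/-- Two points of a ball of radius R are at distance at most 2R. -/
theorem le_coulombEnergy_of_support {ρ : E3 → ℝ≥0∞} (hρ : Measurable ρ) {R : ℝ}
    (h : ∀ x, R ≤ ‖x‖ → ρ x = 0) :
    ENNReal.ofReal (2 * R)⁻¹ * ((∫⁻ x, ρ x) * ∫⁻ x, ρ x) ≤ coulombEnergy ρ ρ := by
  have e : ENNReal.ofReal (2 * R)⁻¹ * ((∫⁻ x, ρ x) * ∫⁻ x, ρ x) =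
      ∫⁻ x, ∫⁻ y, ρ x * ρ y * ENNReal.ofReal (2 * R)⁻¹ := by
    have h1 : ∀ x, ∫⁻ y, ρ x * ρ y * ENNReal.ofReal (2 * R)⁻¹ =
        ρ x * ((∫⁻ y, ρ y) * ENNReal.ofReal (2 * R)⁻¹) := fun x => by
      simp_rw [mul_assoc]
      rw [lintegral_const_mul _ (by fun_prop), lintegral_mul_const _ hρ]
    simp_rw [h1]
    rw [lintegral_mul_const _ hρ]
    ring
  rw [e]
  refine lintegral_mono fun x => lintegral_mono_ae ?_
  have hne : ∀ᵐ y : E3, y ≠ x := by simp [ae_iff]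
  filter_upwards [hne] with y hy
  rcases le_or_gt R ‖x‖ with hx | hx
  · rw [h x hx]; simp
  rcases le_or_gt R ‖y‖ with hy' | hy'
  · rw [h y hy']; simp
  gcongr
  refine le_coulomb_of_norm_le (sub_ne_zero.2 hy.symm) ?_
  linarith [norm_sub_le x y]

section Block

variable {Q : ℝ → ℝ} {C₁ C₂ F₀ k₁ k₂ k₃ : ℝ}

/-- A constant density on the product of two balls. -/
def block (α R V : ℝ) : Phase → ℝ :=
  (Metric.ball (0 : E3) R ×ˢ Metric.ball (0 : E3) V).indicator fun _ => α

theorem measurableSet_ball_prod (R V : ℝ) :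
    MeasurableSet (Metric.ball (0 : E3) R ×ˢ Metric.ball (0 : E3) V) :=
  Metric.isOpen_ball.measurableSet.prod Metric.isOpen_ball.measurableSet

theorem lintegral_block {F : ℝ → ℝ≥0∞} (hF : F 0 = 0) {α R V : ℝ} (hR : 0 < R) (hV : 0 < V) :
    ∫⁻ z, F (block α R V z) = F α * ENNReal.ofReal ((R * V) ^ 3 * unitBallVolume ^ 2) := by
  have h : ∀ z, F (block α R V z) =
      (Metric.ball (0 : E3) R ×ˢ Metric.ball (0 : E3) V).indicator (fun _ => F α) z := fun z => by
    rw [block]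
    by_cases hz : z ∈ Metric.ball (0 : E3) R ×ˢ Metric.ball (0 : E3) V
    · rw [indicator_of_mem hz, indicator_of_mem hz]
    · rw [indicator_of_notMem hz, indicator_of_notMem hz, hF]
  have hW := unitBallVolume_pos
  simp_rw [h]
  rw [lintegral_indicator (measurableSet_ball_prod R V), setLIntegral_const, Measure.volume_eq_prod,
    Measure.prod_prod, volume_ball_E3 _ hR, volume_ball_E3 _ hV, ← ENNReal.ofReal_mul (by positivity)]
  congr 2
  ring

theorem measurable_block (α R V : ℝ) : Measurable (block α R V) :=
  measurable_const.indicator (measurableSet_ball_prod R V)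

theorem block_nonneg {α : ℝ} (hα : 0 ≤ α) (R V : ℝ) (z : Phase) : 0 ≤ block α R V z :=
  indicator_nonneg (fun _ _ => hα) z

theorem block_bounds (hQ : CasimirAssumptions Q C₁ C₂ F₀ k₁ k₂ k₃) {α R V M : ℝ} (hα : 0 < α)
    (hαF : α ≤ F₀) (hR : 0 < R) (hV : 0 < V)
    (hM : α * ((R * V) ^ 3 * unitBallVolume ^ 2) = M) :
    Admissible Q (block α R V) ∧ totalMass (block α R V) = ENNReal.ofReal M ∧
      energy Q (block α R V) ≤ C₂ * M * α ^ (1 / k₂) + M * V ^ 2 / 2 -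
        couplingConst * (M ^ 2 * (2 * R)⁻¹) := by
  have hW := unitBallVolume_pos
  have hM0 : 0 < M := by rw [← hM]; positivity
  have hmass : totalMass (block α R V) = ENNReal.ofReal M := by
    rw [totalMass, lintegral_block ENNReal.ofReal_zero hR hV, ← ENNReal.ofReal_mul hα.le, hM]
  have hC₂ := hQ.C₂_pos
  have hcas : casimir Q (block α R V) ≤ ENNReal.ofReal (C₂ * M * α ^ (1 / k₂)) := by
    rw [casimir, lintegral_block (F := fun s => ENNReal.ofReal (Q s)) (by simp [hQ.map_zero]) hR hV,
      ← ENNReal.ofReal_mul (hQ.nonneg _ hα.le)]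
    apply ENNReal.ofReal_le_ofReal
    calc Q α * ((R * V) ^ 3 * unitBallVolume ^ 2)
        ≤ C₂ * α ^ (1 + 1 / k₂) * ((R * V) ^ 3 * unitBallVolume ^ 2) := by
          gcongr
          exact hQ.growth_small α hα.le hαF
      _ = C₂ * (α * ((R * V) ^ 3 * unitBallVolume ^ 2)) * α ^ (1 / k₂) := by
          rw [Real.rpow_add hα, Real.rpow_one]; ring
      _ = _ := by rw [hM]
  have hkin : kineticEnergy (block α R V) ≤ ENNReal.ofReal (M * V ^ 2 / 2) := by
    calc kineticEnergy (block α R V) ≤ ENNReal.ofReal (1 / 2) *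
          ∫⁻ z, ENNReal.ofReal (V ^ 2) * ENNReal.ofReal (block α R V z) := by
          rw [kineticEnergy]
          gcongr with z
          rw [← ENNReal.ofReal_mul (by positivity)]
          apply ENNReal.ofReal_le_ofReal
          by_cases hz : z ∈ Metric.ball (0 : E3) R ×ˢ Metric.ball (0 : E3) V
          · have h1 : ‖z.2‖ < V := by simpa using hz.2
            have h2 := block_nonneg hα.le R V z
            gcongr
          · rw [block, indicator_of_notMem hz]; simp
      _ = _ := by
          rw [lintegral_const_mul' _ _ ENNReal.ofReal_ne_top]
          change _ * (_ * totalMass _) = _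
          rw [hmass, ← ENNReal.ofReal_mul (by positivity), ← ENNReal.ofReal_mul (by positivity)]
          congr 1
          ring
  have hP : positivePart Q (block α R V) ≤
      ENNReal.ofReal (C₂ * M * α ^ (1 / k₂) + M * V ^ 2 / 2) := by
    rw [ENNReal.ofReal_add (by positivity) (by positivity)]
    exact add_le_add hcas hkin
  have hadm : Admissible Q (block α R V) := ⟨measurable_block α R V, block_nonneg hα.le R V,
    hmass ▸ ENNReal.ofReal_lt_top, hP.trans_lt ENNReal.ofReal_lt_top⟩
  refine ⟨hadm, hmass, ?_⟩
  have hρ := measurable_spatialDensity hadm.measurable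
  have hself : ENNReal.ofReal (M ^ 2 * (2 * R)⁻¹) ≤ selfEnergy (block α R V) := by
    have h1 := le_coulombEnergy_of_support hρ (R := R) fun x hx => by
      have hz : ∀ v, block α R V (x, v) = 0 := fun v => by
        rw [block, indicator_of_notMem]
        rintro ⟨h1, -⟩
        exact absurd hx (not_le.2 (by simpa using h1))
      simp [spatialDensity, hz]
    rw [lintegral_spatialDensity hadm.measurable, hmass, ← ENNReal.ofReal_mul hM0.le,
      ← ENNReal.ofReal_mul (by positivity)] at h1
    refine le_trans (le_of_eq ?_) h1
    congr 1
    ring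
  have h1 : (positivePart Q (block α R V)).toReal ≤ C₂ * M * α ^ (1 / k₂) + M * V ^ 2 / 2 :=
    ENNReal.toReal_le_of_le_ofReal (by positivity) hP
  have h2 : M ^ 2 * (2 * R)⁻¹ ≤ (selfEnergy (block α R V)).toReal := by
    rw [← ENNReal.ofReal_le_iff_le_toReal (hadm.selfEnergy_lt_top hQ).ne]
    exact hself
  have hc := couplingConst_pos
  have h3 : couplingConst * (M ^ 2 * (2 * R)⁻¹) ≤ couplingConst * (selfEnergy (block α R V)).toReal := by
    gcongr
  rw [energy]
  linarith

/-- Spread the mass evenly over |x| < R, |v| < R^(-s); the height is then of order R^(-3(1-s)). As R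
→ ∞ the Casimir term is at most of order R^(-3(1-s)/k₂) and the kinetic energy at most of order
R^(-2s), while the potential energy is at most a negative multiple of 1/R. The last one wins if 2s >
1 and 3(1-s) > k₂, which is possible because k₂ < 3/2. -/
theorem exists_energy_neg (hQ : CasimirAssumptions Q C₁ C₂ F₀ k₁ k₂ k₃) {M : ℝ} (hM : 0 < M) :
    ∃ f, Admissible Q f ∧ totalMass f = ENNReal.ofReal M ∧ energy Q f < 0 := by
  have hk := hQ.k₂_pos
  have hk' := hQ.k₂_lt
  have hW := unitBallVolume_pos
  have hc := couplingConst_pos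
  -- The midpoint of the admissible interval (1/2, 1 - k₂/3).
  set s : ℝ := 3 / 4 - k₂ / 6
  have hs1 : 1 / 2 < s := by simp only [s]; linarith
  have hs2 : 1 < 3 * (1 - s) / k₂ := by rw [lt_div_iff₀ hk]; simp only [s]; linarith
  have hs3 : 0 < 3 * (1 - s) := by simp only [s]; linarith
  set B : ℝ := M / unitBallVolume ^ 2
  have hB : 0 < B := by positivity
  have t1 : Tendsto (fun R : ℝ => B * R ^ (-(3 * (1 - s)))) atTop (𝓝 0) := by
    simpa only [mul_zero] using (tendsto_rpow_neg_atTop hs3).const_mul B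
  have t2 : Tendsto (fun R : ℝ => C₂ * M * B ^ (1 / k₂) * R ^ (-(3 * (1 - s) / k₂ - 1)) +
      M / 2 * R ^ (-(2 * s - 1)) - couplingConst * M ^ 2 / 2) atTop
      (𝓝 (C₂ * M * B ^ (1 / k₂) * 0 + M / 2 * 0 - couplingConst * M ^ 2 / 2)) :=
    (((tendsto_rpow_neg_atTop (by linarith)).const_mul _).add
      ((tendsto_rpow_neg_atTop (by linarith)).const_mul _)).sub tendsto_const_nhds
  have hneg : C₂ * M * B ^ (1 / k₂) * 0 + M / 2 * 0 - couplingConst * M ^ 2 / 2 < 0 := by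
    have : 0 < couplingConst * M ^ 2 / 2 := by positivity
    linarith
  obtain ⟨R, ⟨h1, h2⟩, hR⟩ := (((t1.eventually_lt_const hQ.F₀_pos).and
    (t2.eventually_lt_const hneg)).and (eventually_gt_atTop 0)).exists
  set α := B * R ^ (-(3 * (1 - s)))
  have hα : 0 < α := by positivity
  have hV : 0 < R ^ (-s) := by positivity
  have hmass : α * ((R * R ^ (-s)) ^ 3 * unitBallVolume ^ 2) = M := by
    have e1 : (R * R ^ (-s)) ^ 3 = R ^ (3 * (1 - s)) := by
      rw [mul_comm R, ← Real.rpow_add_one hR.ne', ← Real.rpow_natCast, ← Real.rpow_mul hR.le]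
      congr 1; push_cast; ring
    have e2 : R ^ (-(3 * (1 - s))) * R ^ (3 * (1 - s)) = 1 := by
      rw [← Real.rpow_add hR]; simp
    calc _ = B * (R ^ (-(3 * (1 - s))) * R ^ (3 * (1 - s))) * unitBallVolume ^ 2 := by
          rw [e1]; simp only [α]; ring
      _ = M := by rw [e2]; simp only [B]; field_simp
  obtain ⟨hadm, hm, hE⟩ := block_bounds hQ hα h1.le hR hV hmass
  refine ⟨_, hadm, hm, hE.trans_lt ?_⟩
  have e3 : α ^ (1 / k₂) = B ^ (1 / k₂) * R ^ (-(3 * (1 - s) / k₂ - 1)) / R := by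
    simp only [α]
    rw [Real.mul_rpow hB.le (by positivity), ← Real.rpow_mul hR.le, mul_div_assoc,
      ← Real.rpow_sub_one hR.ne']
    congr 2
    field_simp
    ring
  have e4 : (R ^ (-s)) ^ 2 = R ^ (-(2 * s - 1)) / R := by
    rw [← Real.rpow_natCast, ← Real.rpow_mul hR.le, ← Real.rpow_sub_one hR.ne']
    congr 1
    push_cast
    ring
  rw [e3, e4]
  have e5 : C₂ * M * (B ^ (1 / k₂) * R ^ (-(3 * (1 - s) / k₂ - 1)) / R) +
      M * (R ^ (-(2 * s - 1)) / R) / 2 - couplingConst * (M ^ 2 * (2 * R)⁻¹) =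
      (C₂ * M * B ^ (1 / k₂) * R ^ (-(3 * (1 - s) / k₂ - 1)) +
      M / 2 * R ^ (-(2 * s - 1)) - couplingConst * M ^ 2 / 2) / R := by
    field_simp
  rw [e5]
  exact div_neg_of_neg_of_pos h2 hR

end Block

/-! ### The infimum and its scaling in the mass. -/

section Infimum

variable {Q : ℝ → ℝ} {C₁ C₂ F₀ k₁ k₂ k₃ : ℝ}

/-- The infimum `h_M` is a negative real number, and dilations compare it with the energy of
densities of smaller mass. -/
theorem exists_minEnergy_eq (hQ : CasimirAssumptions Q C₁ C₂ F₀ k₁ k₂ k₃) {M : ℝ} (hM : 0 < M) :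
    ∃ h : ℝ, minEnergy Q M = (h : EReal) ∧ h < 0 ∧
      ∀ f, Admissible Q f → totalMass f = ENNReal.ofReal M → h ≤ energy Q f := by
  obtain ⟨K, hK, hb⟩ := Admissible.exists_le_energy hQ hM
  have hlow : ((-K : ℝ) : EReal) ≤ minEnergy Q M := by
    refine le_iInf₂ fun f hf => ?_
    obtain ⟨g, hfg, hg, hm⟩ := exists_admissible_ae_eq hf
    rw [energyCasimir_congr_ae hfg, hg.energyCasimir_eq hQ]
    have := hb g hg hm.le
    have h0 : 0 ≤ (positivePart Q g).toReal := ENNReal.toReal_nonneg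
    exact_mod_cast (by linarith : -K ≤ energy Q g)
  have hup : ∀ f, Admissible Q f → totalMass f = ENNReal.ofReal M →
      minEnergy Q M ≤ (energy Q f : EReal) := fun f hf hm => by
    rw [← hf.energyCasimir_eq hQ]
    exact iInf₂_le f (hf.mem_constraintSet hM.le hm)
  obtain ⟨f, hf, hm, hE⟩ := exists_energy_neg hQ hM
  have hne_top : minEnergy Q M ≠ ⊤ := ((hup f hf hm).trans_lt (EReal.coe_lt_top _)).ne
  have hne_bot : minEnergy Q M ≠ ⊥ := ((EReal.bot_lt_coe _).trans_le hlow).ne'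
  have e : minEnergy Q M = ((minEnergy Q M).toReal : EReal) := (EReal.coe_toReal hne_top hne_bot).symm
  have hup' : ∀ f, Admissible Q f → totalMass f = ENNReal.ofReal M →
      (minEnergy Q M).toReal ≤ energy Q f := fun f hf hm => by
    have := hup f hf hm
    rw [e] at this
    exact_mod_cast this
  exact ⟨_, e, (hup' f hf hm).trans_lt hE, hup'⟩

/-- Dilation by a raises the mass to M. Times a⁵, the energy of the dilated density is a²P(f) minus
the unchanged potential term, which is at most the energy of f because a ≤ 1. As only x is dilated,
the values of f do not change and the Casimir term scales exactly like the volume. -/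
theorem pow_five_mul_le_energy (hQ : CasimirAssumptions Q C₁ C₂ F₀ k₁ k₂ k₃) {M h : ℝ}
    (hh : ∀ f, Admissible Q f → totalMass f = ENNReal.ofReal M → h ≤ energy Q f)
    {f : Phase → ℝ} (hf : Admissible Q f) {a : ℝ} (ha0 : 0 ≤ a) (ha1 : a ≤ 1)
    (hm : totalMass f = ENNReal.ofReal (a ^ 3 * M)) : a ^ 5 * h ≤ energy Q f := by
  have hP0 : 0 ≤ (positivePart Q f).toReal := ENNReal.toReal_nonneg
  rcases ha0.eq_or_lt with rfl | ha
  -- For a = 0 there is nothing to dilate, but zero mass has no self-energy and P ≥ 0.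
  · have h0 : selfEnergy f = 0 := by
      refine coulombEnergy_eq_zero (measurable_spatialDensity hf.measurable) ?_
      rw [lintegral_spatialDensity hf.measurable, hm]
      simp
    rw [energy, h0]
    simp
  have hQf := hQ.measurable_comp hf.measurable hf.nonneg
  have hm' : totalMass (dilate a f) = ENNReal.ofReal M := by
    rw [totalMass_dilate hf.measurable ha, hm, ← ENNReal.ofReal_mul (by positivity)]
    congr 1
    field_simp
  have hadm : Admissible Q (dilate a f) := by
    refine ⟨?_, fun z => hf.nonneg _, hm' ▸ ENNReal.ofReal_lt_top, ?_⟩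
    · have := hf.measurable
      unfold dilate
      fun_prop
    · rw [positivePart_dilate hf.measurable hQf ha]
      exact ENNReal.mul_lt_top ENNReal.ofReal_lt_top hf.positivePart_lt_top
  have h1 := hh _ hadm hm'
  rw [energy, positivePart_dilate hf.measurable hQf ha, selfEnergy_dilate hf.measurable ha,
    ENNReal.toReal_mul, ENNReal.toReal_mul, ENNReal.toReal_ofReal (by positivity),
    ENNReal.toReal_ofReal (by positivity)] at h1
  have h2 : a ^ 5 * ((a ^ 3)⁻¹ * (positivePart Q f).toReal -
      couplingConst * ((a ^ 5)⁻¹ * (selfEnergy f).toReal)) =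
      a ^ 2 * (positivePart Q f).toReal - couplingConst * (selfEnergy f).toReal := by
    field_simp
  have h3 : a ^ 5 * h ≤ a ^ 5 * ((a ^ 3)⁻¹ * (positivePart Q f).toReal -
      couplingConst * ((a ^ 5)⁻¹ * (selfEnergy f).toReal)) := by gcongr
  have h4 : a ^ 2 * (positivePart Q f).toReal ≤ 1 * (positivePart Q f).toReal := by
    gcongr
    exact pow_le_one₀ ha0 ha1
  rw [energy]
  linarith

end Infimum

/-! ### Weak compactness through subgraphs. -/

section WeakCompactness

open InnerProductSpace in
-- Sequential Banach–Alaoglu, carried over by the Riesz isomorphism.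
theorem exists_subseq_tendsto_inner {H : Type*} [NormedAddCommGroup H] [InnerProductSpace ℝ H]
    [CompleteSpace H] [TopologicalSpace.SeparableSpace H] {x : ℕ → H} {r : ℝ} (h : ∀ n, ‖x n‖ ≤ r) :
    ∃ (x₀ : H) (φ : ℕ → ℕ), StrictMono φ ∧
      ∀ y, Tendsto (fun n => inner ℝ (x (φ n)) y) atTop (𝓝 (inner ℝ x₀ y)) := by
  have hmem : ∀ n, StrongDual.toWeakDual (toDual ℝ H (x n)) ∈
      (WeakDual.toStrongDual ⁻¹' Metric.closedBall (0 : StrongDual ℝ H) r) := fun n => by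
    simpa using h n
  obtain ⟨a, -, φ, hφ, ha⟩ := WeakDual.isSeqCompact_closedBall ℝ H 0 r hmem
  refine ⟨(toDual ℝ H).symm (WeakDual.toStrongDual a), φ, hφ, fun y => ?_⟩
  rw [tendsto_iff_forall_eval_tendsto_topDualPairing] at ha
  rw [toDual_symm_apply]
  exact ha y

/-- The region between zero and the graph of a phase space density. -/
def subgraph (f : Phase → ℝ) : Set (Phase × ℝ) := {p | 0 < p.2 ∧ p.2 < f p.1}

theorem measurableSet_subgraph {f : Phase → ℝ} (hf : Measurable f) :
    MeasurableSet (subgraph f) :=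
  (measurableSet_lt measurable_const measurable_snd).inter
    (measurableSet_lt measurable_snd (hf.comp measurable_fst))

theorem volume_subgraph {f : Phase → ℝ} (hf : Measurable f) : volume (subgraph f) = totalMass f := by
  rw [Measure.volume_eq_prod, Measure.prod_apply (measurableSet_subgraph hf), totalMass]
  refine lintegral_congr fun z => ?_
  have : Prod.mk z ⁻¹' subgraph f = Ioo 0 (f z) := rfl
  rw [this, Real.volume_Ioo, sub_zero]

theorem setLIntegral_subgraph {f : Phase → ℝ} (z : Phase) (N : ℝ) :
    ∫⁻ s in Ioo 0 N, (subgraph f).indicator 1 (z, s) = ENNReal.ofReal (min N (f z)) := by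
  have : ∀ s, (subgraph f).indicator (1 : Phase × ℝ → ℝ≥0∞) (z, s) =
      (Ioo 0 (f z)).indicator 1 s := fun s => by
    by_cases hs : s ∈ Ioo 0 (f z)
    · rw [indicator_of_mem hs, indicator_of_mem (show (z, s) ∈ subgraph f from hs)]; rfl
    · rw [indicator_of_notMem hs, indicator_of_notMem (show (z, s) ∉ subgraph f from hs)]
  simp_rw [this]
  rw [setLIntegral_indicator measurableSet_Ioo]
  simp only [Pi.one_apply, setLIntegral_const, one_mul]
  rw [inter_comm, Ioo_inter_Ioo, max_self, Real.volume_Ioo, sub_zero]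

/-- A bounded function of bounded support on phase space, cut off in the additional variable. -/
def cutoffTest (ψ : Phase → ℝ≥0∞) (R N : ℝ) : Phase × ℝ → ℝ :=
  (Metric.ball (0 : Phase) R ×ˢ Ioo 0 N).indicator fun p => (ψ p.1).toReal

variable {ψ : Phase → ℝ≥0∞} {C : ℝ≥0∞} {R : ℝ}

theorem measurable_cutoffTest (hψ : Measurable ψ) (N : ℝ) : Measurable (cutoffTest ψ R N) :=
  (hψ.comp measurable_fst).ennreal_toReal.indicator
    (Metric.isOpen_ball.measurableSet.prod measurableSet_Ioo)

theorem memLp_cutoffTest (hψ : Measurable ψ) (hC : C < ⊤) (hb : ∀ z, ψ z ≤ C) (N : ℝ) :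
    MemLp (cutoffTest ψ R N) 2 := by
  have hT : MeasurableSet (Metric.ball (0 : Phase) R ×ˢ Ioo 0 N) :=
    Metric.isOpen_ball.measurableSet.prod measurableSet_Ioo
  have hfin : volume (Metric.ball (0 : Phase) R ×ˢ Ioo 0 N) < ⊤ := by
    rw [Measure.volume_eq_prod, Measure.prod_prod]
    exact ENNReal.mul_lt_top measure_ball_lt_top measure_Ioo_lt_top
  have : IsFiniteMeasure (volume.restrict (Metric.ball (0 : Phase) R ×ˢ Ioo 0 N)) :=
    ⟨by rwa [Measure.restrict_apply_univ]⟩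
  rw [cutoffTest, memLp_indicator_iff_restrict hT]
  refine MemLp.of_bound (hψ.comp measurable_fst).ennreal_toReal.aestronglyMeasurable C.toReal
    (.of_forall fun p => ?_)
  rw [Real.norm_of_nonneg ENNReal.toReal_nonneg]
  exact ENNReal.toReal_mono hC.ne (hb _)

theorem lintegral_cutoffTest_mul (hψ : Measurable ψ) (hC : C < ⊤) (hb : ∀ z, ψ z ≤ C)
    (hR : ∀ z, R ≤ ‖z‖ → ψ z = 0) (N : ℝ) {X : Phase × ℝ → ℝ≥0∞} (hX : Measurable X) :
    ∫⁻ p, ENNReal.ofReal (cutoffTest ψ R N p) * X p =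
      ∫⁻ z, ψ z * ∫⁻ s in Ioo 0 N, X (z, s) := by
  have hm := measurable_cutoffTest (R := R) hψ N
  rw [Measure.volume_eq_prod, lintegral_prod _ (by fun_prop)]
  refine lintegral_congr fun z => ?_
  rw [← lintegral_const_mul _ (by fun_prop), ← lintegral_indicator measurableSet_Ioo]
  refine lintegral_congr fun s => ?_
  rcases le_or_gt R ‖z‖ with hz | hz
  · have : (z, s) ∉ Metric.ball (0 : Phase) R ×ˢ Ioo 0 N := fun h => by
      have := h.1
      simp only [mem_ball_zero_iff] at this
      linarith
    rw [cutoffTest, indicator_of_notMem this]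
    simp [hR z hz]
  · by_cases hs : s ∈ Ioo 0 N
    · have : (z, s) ∈ Metric.ball (0 : Phase) R ×ˢ Ioo 0 N := ⟨by simpa using hz, hs⟩
      rw [cutoffTest, indicator_of_mem this, indicator_of_mem hs,
        ENNReal.ofReal_toReal ((hb z).trans_lt hC).ne]
    · have : (z, s) ∉ Metric.ball (0 : Phase) R ×ˢ Ioo 0 N := fun h => hs h.2
      rw [cutoffTest, indicator_of_notMem this, indicator_of_notMem hs]
      simp

theorem cutoffTest_nonneg (ψ : Phase → ℝ≥0∞) (R N : ℝ) (p : Phase × ℝ) : 0 ≤ cutoffTest ψ R N p :=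
  indicator_nonneg (fun _ _ => ENNReal.toReal_nonneg) p

/-- The weak limit of the indicator functions of the subgraphs. -/
theorem exists_subseq_tendsto_subgraph {f : ℕ → Phase → ℝ} (hf : ∀ n, Measurable (f n)) {M : ℝ≥0∞}
    (hM : M < ⊤) (hfM : ∀ n, totalMass (f n) ≤ M) :
    ∃ (X : Phase × ℝ → ℝ≥0∞) (φ : ℕ → ℕ), Measurable X ∧ StrictMono φ ∧
      ∀ (ψ : Phase → ℝ≥0∞) (C : ℝ≥0∞) (R N : ℝ), Measurable ψ → C < ⊤ → (∀ x, ψ x ≤ C) →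
        (∀ x, R ≤ ‖x‖ → ψ x = 0) →
        Tendsto (fun n => ∫⁻ z, ψ z * ENNReal.ofReal (min N (f (φ n) z))) atTop
          (𝓝 (∫⁻ z, ψ z * ∫⁻ s in Ioo 0 N, X (z, s))) := by
  have hfin : ∀ n, volume (subgraph (f n)) ≠ ⊤ := fun n => by
    rw [volume_subgraph (hf n)]; exact ((hfM n).trans_lt hM).ne
  -- The squared L² norm of such an indicator is the mass, so the mass bound alone gives weak
  -- compactness in a Hilbert space.
  set u : ℕ → Lp ℝ 2 (volume : Measure (Phase × ℝ)) := fun n =>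
    indicatorConstLp 2 (measurableSet_subgraph (hf n)) (hfin n) 1
  have hu : ∀ n, ‖u n‖ ≤ M.toReal ^ (1 / 2 : ℝ) := fun n => by
    simp only [u]
    rw [norm_indicatorConstLp (by simp) (by simp), norm_one, one_mul, ENNReal.toReal_ofNat]
    refine Real.rpow_le_rpow measureReal_nonneg ?_ (by norm_num)
    rw [measureReal_def, volume_subgraph (hf n)]
    exact ENNReal.toReal_mono hM.ne (hfM n)
  have : Fact ((2 : ℝ≥0∞) ≠ ⊤) := ⟨by simp⟩
  have : IsSeparable (volume : Measure (Phase × ℝ)) := isSeparable_of_sigmaFinite _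
  obtain ⟨χ, φ, hφ, hlim⟩ := exists_subseq_tendsto_inner hu
  have hlim' : ∀ y : Lp ℝ 2 (volume : Measure (Phase × ℝ)),
      Tendsto (fun n => ∫ p in subgraph (f (φ n)), y p) atTop (𝓝 (inner ℝ χ y)) := fun y => by
    simpa only [u, L2.inner_indicatorConstLp_one] using hlim y
  have hχ0 : 0 ≤ᵐ[volume] (χ : Phase × ℝ → ℝ) := by
    refine ae_nonneg_of_forall_setIntegral_nonneg_of_sigmaFinite
      (fun s _ hs' => integrableOn_Lp_of_measure_ne_top χ (by simp) hs'.ne) fun s hs hs' => ?_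
    have h := hlim' (indicatorConstLp 2 hs hs'.ne 1)
    rw [real_inner_comm, L2.inner_indicatorConstLp_one] at h
    refine ge_of_tendsto' h fun n => integral_nonneg_of_ae (ae_restrict_of_ae ?_)
    filter_upwards [indicatorConstLp_coeFn (p := 2) (hs := hs) (hμs := hs'.ne) (c := (1 : ℝ))]
      with p hp
    rw [hp]
    exact indicator_nonneg (fun _ _ => zero_le_one) _
  set X : Phase × ℝ → ℝ≥0∞ := fun p => ENNReal.ofReal ((Lp.aestronglyMeasurable χ).mk χ p)
  have hX : Measurable X :=
    ((Lp.aestronglyMeasurable χ).stronglyMeasurable_mk.measurable).ennreal_ofReal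
  have hXχ : ∀ᵐ p, ENNReal.ofReal (χ p) = X p := by
    filter_upwards [(Lp.aestronglyMeasurable χ).ae_eq_mk] with p hp
    simp only [X, ← hp]
  refine ⟨X, φ, hX, hφ, fun ψ C R N hψ hC hb hR => ?_⟩
  have hmem := memLp_cutoffTest (R := R) hψ hC hb N
  have hm := measurable_cutoffTest (R := R) hψ N
  have h := hlim' (hmem.toLp _)
  have e1 : ∀ n, ∫ p in subgraph (f (φ n)), (hmem.toLp _ : Phase × ℝ → ℝ) p =
      (∫⁻ z, ψ z * ENNReal.ofReal (min N (f (φ n) z))).toReal := fun n => by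
    have hS := measurableSet_subgraph (hf (φ n))
    rw [integral_congr_ae (ae_restrict_of_ae hmem.coeFn_toLp),
      integral_eq_lintegral_of_nonneg_ae (.of_forall (cutoffTest_nonneg ψ R N))
      hm.aestronglyMeasurable]
    simp_rw [← setLIntegral_subgraph]
    rw [← lintegral_cutoffTest_mul hψ hC hb hR N (measurable_one.indicator hS),
      ← lintegral_indicator hS]
    congr 1
    refine lintegral_congr fun p => ?_
    by_cases hp : p ∈ subgraph (f (φ n))
    · rw [indicator_of_mem hp, indicator_of_mem hp, Pi.one_apply, mul_one]
    · rw [indicator_of_notMem hp, indicator_of_notMem hp, mul_zero]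
  have hint : Integrable fun p => cutoffTest ψ R N p * χ p := hmem.integrable_mul (Lp.memLp χ)
  have hnn : 0 ≤ᵐ[volume] fun p => cutoffTest ψ R N p * χ p := by
    filter_upwards [hχ0] with p hp
    exact mul_nonneg (cutoffTest_nonneg ψ R N p) hp
  have e3 : ∫⁻ p, ENNReal.ofReal (cutoffTest ψ R N p * χ p) =
      ∫⁻ z, ψ z * ∫⁻ s in Ioo 0 N, X (z, s) := by
    rw [← lintegral_cutoffTest_mul hψ hC hb hR N hX]
    refine lintegral_congr_ae ?_
    filter_upwards [hXχ] with p hp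
    rw [ENNReal.ofReal_mul (cutoffTest_nonneg ψ R N p), hp]
  have e2 : inner ℝ χ (hmem.toLp _) = (∫⁻ z, ψ z * ∫⁻ s in Ioo 0 N, X (z, s)).toReal := by
    rw [← e3, ← integral_eq_lintegral_of_nonneg_ae hnn hint.1, L2.inner_def]
    refine integral_congr_ae ?_
    filter_upwards [hmem.coeFn_toLp] with p hp
    rw [hp]
    rfl
  simp_rw [e1, e2] at h
  refine (ENNReal.tendsto_toReal_iff (fun n => ?_) ?_).1 h
  · refine ((lintegral_mono fun z => mul_le_mul' (hb z)
      (ENNReal.ofReal_le_ofReal (min_le_right N (f (φ n) z)))).trans_lt ?_).ne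
    rw [lintegral_const_mul' _ _ hC.ne]
    exact ENNReal.mul_lt_top hC ((hfM (φ n)).trans_lt hM)
  · rw [← e3, ← ofReal_integral_eq_lintegral_ofReal hint hnn]
    exact ENNReal.ofReal_ne_top

/-- The limit is recovered by integrating the weak limit of the subgraph indicators over the height.
Testing sees heights up to N only, that is min(N, f_n); `htail` makes the rest small uniformly in n.
-/
theorem exists_subseq_vagueTendsto {f : ℕ → Phase → ℝ} (hf : ∀ n, Measurable (f n))
    {M : ℝ≥0∞} (hM : M < ⊤) (hfM : ∀ n, totalMass (f n) ≤ M)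
    (htail : ∀ ε : ℝ≥0∞, 0 < ε → ∃ N : ℝ, ∀ N', N ≤ N' → ∀ n,
      ∫⁻ z, ENNReal.ofReal (f n z - N') ≤ ε) :
    ∃ (f₀ : Phase → ℝ) (φ : ℕ → ℕ), Measurable f₀ ∧ (∀ z, 0 ≤ f₀ z) ∧ StrictMono φ ∧
      VagueTendsto (fun n z => ENNReal.ofReal (f (φ n) z)) (fun z => ENNReal.ofReal (f₀ z)) := by
  obtain ⟨X, φ, hX, hφ, hlim⟩ := exists_subseq_tendsto_subgraph hf hM hfM
  set G : ℕ → Phase → ℝ≥0∞ := fun N z => ∫⁻ s in Ioo 0 (N : ℝ), X (z, s)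
  set F : Phase → ℝ≥0∞ := fun z => ⨆ N, G N z
  have hG : ∀ N, Measurable (G N) := fun N => hX.lintegral_prod_right'
  have hF : Measurable F := Measurable.iSup hG
  have hmono : ∀ z, Monotone fun N => G N z := fun z N N' h =>
    lintegral_mono_set (Ioo_subset_Ioo_right (by exact_mod_cast h))
  have hsup : ∀ ψ : Phase → ℝ≥0∞, Measurable ψ →
      ∫⁻ z, ψ z * F z = ⨆ N, ∫⁻ z, ψ z * G N z := fun ψ hψ => by
    simp_rw [F, ENNReal.mul_iSup]
    refine lintegral_iSup (fun N => hψ.mul (hG N)) fun N N' h z => ?_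
    exact mul_le_mul_right (hmono z h) _
  have hle : ∀ (ψ : Phase → ℝ≥0∞) (C : ℝ≥0∞) (R : ℝ), Measurable ψ → C < ⊤ → (∀ x, ψ x ≤ C) →
        (∀ x, R ≤ ‖x‖ → ψ x = 0) → ∫⁻ z, ψ z * F z ≤ C * M := fun ψ C R hψ hC hb hR => by
    rw [hsup ψ hψ]
    refine iSup_le fun N => le_of_tendsto' (hlim ψ C R N hψ hC hb hR) fun n => ?_
    refine (lintegral_mono fun z => mul_le_mul' (hb z)
      (ENNReal.ofReal_le_ofReal (min_le_right _ (f (φ n) z)))).trans ?_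
    rw [lintegral_const_mul' _ _ hC.ne]
    gcongr
    exact hfM (φ n)
  -- The mass bound makes F integrable on every ball, so passing to `toReal` changes it only on a
  -- null set.
  have hFfin : ∀ᵐ z, F z < ⊤ := by
    have h1 : ∀ R : ℕ, ∀ᵐ z, z ∈ Metric.ball (0 : Phase) R → F z < ⊤ := fun R => by
      rw [← ae_restrict_iff' Metric.isOpen_ball.measurableSet]
      refine ae_lt_top hF (ne_of_lt ?_)
      have h2 := hle ((Metric.ball (0 : Phase) R).indicator 1) 1 R
        (measurable_one.indicator Metric.isOpen_ball.measurableSet) (by simp)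
        (fun x => indicator_le_self _ _ x) fun x hx => indicator_of_notMem (by simpa using hx) _
      rw [← lintegral_indicator Metric.isOpen_ball.measurableSet]
      refine lt_of_le_of_lt (le_of_eq_of_le ?_ h2) (by simpa using hM)
      refine lintegral_congr fun z => ?_
      by_cases hz : z ∈ Metric.ball (0 : Phase) R
      · rw [indicator_of_mem hz, indicator_of_mem hz, Pi.one_apply, one_mul]
      · rw [indicator_of_notMem hz, indicator_of_notMem hz, zero_mul]
    filter_upwards [ae_all_iff.2 h1] with z hz
    obtain ⟨R, hR⟩ := exists_nat_gt ‖z‖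
    exact hz R (by simpa using hR)
  refine ⟨fun z => (F z).toReal, φ, hF.ennreal_toReal, fun z => ENNReal.toReal_nonneg, hφ, ?_⟩
  intro ψ C R hψ hC hb hR
  have e : ∫⁻ z, ENNReal.ofReal (F z).toReal * ψ z = ∫⁻ z, ψ z * F z := by
    refine lintegral_congr_ae ?_
    filter_upwards [hFfin] with z hz
    rw [ENNReal.ofReal_toReal hz.ne, mul_comm]
  rw [e]
  refine tendsto_of_approx fun ε hε => ?_
  -- Using C + 1 instead of C covers the case C = 0 in the division below.
  have hC1 : C + 1 ≠ 0 := by simp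
  have hC2 : C + 1 ≠ ⊤ := by simpa using hC.ne
  obtain ⟨N₁, hN₁⟩ := htail (ε / (C + 1)) (ENNReal.div_pos hε.ne' hC2)
  have hfin : (⨆ N, ∫⁻ z, ψ z * G N z) < ⊤ := by
    rw [← hsup ψ hψ]
    exact (hle ψ C R hψ hC hb hR).trans_lt (ENNReal.mul_lt_top hC hM)
  obtain ⟨N₂, hN₂⟩ : ∃ N, (⨆ N, ∫⁻ z, ψ z * G N z) ≤ (∫⁻ z, ψ z * G N z) + ε := by
    by_contra! h
    have h3 : (⨆ N, ∫⁻ z, ψ z * G N z) + ε ≤ ⨆ N, ∫⁻ z, ψ z * G N z := by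
      rw [ENNReal.iSup_add]
      exact iSup_le fun N => (h N).le
    exact absurd h3 (not_le.2 (ENNReal.lt_add_right hfin.ne hε.ne'))
  obtain ⟨N, hN⟩ := exists_nat_ge (max N₁ N₂)
  have hNN₂ : N₂ ≤ N := by exact_mod_cast (le_max_right _ _).trans hN
  have hGm : Monotone fun N => ∫⁻ z, ψ z * G N z := fun a b h =>
    lintegral_mono fun z => mul_le_mul_right (hmono z h) _
  refine ⟨fun n => ∫⁻ z, ψ z * ENNReal.ofReal (min (N : ℝ) (f (φ n) z)), ∫⁻ z, ψ z * G N z,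
    hlim ψ C R N hψ hC hb hR, fun n => ⟨?_, ?_⟩, ?_, ?_⟩
  · refine lintegral_mono fun z => ?_
    rw [mul_comm]
    exact mul_le_mul_left (ENNReal.ofReal_le_ofReal (min_le_right _ _)) _
  · have hfm := hf (φ n)
    calc ∫⁻ z, ENNReal.ofReal (f (φ n) z) * ψ z
        ≤ ∫⁻ z, (ψ z * ENNReal.ofReal (min (N : ℝ) (f (φ n) z)) +
          (C + 1) * ENNReal.ofReal (f (φ n) z - N)) := by
          refine lintegral_mono fun z => ?_
          have h1 : ENNReal.ofReal (f (φ n) z) ≤ ENNReal.ofReal (min (N : ℝ) (f (φ n) z)) +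
              ENNReal.ofReal (f (φ n) z - N) := by
            rcases le_total (N : ℝ) (f (φ n) z) with h | h
            · refine le_trans (ENNReal.ofReal_le_ofReal ?_) ENNReal.ofReal_add_le
              rw [min_eq_left h]; linarith
            · rw [min_eq_right h]; exact le_self_add
          calc ENNReal.ofReal (f (φ n) z) * ψ z ≤ (ENNReal.ofReal (min (N : ℝ) (f (φ n) z)) +
              ENNReal.ofReal (f (φ n) z - N)) * ψ z := by gcongr
            _ = ψ z * ENNReal.ofReal (min (N : ℝ) (f (φ n) z)) +
              ψ z * ENNReal.ofReal (f (φ n) z - N) := by ring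
            _ ≤ _ := by gcongr; exact (hb z).trans le_self_add
      _ = (∫⁻ z, ψ z * ENNReal.ofReal (min (N : ℝ) (f (φ n) z))) +
          (C + 1) * ∫⁻ z, ENNReal.ofReal (f (φ n) z - N) := by
          rw [lintegral_add_right _ (by fun_prop), lintegral_const_mul' _ _ hC2]
      _ ≤ (∫⁻ z, ψ z * ENNReal.ofReal (min (N : ℝ) (f (φ n) z))) + (C + 1) * (ε / (C + 1)) := by
          gcongr
          exact hN₁ _ ((le_max_left _ _).trans hN) _
      _ = _ := by rw [ENNReal.mul_div_cancel hC1 hC2]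
  · rw [hsup ψ hψ]
    exact le_iSup (fun N => ∫⁻ z, ψ z * G N z) N
  · rw [hsup ψ hψ]
    exact hN₂.trans (add_le_add_left (hGm hNN₂) _)

end WeakCompactness

/-! ### Lower semicontinuity and passage to spatial densities. -/

section LowerSemicontinuity

/-- Fatou's lemma for truncations that, at each point, eventually agree with the function. -/
theorem lintegral_le_of_forall_eventually {α : Type*} [MeasurableSpace α] {μ : Measure α}
    {G : α → ℝ≥0∞} {F : ℕ → α → ℝ≥0∞} {c : ℝ≥0∞} (hF : ∀ n, Measurable (F n))
    (h : ∀ z, ∀ᶠ n in atTop, G z = F n z) (hc : ∀ n, ∫⁻ z, F n z ∂μ ≤ c) :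
    ∫⁻ z, G z ∂μ ≤ c := by
  calc ∫⁻ z, G z ∂μ = ∫⁻ z, liminf (fun n => F n z) atTop ∂μ := by
        refine lintegral_congr fun z => ?_
        have : Tendsto (fun n => F n z) atTop (𝓝 (G z)) := by
          refine tendsto_const_nhds.congr' ?_
          filter_upwards [h z] with n hn using hn
        exact this.liminf_eq.symm
    _ ≤ liminf (fun n => ∫⁻ z, F n z ∂μ) atTop := lintegral_liminf_le hF
    _ ≤ c := liminf_le_of_le (by isBoundedDefault) fun b hb => by
        obtain ⟨n, hn⟩ := hb.exists
        exact hn.trans (hc n)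

theorem eventually_mem_ball {α : Type*} [SeminormedAddCommGroup α] (z : α) :
    ∀ᶠ n : ℕ in atTop, z ∈ Metric.ball (0 : α) n := by
  filter_upwards [eventually_gt_atTop ⌈‖z‖⌉₊] with n hn
  simpa using (Nat.lt_of_ceil_lt hn)

variable {Q : ℝ → ℝ} {C₁ C₂ F₀ k₁ k₂ k₃ : ℝ}

theorem CasimirAssumptions.convexOn (hQ : CasimirAssumptions Q C₁ C₂ F₀ k₁ k₂ k₃) :
    ConvexOn ℝ (Ici 0) Q := by
  have h2 : ContDiffOn ℝ 1 (deriv Q) (Ioi 0) :=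
    ((contDiffOn_succ_iff_deriv_of_isOpen (n := 1) isOpen_Ioi).1
      (by simpa [one_add_one_eq_two] using hQ.contDiffOn_two)).2.2
  refine convexOn_of_deriv2_nonneg (convex_Ici 0) hQ.contDiffOn_one.continuousOn ?_ ?_ ?_
  · rw [interior_Ici]; exact hQ.contDiffOn_two.differentiableOn (by simp)
  · rw [interior_Ici]; exact h2.differentiableOn (by simp)
  · rw [interior_Ici]
    exact fun x hx => (hQ.second_deriv_pos x hx).le

theorem CasimirAssumptions.differentiableAt (hQ : CasimirAssumptions Q C₁ C₂ F₀ k₁ k₂ k₃)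
    {s : ℝ} (hs : 0 < s) : DifferentiableAt ℝ Q s :=
  (hQ.contDiffOn_two.differentiableOn (by simp)).differentiableAt (Ioi_mem_nhds hs)

theorem CasimirAssumptions.tangent_le (hQ : CasimirAssumptions Q C₁ C₂ F₀ k₁ k₂ k₃) {s t : ℝ}
    (hs : 0 < s) (ht : 0 ≤ t) : Q s + deriv Q s * t ≤ Q t + deriv Q s * s := by
  have hd := hQ.differentiableAt hs
  rcases lt_trichotomy s t with h | rfl | h
  · have h1 := hQ.convexOn.deriv_le_slope (mem_Ici.2 hs.le) (mem_Ici.2 ht) h hd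
    rw [slope_def_field, le_div_iff₀ (by linarith)] at h1
    linarith
  · exact le_rfl
  · have h1 := hQ.convexOn.slope_le_deriv (mem_Ici.2 ht) (mem_Ici.2 hs.le) h hd
    rw [slope_def_field, div_le_iff₀ (by linarith)] at h1
    linarith

theorem CasimirAssumptions.deriv_nonneg (hQ : CasimirAssumptions Q C₁ C₂ F₀ k₁ k₂ k₃) {s : ℝ}
    (hs : 0 < s) : 0 ≤ deriv Q s := by
  have h := hQ.tangent_le hs le_rfl
  rw [hQ.map_zero, mul_zero, add_zero, zero_add] at h
  exact nonneg_of_mul_nonneg_left ((hQ.nonneg s hs.le).trans h) hs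

theorem CasimirAssumptions.deriv_le_deriv (hQ : CasimirAssumptions Q C₁ C₂ F₀ k₁ k₂ k₃) {s t : ℝ}
    (hs : 0 < s) (hst : s ≤ t) : deriv Q s ≤ deriv Q t := by
  rcases hst.eq_or_lt with rfl | h
  · exact le_rfl
  have h1 := hQ.tangent_le hs (hs.trans h).le
  have h2 := hQ.tangent_le (hs.trans h) hs.le
  nlinarith

variable {f : ℕ → Phase → ℝ} {f₀ : Phase → ℝ}

/-- By convexity Q(f_n) lies above the tangent to Q at f₀. On a bounded region where 0 < f₀ ≤ R the
slope Q'(f₀) is an admissible test function, so the linear term disappears in the limit; the weight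
|v|²/2 cut to a ball is a test function too. Then R → ∞. -/
theorem positivePart_le_of_vagueTendsto (hQ : CasimirAssumptions Q C₁ C₂ F₀ k₁ k₂ k₃)
    (hf : ∀ n, Measurable (f n)) (hf' : ∀ n z, 0 ≤ f n z)
    (hf₀ : Measurable f₀) (hf₀' : ∀ z, 0 ≤ f₀ z)
    (h : VagueTendsto (fun n z => ENNReal.ofReal (f n z)) (fun z => ENNReal.ofReal (f₀ z)))
    {c : ℝ≥0∞} (hc : ∀ᶠ n in atTop, positivePart Q (f n) ≤ c) : positivePart Q f₀ ≤ c := by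
  have hQf₀ := (hQ.measurable_comp hf₀ hf₀').ennreal_ofReal
  have hQf := fun n => (hQ.measurable_comp (hf n) (hf' n)).ennreal_ofReal
  -- Points with f₀ = 0 are left out: `deriv Q 0` is two-sided and would see negative arguments, and
  -- these points contribute Q(0) = 0 anyway.
  set A : ℕ → Set Phase := fun R => Metric.ball 0 R ∩ {z | 0 < f₀ z ∧ f₀ z ≤ R}
  have hA : ∀ R, MeasurableSet (A R) := fun R => Metric.isOpen_ball.measurableSet.inter
    ((measurableSet_lt measurable_const hf₀).inter (measurableSet_le hf₀ measurable_const))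
  have hB : ∀ R : ℕ, MeasurableSet (Metric.ball (0 : Phase) R) :=
    fun R => Metric.isOpen_ball.measurableSet
  set q : ℕ → Phase → ℝ≥0∞ := fun R => (A R).indicator fun z => ENNReal.ofReal (deriv Q (f₀ z))
  have hq : ∀ R, Measurable (q R) := fun R =>
    ((measurable_deriv Q).comp hf₀).ennreal_ofReal.indicator (hA R)
  set w : ℕ → Phase → ℝ≥0∞ := fun R =>
    (Metric.ball 0 R).indicator fun z => ENNReal.ofReal (1 / 2) * ENNReal.ofReal (‖z.2‖ ^ 2)
  have hw : ∀ R, Measurable (w R) := fun R => Measurable.indicator (by fun_prop) (hB R)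
  have hkin : ∀ g : Phase → ℝ, kineticEnergy g =
      ∫⁻ z : Phase, ENNReal.ofReal (g z) *
        (ENNReal.ofReal (1 / 2) * ENNReal.ofReal (‖z.2‖ ^ 2)) := fun g => by
    rw [kineticEnergy, ← lintegral_const_mul' _ _ ENNReal.ofReal_ne_top]
    refine lintegral_congr fun z => ?_
    rw [ENNReal.ofReal_mul (by positivity)]
    ring
  rw [positivePart, casimir, hkin, ← lintegral_add_left hQf₀]
  refine lintegral_le_of_forall_eventually
    (F := fun R z => (A R).indicator (fun z => ENNReal.ofReal (Q (f₀ z))) z +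
      ENNReal.ofReal (f₀ z) * w R z) (fun R => ?_) (fun z => ?_) fun R => ?_
  · exact (hQf₀.indicator (hA R)).add (hf₀.ennreal_ofReal.mul (hw R))
  · filter_upwards [eventually_mem_ball z, eventually_ge_atTop ⌈f₀ z⌉₊] with R h1 h2
    have h3 : f₀ z ≤ R := Nat.ceil_le.1 h2
    simp only [w, indicator_of_mem h1]
    congr 1
    rcases (hf₀' z).eq_or_lt with h0 | h0
    · rw [← h0, hQ.map_zero, ENNReal.ofReal_zero]
      rw [indicator_of_notMem]
      exact fun h => h0.not_lt h.2.1
    · rw [indicator_of_mem (show z ∈ A R from ⟨h1, h0, h3⟩)]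
  · have hqb : ∀ z, q R z ≤ ENNReal.ofReal (deriv Q R) := fun z => by
      by_cases hz : z ∈ A R
      · simp only [q, indicator_of_mem hz]
        exact ENNReal.ofReal_le_ofReal (hQ.deriv_le_deriv hz.2.1 hz.2.2)
      · simp only [q, indicator_of_notMem hz, zero_le]
    have hwb : ∀ z, w R z ≤ ENNReal.ofReal (1 / 2) * ENNReal.ofReal ((R : ℝ) ^ 2) := fun z => by
      by_cases hz : z ∈ Metric.ball (0 : Phase) R
      · simp only [w, indicator_of_mem hz]
        have h1 : ‖z‖ < R := by simpa using hz
        have h2 : ‖z.2‖ ≤ R := (norm_snd_le z).trans h1.le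
        gcongr
      · simp only [w, indicator_of_notMem hz, zero_le]
    have hball : ∀ z : Phase, (R : ℝ) ≤ ‖z‖ → z ∉ Metric.ball (0 : Phase) R := fun z hz => by
      simpa using hz
    have t1 := h (q R) _ R (hq R) ENNReal.ofReal_lt_top hqb fun z hz =>
      indicator_of_notMem (fun h => hball z hz h.1) _
    have t2 := h (w R) _ R (hw R)
      (ENNReal.mul_lt_top ENNReal.ofReal_lt_top ENNReal.ofReal_lt_top) hwb fun z hz =>
      indicator_of_notMem (hball z hz) _
    have hfin : ∫⁻ z, ENNReal.ofReal (f₀ z) * q R z ≠ ⊤ := by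
      have hle : ∀ z, ENNReal.ofReal (f₀ z) * q R z ≤ (Metric.ball (0 : Phase) R).indicator
          (fun _ => ENNReal.ofReal R * ENNReal.ofReal (deriv Q R)) z := fun z => by
        by_cases hz : z ∈ A R
        · rw [indicator_of_mem hz.1]
          exact mul_le_mul' (ENNReal.ofReal_le_ofReal hz.2.2) (hqb z)
        · simp [q, indicator_of_notMem hz]
      refine ((lintegral_mono hle).trans_lt ?_).ne
      rw [lintegral_indicator (hB R), setLIntegral_const]
      exact ENNReal.mul_lt_top (ENNReal.mul_lt_top ENNReal.ofReal_lt_top ENNReal.ofReal_lt_top)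
        measure_ball_lt_top
    -- The tangent inequality is kept free of subtraction; the finite term on the right is cancelled
    -- only after the limit.
    have key : ∀ᶠ n in atTop, (∫⁻ z, (A R).indicator (fun z => ENNReal.ofReal (Q (f₀ z))) z) +
        ((∫⁻ z, ENNReal.ofReal (f n z) * q R z) + ∫⁻ z, ENNReal.ofReal (f n z) * w R z) ≤
        c + ∫⁻ z, ENNReal.ofReal (f₀ z) * q R z := by
      filter_upwards [hc] with n hn
      have h1 : (∫⁻ z, (A R).indicator (fun z => ENNReal.ofReal (Q (f₀ z))) z) +
          (∫⁻ z, ENNReal.ofReal (f n z) * q R z) ≤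
          casimir Q (f n) + ∫⁻ z, ENNReal.ofReal (f₀ z) * q R z := by
        rw [casimir, ← lintegral_add_left (hQf₀.indicator (hA R)), ← lintegral_add_left (hQf n)]
        refine lintegral_mono fun z => ?_
        by_cases hz : z ∈ A R
        · simp only [q, indicator_of_mem hz]
          have hd := hQ.deriv_nonneg hz.2.1
          rw [← ENNReal.ofReal_mul (hf' n z), ← ENNReal.ofReal_mul (hf₀' z),
            ← ENNReal.ofReal_add (hQ.nonneg _ (hf₀' z)) (mul_nonneg (hf' n z) hd),
            ← ENNReal.ofReal_add (hQ.nonneg _ (hf' n z)) (mul_nonneg (hf₀' z) hd)]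
          apply ENNReal.ofReal_le_ofReal
          linarith [hQ.tangent_le hz.2.1 (hf' n z)]
        · simp only [q, indicator_of_notMem hz, mul_zero, add_zero, zero_le]
      have h2 : ∫⁻ z, ENNReal.ofReal (f n z) * w R z ≤ kineticEnergy (f n) := by
        rw [hkin]
        exact lintegral_mono fun z => mul_le_mul_right (indicator_le_self _ _ z) _
      calc _ = ((∫⁻ z, (A R).indicator (fun z => ENNReal.ofReal (Q (f₀ z))) z) +
          (∫⁻ z, ENNReal.ofReal (f n z) * q R z)) + ∫⁻ z, ENNReal.ofReal (f n z) * w R z := by ring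
        _ ≤ (casimir Q (f n) + ∫⁻ z, ENNReal.ofReal (f₀ z) * q R z) + kineticEnergy (f n) :=
          add_le_add h1 h2
        _ = positivePart Q (f n) + ∫⁻ z, ENNReal.ofReal (f₀ z) * q R z := by
          rw [positivePart]; ring
        _ ≤ _ := by gcongr
    have hlim := le_of_tendsto (tendsto_const_nhds.add (t1.add t2)) key
    rw [lintegral_add_left (hQf₀.indicator (hA R))]
    refine (ENNReal.add_le_add_iff_right hfin).1 (le_trans (le_of_eq ?_) hlim)
    ring

theorem totalMass_le_of_vagueTendsto (hf₀ : Measurable f₀)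
    (h : VagueTendsto (fun n z => ENNReal.ofReal (f n z)) (fun z => ENNReal.ofReal (f₀ z)))
    {M : ℝ≥0∞} (hM : ∀ n, totalMass (f n) ≤ M) : totalMass f₀ ≤ M := by
  have hB : ∀ R : ℕ, MeasurableSet (Metric.ball (0 : Phase) R) :=
    fun R => Metric.isOpen_ball.measurableSet
  refine lintegral_le_of_forall_eventually (F := fun (R : ℕ) => (Metric.ball (0 : Phase) R).indicator
    fun z => ENNReal.ofReal (f₀ z)) (fun R => hf₀.ennreal_ofReal.indicator (hB R)) (fun z => ?_) fun R => ?_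
  · filter_upwards [eventually_mem_ball z] with R hR
    rw [indicator_of_mem hR]
  · rw [lintegral_indicator (hB R)]
    exact le_of_tendsto' (h.tendsto_setLIntegral R) fun n =>
      (setLIntegral_le_lintegral _ _).trans (hM n)

theorem lintegral_far_velocity_le {g : Phase → ℝ} (hg0 : ∀ z, 0 ≤ g z)
    {V : ℝ} (hV : 0 < V) :
    ∫⁻ z, {z : Phase | V ≤ ‖z.2‖}.indicator (fun z => ENNReal.ofReal (g z)) z ≤
      ENNReal.ofReal (2 / V ^ 2) * kineticEnergy g := by
  rw [kineticEnergy, ← mul_assoc, ← ENNReal.ofReal_mul (by positivity),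
    ← lintegral_const_mul' _ _ ENNReal.ofReal_ne_top]
  refine lintegral_mono fun z => ?_
  by_cases hz : V ≤ ‖z.2‖
  · rw [indicator_of_mem (show z ∈ {z : Phase | V ≤ ‖z.2‖} from hz),
      ← ENNReal.ofReal_mul (by positivity)]
    apply ENNReal.ofReal_le_ofReal
    have h1 := hg0 z
    have h2 : V ^ 2 * g z ≤ ‖z.2‖ ^ 2 * g z := by gcongr
    calc g z = 2 / V ^ 2 * (1 / 2) * (V ^ 2 * g z) := by field_simp
      _ ≤ _ := by gcongr
  · rw [indicator_of_notMem (show z ∉ {z : Phase | V ≤ ‖z.2‖} from hz)]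
    exact zero_le

/-- A test function of x alone has unbounded support in v. The kinetic energy bound makes the
contribution of |v| ≥ V of order V⁻², uniformly in n, so it can be cut there. -/
theorem vagueTendsto_spatialDensity (hf : ∀ n, Measurable (f n)) (hf' : ∀ n z, 0 ≤ f n z)
    (hf₀ : Measurable f₀) (hf₀' : ∀ z, 0 ≤ f₀ z)
    (h : VagueTendsto (fun n z => ENNReal.ofReal (f n z)) (fun z => ENNReal.ofReal (f₀ z)))
    {K : ℝ≥0∞} (hK : K < ⊤) (hfK : ∀ n, kineticEnergy (f n) ≤ K) (hf₀K : kineticEnergy f₀ ≤ K) :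
    VagueTendsto (fun n => spatialDensity (f n)) (spatialDensity f₀) := by
  intro ψ C R hψ hC hb hR
  have e : ∀ g : Phase → ℝ, Measurable g → ∫⁻ x, spatialDensity g x * ψ x =
      ∫⁻ z : Phase, ENNReal.ofReal (g z) * ψ z.1 := fun g hg => by
    rw [Measure.volume_eq_prod, lintegral_prod _ (by fun_prop)]
    refine lintegral_congr fun x => ?_
    exact (lintegral_mul_const (ψ x) (by fun_prop)).symm
  simp_rw [fun n => e _ (hf n)]
  rw [e _ hf₀]
  refine tendsto_of_approx fun ε hε => ?_
  obtain ⟨V, hV, hVε⟩ : ∃ V : ℝ, 0 < V ∧ C * (ENNReal.ofReal (2 / V ^ 2) * K) ≤ ε := by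
    have h1 : Tendsto (fun V : ℝ => 2 / V ^ 2) atTop (𝓝 0) :=
      tendsto_const_nhds.div_atTop (tendsto_pow_atTop two_ne_zero)
    have h2 := (ENNReal.continuous_ofReal.tendsto 0).comp h1
    rw [ENNReal.ofReal_zero] at h2
    have h3 := ENNReal.Tendsto.const_mul (a := C)
      (ENNReal.Tendsto.mul_const (b := K) h2 (Or.inr hK.ne)) (Or.inr hC.ne)
    rw [zero_mul, mul_zero] at h3
    obtain ⟨V, h4, h5⟩ := ((h3.eventually_lt_const hε).and (eventually_gt_atTop 0)).exists
    exact ⟨V, h5, h4.le⟩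
  have hVm : MeasurableSet {z : Phase | V ≤ ‖z.2‖} :=
    measurableSet_le measurable_const (by fun_prop)
  set ξ : Phase → ℝ≥0∞ := {z : Phase | V ≤ ‖z.2‖}ᶜ.indicator fun z => ψ z.1
  have hξ : Measurable ξ := (hψ.comp measurable_fst).indicator hVm.compl
  have happ : ∀ g : Phase → ℝ, Measurable g → (∀ z, 0 ≤ g z) → kineticEnergy g ≤ K →
      ∫⁻ z, ENNReal.ofReal (g z) * ξ z ≤ ∫⁻ z : Phase, ENNReal.ofReal (g z) * ψ z.1 ∧
      ∫⁻ z : Phase, ENNReal.ofReal (g z) * ψ z.1 ≤ (∫⁻ z, ENNReal.ofReal (g z) * ξ z) + ε :=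
    fun g hg hg0 hgK => by
      refine ⟨lintegral_mono fun z => mul_le_mul_right (indicator_le_self _ _ z) _, ?_⟩
      calc ∫⁻ z : Phase, ENNReal.ofReal (g z) * ψ z.1
          ≤ ∫⁻ z : Phase, (ENNReal.ofReal (g z) * ξ z +
            C * {z : Phase | V ≤ ‖z.2‖}.indicator (fun z => ENNReal.ofReal (g z)) z) := by
            refine lintegral_mono fun z => ?_
            by_cases hz : z ∈ {z : Phase | V ≤ ‖z.2‖}
            · rw [indicator_of_mem hz, mul_comm C]
              refine le_trans ?_ le_add_self
              gcongr
              exact hb _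
            · simp only [ξ]
              rw [indicator_of_mem (mem_compl hz)]
              exact le_self_add
        _ = (∫⁻ z, ENNReal.ofReal (g z) * ξ z) +
            C * ∫⁻ z, {z : Phase | V ≤ ‖z.2‖}.indicator (fun z => ENNReal.ofReal (g z)) z := by
            rw [lintegral_add_left (by fun_prop), lintegral_const_mul' _ _ hC.ne]
        _ ≤ (∫⁻ z, ENNReal.ofReal (g z) * ξ z) + C * (ENNReal.ofReal (2 / V ^ 2) * K) := by
            gcongr
            exact (lintegral_far_velocity_le hg0 hV).trans (by gcongr)
        _ ≤ _ := by gcongr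
  refine ⟨fun n => ∫⁻ z, ENNReal.ofReal (f n z) * ξ z, ∫⁻ z, ENNReal.ofReal (f₀ z) * ξ z, ?_,
    fun n => happ _ (hf n) (hf' n) (hfK n), happ _ hf₀ hf₀' hf₀K⟩
  refine h ξ C (max R V) hξ hC (fun z => (indicator_le_self _ _ z).trans (hb _)) fun z hz => ?_
  by_cases hz2 : V ≤ ‖z.2‖
  · simp only [ξ]
    rw [indicator_of_notMem (show z ∉ {z : Phase | V ≤ ‖z.2‖}ᶜ from fun h => h hz2)]
  · have h1 : R ≤ ‖z.1‖ := by
      by_contra! h1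
      push Not at hz2
      have : ‖z‖ < max R V := by
        rw [Prod.norm_def]
        exact max_lt (h1.trans_le (le_max_left _ _)) (hz2.trans_le (le_max_right _ _))
      linarith
    simp only [ξ]
    rw [indicator_of_mem (show z ∈ {z : Phase | V ≤ ‖z.2‖}ᶜ from hz2), hR _ h1]

/-- Along a sequence with bounded mass and bounded positive part of the energy, a subsequence
converges. -/
theorem exists_subseq_vagueTendsto_of_admissible (hQ : CasimirAssumptions Q C₁ C₂ F₀ k₁ k₂ k₃)
    (hf : ∀ n, Admissible Q (f n)) {M P : ℝ≥0∞} (hM : M < ⊤) (hP : P < ⊤)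
    (hfM : ∀ n, totalMass (f n) ≤ M) (hfP : ∀ n, positivePart Q (f n) ≤ P) :
    ∃ (f₀ : Phase → ℝ) (φ : ℕ → ℕ), Measurable f₀ ∧ (∀ z, 0 ≤ f₀ z) ∧ StrictMono φ ∧
      VagueTendsto (fun n z => ENNReal.ofReal (f (φ n) z)) (fun z => ENNReal.ofReal (f₀ z)) := by
  obtain ⟨C, hC, h53⟩ := hQ.lintegral_rpow_five_thirds_le one_pos
  set B : ℝ≥0∞ := P + ENNReal.ofReal C * M
  have hB : B < ⊤ := ENNReal.add_lt_top.2 ⟨hP, ENNReal.mul_lt_top ENNReal.ofReal_lt_top hM⟩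
  have hfB : ∀ n, ∫⁻ z, ENNReal.ofReal (f n z ^ (5 / 3 : ℝ)) ≤ B := fun n => by
    refine (h53 _ (hf n).measurable (hf n).nonneg).trans ?_
    rw [ENNReal.ofReal_one, one_mul]
    exact add_le_add (le_self_add.trans (hfP n)) (by gcongr; exact hfM n)
  refine exists_subseq_vagueTendsto (fun n => (hf n).measurable) hM hfM fun ε hε => ?_
  have h1 := (ENNReal.continuous_ofReal.tendsto 0).comp
    (tendsto_rpow_neg_atTop (show (0 : ℝ) < 2 / 3 by norm_num))
  rw [ENNReal.ofReal_zero] at h1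
  have h2 := ENNReal.Tendsto.mul_const (b := B) h1 (Or.inr hB.ne)
  rw [zero_mul] at h2
  obtain ⟨N, hN⟩ := eventually_atTop.1 ((h2.eventually_lt_const hε).and (eventually_gt_atTop 0))
  refine ⟨N, fun N' hN' n => ?_⟩
  obtain ⟨hlt, hpos⟩ := hN N' hN'
  -- Where f_n > N' one has f_n ≤ N'^(-2/3) f_n^(5/3), so the 5/3 bound supplies the uniform tail
  -- estimate.
  calc ∫⁻ z, ENNReal.ofReal (f n z - N')
      ≤ ∫⁻ z, ENNReal.ofReal (N' ^ (-(2 / 3) : ℝ)) * ENNReal.ofReal (f n z ^ (5 / 3 : ℝ)) := by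
        refine lintegral_mono fun z => ?_
        have h0 := (hf n).nonneg z
        rw [← ENNReal.ofReal_mul (by positivity)]
        rcases le_or_gt (f n z) N' with h | h
        · rw [ENNReal.ofReal_of_nonpos (by linarith)]
          exact zero_le
        · apply ENNReal.ofReal_le_ofReal
          have hz : 0 < f n z := hpos.trans h
          have e1 : f n z ^ (5 / 3 : ℝ) = f n z ^ (2 / 3 : ℝ) * f n z := by
            rw [← Real.rpow_add_one hz.ne']; norm_num
          have h3 : 1 ≤ N' ^ (-(2 / 3) : ℝ) * f n z ^ (2 / 3 : ℝ) := by
            rw [Real.rpow_neg hpos.le, ← div_eq_inv_mul, one_le_div (by positivity)]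
            gcongr
          rw [e1, ← mul_assoc]
          have := mul_le_mul_of_nonneg_right h3 h0
          linarith
    _ ≤ ENNReal.ofReal (N' ^ (-(2 / 3) : ℝ)) * B := by
        rw [lintegral_const_mul' _ _ ENNReal.ofReal_ne_top]
        gcongr
        exact hfB n
    _ ≤ ε := hlt.le

end LowerSemicontinuity

/-! ### Nonvanishing: energy forces concentration of mass. -/

section Nonvanishing

/-- If the self-energy of a density is bounded below, then some ball of fixed radius carries a
fixed amount of mass. -/
theorem exists_ball_lintegral_ge {M A d : ℝ≥0∞} (hM : M < ⊤) (hA : A < ⊤) (hd : 0 < d)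
    (hd' : d < ⊤) : ∃ (L : ℝ) (δ : ℝ≥0∞), 0 < δ ∧ ∀ ρ : E3 → ℝ≥0∞, Measurable ρ →
      ∫⁻ x, ρ x ≤ M → fourThirds ρ ≤ A → d ≤ coulombEnergy ρ ρ →
      ∃ a : E3, δ ≤ ∫⁻ x in Metric.ball a L, ρ x := by
  obtain ⟨η, L, hη, hL, hnf⟩ := exists_near_add_far_le hM hA (ENNReal.half_pos hd.ne')
  set c : ℝ≥0∞ := ENNReal.ofReal η⁻¹ * (M + 1)
  have hc : c ≠ ⊤ := (ENNReal.mul_lt_top ENNReal.ofReal_lt_top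
    (ENNReal.add_lt_top.2 ⟨hM, ENNReal.one_lt_top⟩)).ne
  have hc0 : c ≠ 0 := mul_ne_zero (by simpa using hη) (by simp)
  refine ⟨L, d / 4 / c, ENNReal.div_pos (ENNReal.div_pos hd.ne' (by simp)).ne' hc,
    fun ρ hρ hρM hρA hρd => ?_⟩
  by_contra! hno
  have hmidm : Measurable (midCoulomb η L) :=
    (measurable_nearCoulomb L).indicator Metric.isOpen_ball.measurableSet.compl
  -- Suppose every ball of radius L has little mass. The middle kernel is at most η⁻¹ and lives at
  -- distances below L, so it contributes at most d/4; near and far parts contribute at most d/2,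
  -- and the total falls short of d.
  have hmid : kernelEnergy (midCoulomb η L) ρ ρ ≤ d / 4 := by
    have h1 : ∀ x y, ρ x * ρ y * midCoulomb η L (x - y) ≤
        ρ x * (ENNReal.ofReal η⁻¹ * (Metric.ball x L).indicator ρ y) := fun x y => by
      by_cases h2 : x - y ∈ Metric.ball (0 : E3) L
      · have h3 : y ∈ Metric.ball x L := by
          rw [mem_ball_iff_norm, norm_sub_rev]; simpa using h2
        rw [indicator_of_mem h3, mul_assoc, mul_comm (ENNReal.ofReal _)]
        gcongr
        by_cases h4 : x - y ∈ Metric.ball (0 : E3) η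
        · rw [midCoulomb, indicator_of_notMem (notMem_compl_iff.2 h4)]; exact zero_le
        · exact (midCoulomb_le η L _).trans (coulomb_le_of_le_norm hη (by simpa using h4))
      · have : midCoulomb η L (x - y) = 0 := by
          rw [midCoulomb]
          refine le_antisymm ((indicator_le_self _ _ _).trans ?_) zero_le
          rw [nearCoulomb, indicator_of_notMem h2]
        rw [this, mul_zero]
        exact zero_le
    calc kernelEnergy (midCoulomb η L) ρ ρ
        ≤ ∫⁻ x, ∫⁻ y, ρ x * (ENNReal.ofReal η⁻¹ * (Metric.ball x L).indicator ρ y) :=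
          lintegral_mono fun x => lintegral_mono fun y => h1 x y
      _ ≤ ∫⁻ x, ρ x * (ENNReal.ofReal η⁻¹ * (d / 4 / c)) := by
          refine lintegral_mono fun x => ?_
          have hm : Measurable fun y => (Metric.ball x L).indicator ρ y :=
            hρ.indicator Metric.isOpen_ball.measurableSet
          rw [lintegral_const_mul _ (hm.const_mul _), lintegral_const_mul _ hm,
            lintegral_indicator Metric.isOpen_ball.measurableSet]
          gcongr
          exact (hno x).le
      _ = (∫⁻ x, ρ x) * (ENNReal.ofReal η⁻¹ * (d / 4 / c)) := lintegral_mul_const _ hρ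
      _ ≤ (M + 1) * (ENNReal.ofReal η⁻¹ * (d / 4 / c)) := by
          gcongr
          exact hρM.trans le_self_add
      _ = c * (d / 4 / c) := by simp only [c]; ring
      _ = d / 4 := ENNReal.mul_div_cancel hc0 hc
  have h2 : coulombEnergy ρ ρ ≤ d / 4 + d / 2 := by
    refine (kernelEnergy_mono (coulomb_le_near_add_mid_add_far η L) le_rfl le_rfl).trans ?_
    rw [kernelEnergy_add_kernel hρ hρ hmidm,
      kernelEnergy_add_kernel hρ hρ (measurable_nearCoulomb η)]
    exact add_le_add hmid (hnf ρ ρ hρ hρ hρM hρM hρA hρA)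
  have h3 : d / 4 + d / 2 < d := by
    lift d to NNReal using hd'.ne
    have hd0 : 0 < d := by simpa using hd
    have : (d / 4 + d / 2 : NNReal) < d := by
      rw [← NNReal.coe_lt_coe]; push_cast
      have : (0 : ℝ) < d := hd0
      linarith
    have e4 : ((d : ℝ≥0∞) / 4) = ((d / 4 : NNReal) : ℝ≥0∞) := by
      rw [ENNReal.coe_div (by norm_num)]; rfl
    have e2 : ((d : ℝ≥0∞) / 2) = ((d / 2 : NNReal) : ℝ≥0∞) := by
      rw [ENNReal.coe_div (by norm_num)]; rfl
    rw [e4, e2, ← ENNReal.coe_add]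
    exact_mod_cast this
  exact absurd (hρd.trans h2) (not_le.2 h3)

end Nonvanishing

/-! ### Tightness and convergence of the Coulomb energy. -/

theorem tendsto_setLIntegral_compl_ball {α : Type*} [NormedAddCommGroup α] [MeasureSpace α]
    [OpensMeasurableSpace α] {F : α → ℝ≥0∞} (hF : Measurable F) (h : ∫⁻ x, F x < ⊤) :
    Tendsto (fun R : ℕ => ∫⁻ x in (Metric.ball 0 (R : ℝ))ᶜ, F x) atTop (𝓝 0) := by
  have hB : ∀ R : ℕ, MeasurableSet (Metric.ball (0 : α) R)ᶜ :=
    fun R => Metric.isOpen_ball.measurableSet.compl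
  simp_rw [← lintegral_indicator (hB _)]
  have h0 : (0 : ℝ≥0∞) = ∫⁻ x : α, 0 := by simp
  rw [h0]
  refine tendsto_lintegral_of_dominated_convergence F (fun R => hF.indicator (hB R))
    (fun R => .of_forall fun x => indicator_le_self _ _ x) h.ne (.of_forall fun x => ?_)
  refine tendsto_const_nhds.congr' ?_
  filter_upwards [eventually_mem_ball x] with R hR
  rw [indicator_of_notMem (notMem_compl_iff.2 hR)]

theorem tendsto_setLIntegral_ball {α : Type*} [NormedAddCommGroup α] [MeasureSpace α]
    [OpensMeasurableSpace α] {F : α → ℝ≥0∞} (hF : Measurable F) (h : ∫⁻ x, F x < ⊤) :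
    Tendsto (fun R : ℕ => ∫⁻ x in Metric.ball 0 (R : ℝ), F x) atTop (𝓝 (∫⁻ x, F x)) := by
  have hB : ∀ R : ℕ, MeasurableSet (Metric.ball (0 : α) R) :=
    fun R => Metric.isOpen_ball.measurableSet
  simp_rw [← lintegral_indicator (hB _)]
  refine tendsto_lintegral_of_dominated_convergence F (fun R => hF.indicator (hB R))
    (fun R => .of_forall fun x => indicator_le_self _ _ x) h.ne (.of_forall fun x => ?_)
  refine tendsto_const_nhds.congr' ?_
  filter_upwards [eventually_mem_ball x] with R hR
  rw [indicator_of_mem hR]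

theorem tendsto_of_eventually_approx {ι : Type*} {l : Filter ι} {a : ι → ℝ≥0∞} {a₀ : ℝ≥0∞}
    (h : ∀ ε : ℝ≥0∞, 0 < ε → ∃ (b : ι → ℝ≥0∞) (b₀ : ℝ≥0∞), Tendsto b l (𝓝 b₀) ∧
      (∀ᶠ i in l, b i ≤ a i ∧ a i ≤ b i + ε) ∧ b₀ ≤ a₀ ∧ a₀ ≤ b₀ + ε) : Tendsto a l (𝓝 a₀) := by
  refine tendsto_of_approx fun ε hε => ?_
  obtain ⟨b, b₀, hb, hab, h₀⟩ := h ε hε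
  classical
  refine ⟨fun i => if b i ≤ a i ∧ a i ≤ b i + ε then b i else a i, b₀, ?_, fun i => ?_, h₀⟩
  · refine hb.congr' ?_
    filter_upwards [hab] with i hi
    rw [if_pos hi]
  · dsimp only
    split_ifs with hi
    · exact hi
    · exact ⟨le_rfl, le_self_add⟩

section Tight

/-- Near and far interactions are already small; the middle kernel is bounded, so its contribution
is controlled by the product of the masses. -/
theorem exists_coulombEnergy_le_of_lintegral_le {M A ε : ℝ≥0∞} (hM : M < ⊤) (hA : A < ⊤)
    (hε : 0 < ε) : ∃ δ : ℝ≥0∞, 0 < δ ∧ ∀ ρ σ : E3 → ℝ≥0∞, Measurable ρ → Measurable σ →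
      ∫⁻ x, ρ x ≤ M → ∫⁻ x, σ x ≤ M → fourThirds ρ ≤ A → fourThirds σ ≤ A → ∫⁻ x, ρ x ≤ δ →
      coulombEnergy ρ σ ≤ ε := by
  rcases eq_or_ne ε ⊤ with rfl | hεt
  · exact ⟨1, one_pos, fun _ _ _ _ _ _ _ _ _ => le_top⟩
  obtain ⟨η, L, hη, hL, hnf⟩ := exists_near_add_far_le hM hA (ENNReal.half_pos hε.ne')
  set c : ℝ≥0∞ := ENNReal.ofReal η⁻¹ * (M + 1)
  have hc : c ≠ ⊤ := (ENNReal.mul_lt_top ENNReal.ofReal_lt_top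
    (ENNReal.add_lt_top.2 ⟨hM, ENNReal.one_lt_top⟩)).ne
  have hc0 : c ≠ 0 := mul_ne_zero (by simpa using hη) (by simp)
  refine ⟨ε / 2 / c, ENNReal.div_pos (ENNReal.half_pos hε.ne').ne' hc,
    fun ρ σ hρ hσ hρM hσM hρA hσA hρδ => ?_⟩
  have hmid : Measurable (midCoulomb η L) :=
    (measurable_nearCoulomb L).indicator Metric.isOpen_ball.measurableSet.compl
  have hmidle : ∀ x, midCoulomb η L x ≤ ENNReal.ofReal η⁻¹ := fun x => by
    by_cases hx : x ∈ Metric.ball (0 : E3) η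
    · simp [midCoulomb, hx]
    · exact (midCoulomb_le η L _).trans (coulomb_le_of_le_norm hη (by simpa using hx))
  calc coulombEnergy ρ σ
      ≤ kernelEnergy (midCoulomb η L) ρ σ +
          (kernelEnergy (nearCoulomb η) ρ σ + kernelEnergy (farCoulomb L) ρ σ) := by
        refine (kernelEnergy_mono (coulomb_le_near_add_mid_add_far η L) le_rfl le_rfl).trans ?_
        rw [kernelEnergy_add_kernel hρ hσ hmid,
          kernelEnergy_add_kernel hρ hσ (measurable_nearCoulomb η)]
    _ ≤ ε / 2 + ε / 2 := by
        refine add_le_add ?_ (hnf ρ σ hρ hσ hρM hσM hρA hσA)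
        refine (kernelEnergy_le_of_le hmidle hρ hσ).trans ?_
        calc ENNReal.ofReal η⁻¹ * ((∫⁻ x, ρ x) * ∫⁻ x, σ x)
            ≤ ENNReal.ofReal η⁻¹ * (ε / 2 / c * (M + 1)) := by
              gcongr
              exact hσM.trans le_self_add
          _ = ε / 2 / c * c := by ring
          _ = ε / 2 := ENNReal.div_mul_cancel hc0 hc
    _ = ε := ENNReal.add_halves ε

theorem fourThirds_mono {ρ σ : E3 → ℝ≥0∞} (h : ρ ≤ σ) : fourThirds ρ ≤ fourThirds σ :=
  lintegral_mono fun x => ENNReal.rpow_le_rpow (h x) (by norm_num)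

theorem coulombEnergy_indicator_add_compl {ρ σ : E3 → ℝ≥0∞} {s : Set E3} (hs : MeasurableSet s)
    (hρ : Measurable ρ) (hσ : Measurable σ) : coulombEnergy ρ σ =
      coulombEnergy (s.indicator ρ) σ + coulombEnergy (sᶜ.indicator ρ) σ := by
  rw [← coulombEnergy_add_left (hρ.indicator hs) hσ]
  congr 1
  funext x
  exact (congrFun (indicator_self_add_compl s ρ) x).symm

/-- Convergence of the total mass and of the mass in a ball gives convergence of the mass outside
it. Hence one radius makes the outer part of ρ_n negligible for all large n, and the bounded-support
case applies to the rest. -/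
theorem tendsto_coulombEnergy_of_tendsto_lintegral {ρ σ : ℕ → E3 → ℝ≥0∞} {ρ₀ σ₀ : E3 → ℝ≥0∞}
    {M A : ℝ≥0∞}
    (hρ : VagueTendsto ρ ρ₀) (hσ : VagueTendsto σ σ₀)
    (hρm : ∀ n, Measurable (ρ n)) (hσm : ∀ n, Measurable (σ n)) (hρ₀m : Measurable ρ₀)
    (hσ₀m : Measurable σ₀) (hM : M < ⊤) (hA : A < ⊤)
    (hρM : ∀ n, ∫⁻ x, ρ n x ≤ M) (hσM : ∀ n, ∫⁻ x, σ n x ≤ M)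
    (hσ₀M : ∫⁻ x, σ₀ x ≤ M) (hρ₀M : ∫⁻ x, ρ₀ x ≤ M)
    (hρA : ∀ n, fourThirds (ρ n) ≤ A) (hσA : ∀ n, fourThirds (σ n) ≤ A)
    (hρ₀A : fourThirds ρ₀ ≤ A) (hσ₀A : fourThirds σ₀ ≤ A)
    (h : Tendsto (fun n => ∫⁻ x, ρ n x) atTop (𝓝 (∫⁻ x, ρ₀ x))) :
    Tendsto (fun n => coulombEnergy (ρ n) (σ n)) atTop (𝓝 (coulombEnergy ρ₀ σ₀)) := by
  refine tendsto_of_eventually_approx fun ε hε => ?_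
  obtain ⟨δ, hδ, hsmall⟩ := exists_coulombEnergy_le_of_lintegral_le hM hA hε
  obtain ⟨R, hR⟩ := ((tendsto_setLIntegral_compl_ball hρ₀m (hρ₀M.trans_lt hM)).eventually
    (gt_mem_nhds hδ)).exists
  set s : Set E3 := Metric.ball 0 (R : ℝ)
  have hs : MeasurableSet s := Metric.isOpen_ball.measurableSet
  have hle : ∀ (t : Set E3) (τ : E3 → ℝ≥0∞), t.indicator τ ≤ τ := fun t τ => indicator_le_self _ _
  have hout : ∀ τ υ : E3 → ℝ≥0∞, Measurable τ → Measurable υ → ∫⁻ x, τ x ≤ M → ∫⁻ x, υ x ≤ M →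
      fourThirds τ ≤ A → fourThirds υ ≤ A → ∫⁻ x in sᶜ, τ x ≤ δ →
      coulombEnergy (s.indicator τ) υ ≤ coulombEnergy τ υ ∧
      coulombEnergy τ υ ≤ coulombEnergy (s.indicator τ) υ + ε :=
    fun τ υ hτ hυ h1 h2 h3 h4 h5 => by
      refine ⟨coulombEnergy_mono (hle _ _) le_rfl, ?_⟩
      rw [coulombEnergy_indicator_add_compl hs hτ hυ]
      gcongr
      exact hsmall _ _ (hτ.indicator hs.compl) hυ ((lintegral_mono (hle _ _)).trans h1) h2
        ((fourThirds_mono (hle _ _)).trans h3) h4 (by rwa [lintegral_indicator hs.compl])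
  refine ⟨fun n => coulombEnergy (s.indicator (ρ n)) (σ n), coulombEnergy (s.indicator ρ₀) σ₀,
    ?_, ?_, hout _ _ hρ₀m hσ₀m hρ₀M hσ₀M hρ₀A hσ₀A hR.le⟩
  · exact tendsto_coulombEnergy (r := R) (hρ.indicator hs) hσ (fun n => (hρm n).indicator hs) hσm
      (hρ₀m.indicator hs) hσ₀m hM hA (fun n => (lintegral_mono (hle _ _)).trans (hρM n)) hσM hσ₀M
      ((lintegral_mono (hle _ _)).trans hρ₀M) (fun n => (fourThirds_mono (hle _ _)).trans (hρA n))
      hσA ((fourThirds_mono (hle _ _)).trans hρ₀A) hσ₀A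
      (fun n x hx => indicator_of_notMem (by simpa [s] using hx) _)
      (fun x hx => indicator_of_notMem (by simpa [s] using hx) _)
  · have e : ∀ τ : E3 → ℝ≥0∞, ∫⁻ x, τ x ≤ M →
        ∫⁻ x in sᶜ, τ x = (∫⁻ x, τ x) - ∫⁻ x in s, τ x := fun τ hτ => by
      refine ENNReal.eq_sub_of_add_eq
        ((setLIntegral_le_lintegral _ _).trans_lt (hτ.trans_lt hM)).ne ?_
      rw [add_comm]
      exact lintegral_add_compl τ hs
    have h1 : Tendsto (fun n => ∫⁻ x in sᶜ, ρ n x) atTop (𝓝 (∫⁻ x in sᶜ, ρ₀ x)) := by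
      rw [e _ hρ₀M]
      simp_rw [fun n => e _ (hρM n)]
      exact ENNReal.Tendsto.sub h (hρ.tendsto_setLIntegral R) (Or.inl (hρ₀M.trans_lt hM).ne)
    filter_upwards [h1.eventually (gt_mem_nhds hR)] with n hn
    exact hout _ _ (hρm n) (hσm n) (hρM n) (hσM n) (hρA n) (hσA n) hn.le

end Tight

/-! ### Cutting a density in space. -/

section Cut

variable {Q : ℝ → ℝ} {C₁ C₂ F₀ k₁ k₂ k₃ : ℝ} {f : Phase → ℝ} {s : Set E3}

/-- The restriction of a phase space density to positions in `s`. -/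
def cut (s : Set E3) (f : Phase → ℝ) : Phase → ℝ := (Prod.fst ⁻¹' s).indicator f

theorem cut_nonneg (hf : ∀ z, 0 ≤ f z) (z : Phase) : 0 ≤ cut s f z :=
  indicator_nonneg (fun z _ => hf z) z

theorem spatialDensity_cut (s : Set E3) (f : Phase → ℝ) :
    spatialDensity (cut s f) = s.indicator (spatialDensity f) := by
  funext x
  by_cases hx : x ∈ s
  · rw [indicator_of_mem hx]
    refine lintegral_congr fun v => ?_
    rw [cut, indicator_of_mem (show (x, v) ∈ Prod.fst ⁻¹' s from hx)]
  · rw [indicator_of_notMem hx, spatialDensity]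
    refine (lintegral_congr fun v => ?_).trans lintegral_zero
    rw [cut, indicator_of_notMem (show (x, v) ∉ Prod.fst ⁻¹' s from hx), ENNReal.ofReal_zero]

theorem lintegral_cut (hs : MeasurableSet s) {G : Phase → ℝ → ℝ≥0∞} (hG : ∀ z, G z 0 = 0) :
    ∫⁻ z, G z (cut s f z) = ∫⁻ z in Prod.fst ⁻¹' s, G z (f z) := by
  rw [← lintegral_indicator (measurable_fst hs)]
  refine lintegral_congr fun z => ?_
  by_cases hz : z ∈ Prod.fst ⁻¹' s
  · rw [cut, indicator_of_mem hz, indicator_of_mem hz]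
  · rw [cut, indicator_of_notMem hz, indicator_of_notMem hz, hG]

theorem lintegral_cut_add_compl (hs : MeasurableSet s) {G : Phase → ℝ → ℝ≥0∞}
    (hG : ∀ z, G z 0 = 0) :
    (∫⁻ z, G z (cut s f z)) + ∫⁻ z, G z (cut sᶜ f z) = ∫⁻ z, G z (f z) := by
  rw [lintegral_cut hs hG, lintegral_cut hs.compl hG, preimage_compl]
  exact lintegral_add_compl _ (measurable_fst hs)

theorem totalMass_cut_add_compl (hs : MeasurableSet s) :
    totalMass (cut s f) + totalMass (cut sᶜ f) = totalMass f :=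
  lintegral_cut_add_compl (G := fun _ t => ENNReal.ofReal t) hs (by simp)

theorem positivePart_cut_add_compl (hQ : CasimirAssumptions Q C₁ C₂ F₀ k₁ k₂ k₃)
    (hs : MeasurableSet s) :
    positivePart Q (cut s f) + positivePart Q (cut sᶜ f) = positivePart Q f := by
  have h1 : casimir Q (cut s f) + casimir Q (cut sᶜ f) = casimir Q f :=
    lintegral_cut_add_compl (G := fun _ t => ENNReal.ofReal (Q t)) hs (by simp [hQ.map_zero])
  have h2 : kineticEnergy (cut s f) + kineticEnergy (cut sᶜ f) = kineticEnergy f := by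
    rw [kineticEnergy, kineticEnergy, kineticEnergy, ← mul_add]
    congr 1
    exact lintegral_cut_add_compl (G := fun z t => ENNReal.ofReal (‖z.2‖ ^ 2 * t)) hs (by simp)
  rw [positivePart, positivePart, positivePart, ← h1, ← h2]
  ring

theorem Admissible.cut (hQ : CasimirAssumptions Q C₁ C₂ F₀ k₁ k₂ k₃) (h : Admissible Q f)
    (hs : MeasurableSet s) : Admissible Q (cut s f) where
  measurable := h.measurable.indicator (measurable_fst hs)
  nonneg := cut_nonneg h.nonneg
  totalMass_lt_top := (le_self_add.trans (totalMass_cut_add_compl hs).le).trans_lt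
    h.totalMass_lt_top
  positivePart_lt_top := (le_self_add.trans (positivePart_cut_add_compl hQ hs).le).trans_lt
    h.positivePart_lt_top

/-- P is additive over disjoint supports, as Q(0) = 0, and D is bilinear and symmetric, so only the
cross term remains. -/
theorem Admissible.energy_eq_cut (hQ : CasimirAssumptions Q C₁ C₂ F₀ k₁ k₂ k₃)
    (h : Admissible Q f) (hs : MeasurableSet s) :
    energy Q f = energy Q (VlasovPoisson.cut s f) + energy Q (VlasovPoisson.cut sᶜ f) -
      2 * couplingConst * (coulombEnergy (s.indicator (spatialDensity f))
        (sᶜ.indicator (spatialDensity f))).toReal := by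
  have hρ := measurable_spatialDensity h.measurable
  have hD := h.selfEnergy_lt_top hQ
  have hadd : selfEnergy f = selfEnergy (VlasovPoisson.cut s f) +
      2 * coulombEnergy (s.indicator (spatialDensity f)) (sᶜ.indicator (spatialDensity f)) +
      selfEnergy (VlasovPoisson.cut sᶜ f) := by
    rw [selfEnergy, selfEnergy, selfEnergy, spatialDensity_cut, spatialDensity_cut,
      ← coulombEnergy_add_self (hρ.indicator hs) (hρ.indicator hs.compl)]
    have e : (fun x => s.indicator (spatialDensity f) x + sᶜ.indicator (spatialDensity f) x) =
        spatialDensity f := indicator_self_add_compl s (spatialDensity f)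
    rw [e]
  have h12 := (h.cut hQ hs).selfEnergy_lt_top hQ
  have h22 := (h.cut hQ hs.compl).selfEnergy_lt_top hQ
  have hx : 2 * coulombEnergy (s.indicator (spatialDensity f)) (sᶜ.indicator (spatialDensity f)) ≠
      ⊤ := (lt_of_le_of_lt (by rw [hadd]; exact (self_le_add_left _ _).trans le_self_add) hD).ne
  have hP := congrArg ENNReal.toReal (positivePart_cut_add_compl (f := f) hQ hs)
  rw [ENNReal.toReal_add (h.cut hQ hs).positivePart_lt_top.ne
    (h.cut hQ hs.compl).positivePart_lt_top.ne] at hP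
  rw [energy, energy, energy, ← hP, hadd, ENNReal.toReal_add (ENNReal.add_ne_top.2 ⟨h12.ne, hx⟩)
    h22.ne, ENNReal.toReal_add h12.ne hx, ENNReal.toReal_mul, ENNReal.toReal_ofNat]
  ring

end Cut

/-! ### Translation invariance. -/

section Shift

variable {Q : ℝ → ℝ} {f g : Phase → ℝ}

instance isAddRightInvariant_volume_phase : (volume : Measure Phase).IsAddRightInvariant := by
  rw [Measure.volume_eq_prod]
  infer_instance

theorem shift_apply (a : E3) (f : Phase → ℝ) (z : Phase) : shift a f z = f (z + (a, 0)) := by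
  simp [shift, Prod.add_def]

theorem spatialDensity_shift (a : E3) (f : Phase → ℝ) (x : E3) :
    spatialDensity (shift a f) x = spatialDensity f (x + a) := rfl

theorem totalMass_shift (a : E3) (f : Phase → ℝ) : totalMass (shift a f) = totalMass f := by
  simp_rw [totalMass, shift_apply]
  exact lintegral_add_right_eq_self (fun z => ENNReal.ofReal (f z)) ((a, 0) : Phase)

theorem positivePart_shift (a : E3) (f : Phase → ℝ) :
    positivePart Q (shift a f) = positivePart Q f := by
  have h1 : casimir Q (shift a f) = casimir Q f := by
    simp_rw [casimir, shift_apply]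
    exact lintegral_add_right_eq_self (fun z => ENNReal.ofReal (Q (f z))) ((a, 0) : Phase)
  have h2 : kineticEnergy (shift a f) = kineticEnergy f := by
    rw [kineticEnergy, kineticEnergy, ← lintegral_add_right_eq_self
      (fun z : Phase => ENNReal.ofReal (‖z.2‖ ^ 2 * f z)) ((a, 0) : Phase)]
    simp [shift_apply]
  rw [positivePart, positivePart, h1, h2]

theorem selfEnergy_shift (a : E3) (f : Phase → ℝ) : selfEnergy (shift a f) = selfEnergy f := by
  rw [selfEnergy, selfEnergy, coulombEnergy, coulombEnergy, ← lintegral_add_right_eq_self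
    (fun x => ∫⁻ y, spatialDensity f x * spatialDensity f y * coulomb (x - y)) a]
  refine lintegral_congr fun x => ?_
  rw [← lintegral_add_right_eq_self
    (fun y => spatialDensity f (x + a) * spatialDensity f y * coulomb (x + a - y)) a]
  simp_rw [spatialDensity_shift, add_sub_add_right_eq_sub]

theorem energy_shift (a : E3) (f : Phase → ℝ) : energy Q (shift a f) = energy Q f := by
  rw [energy, energy, positivePart_shift, selfEnergy_shift]

theorem Admissible.shift (h : Admissible Q f) (a : E3) : Admissible Q (shift a f) where
  measurable := h.measurable.comp (by fun_prop)
  nonneg z := h.nonneg _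
  totalMass_lt_top := by rw [totalMass_shift]; exact h.totalMass_lt_top
  positivePart_lt_top := by rw [positivePart_shift]; exact h.positivePart_lt_top

theorem shift_congr_ae (h : f =ᵐ[volume] g) (a : E3) :
    VlasovPoisson.shift a f =ᵐ[volume] VlasovPoisson.shift a g := by
  have h1 := (measurePreserving_add_right volume ((a, 0) : Phase)).quasiMeasurePreserving.ae_eq_comp h
  filter_upwards [h1] with z hz
  rw [shift_apply, shift_apply]
  exact hz

theorem setLIntegral_ball_spatialDensity_shift (a : E3) (f : Phase → ℝ) (L : ℝ) :
    ∫⁻ x in Metric.ball 0 L, spatialDensity (VlasovPoisson.shift a f) x =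
      ∫⁻ x in Metric.ball a L, spatialDensity f x := by
  rw [← lintegral_indicator Metric.isOpen_ball.measurableSet,
    ← lintegral_indicator Metric.isOpen_ball.measurableSet,
    ← lintegral_add_right_eq_self ((Metric.ball a L).indicator (spatialDensity f)) a]
  refine lintegral_congr fun x => ?_
  by_cases hx : x ∈ Metric.ball (0 : E3) L
  · rw [indicator_of_mem hx, indicator_of_mem (by simpa using hx), spatialDensity_shift]
  · rw [indicator_of_notMem hx, indicator_of_notMem (by simpa using hx)]

end Shift

/-! ### Vague limits of minimizing sequences: no loss of mass. -/

theorem rpow_five_thirds_add_lt_one {x : ℝ} (h0 : 0 < x) (h1 : x < 1) :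
    x ^ (5 / 3 : ℝ) + (1 - x) ^ (5 / 3 : ℝ) < 1 := by
  have e1 := Real.rpow_lt_rpow_of_exponent_gt h0 h1 (show (1 : ℝ) < 5 / 3 by norm_num)
  have e2 := Real.rpow_lt_rpow_of_exponent_gt (sub_pos.2 h1) (sub_lt_self 1 h0)
    (show (1 : ℝ) < 5 / 3 by norm_num)
  rw [Real.rpow_one] at e1 e2
  linarith

theorem integrable_inner_of_memLp {F G : E3 → E3} (hF : MemLp F 2) (hG : MemLp G 2) :
    Integrable fun x => inner ℝ (F x) (G x) := by
  refine (integrable_congr ?_).1 (L2.integrable_inner (𝕜 := ℝ) (hF.toLp F) (hG.toLp G))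
  filter_upwards [hF.coeFn_toLp, hG.coeFn_toLp] with x h1 h2
  rw [h1, h2]

variable {Q : ℝ → ℝ} {C₁ C₂ F₀ k₁ k₂ k₃ : ℝ} {f : ℕ → Phase → ℝ} {f₀ : Phase → ℝ} {M h : ℝ}

theorem rpow_mul_le_energy (hQ : CasimirAssumptions Q C₁ C₂ F₀ k₁ k₂ k₃)
    (hh : ∀ f, Admissible Q f → totalMass f = ENNReal.ofReal M → h ≤ energy Q f)
    {g : Phase → ℝ} (hg : Admissible Q g) {x : ℝ} (h0 : 0 ≤ x) (h1 : x ≤ 1)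
    (hm : totalMass g = ENNReal.ofReal (x * M)) : x ^ (5 / 3 : ℝ) * h ≤ energy Q g := by
  have e3 : (x ^ (1 / 3 : ℝ)) ^ 3 = x := by
    rw [← Real.rpow_natCast, ← Real.rpow_mul h0]; norm_num
  have e5 : (x ^ (1 / 3 : ℝ)) ^ 5 = x ^ (5 / 3 : ℝ) := by
    rw [← Real.rpow_natCast, ← Real.rpow_mul h0]; norm_num
  rw [← e5]
  exact pow_five_mul_le_energy hQ hh hg (by positivity) (Real.rpow_le_one h0 h1 (by norm_num))
    (by rw [e3, hm])

theorem totalMass_cut {s : Set E3} (hs : MeasurableSet s) {g : Phase → ℝ} (hg : Measurable g) :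
    totalMass (cut s g) = ∫⁻ x in s, spatialDensity g x := by
  have hm : Measurable (cut s g) := hg.indicator (measurable_fst hs)
  rw [← lintegral_spatialDensity hm, spatialDensity_cut,
    lintegral_indicator hs]

/-- Splitting a density of minimal mass into two parts, in terms of the fraction of the mass of
the first part. -/
theorem Admissible.rpow_add_rpow_mul_sub_le_energy (hQ : CasimirAssumptions Q C₁ C₂ F₀ k₁ k₂ k₃)
    (hM : 0 < M) (hh : ∀ f, Admissible Q f → totalMass f = ENNReal.ofReal M → h ≤ energy Q f)
    {g : Phase → ℝ} (hg : Admissible Q g) (hgM : totalMass g = ENNReal.ofReal M) {s : Set E3}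
    (hs : MeasurableSet s) {x : ℝ} (hx : x = (∫⁻ y in s, spatialDensity g y).toReal / M) :
    (x ^ (5 / 3 : ℝ) + (1 - x) ^ (5 / 3 : ℝ)) * h -
      2 * couplingConst * (coulombEnergy (s.indicator (spatialDensity g))
        (sᶜ.indicator (spatialDensity g))).toReal ≤ energy Q g := by
  have hle : ∫⁻ y in s, spatialDensity g y ≤ ENNReal.ofReal M := by
    rw [← hgM, ← lintegral_spatialDensity hg.measurable]
    exact setLIntegral_le_lintegral _ _
  have hne := (hle.trans_lt ENNReal.ofReal_lt_top).ne
  have hx0 : 0 ≤ x := by rw [hx]; positivity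
  have hx1 : x ≤ 1 := by
    rw [hx, div_le_one hM]
    exact ENNReal.toReal_le_of_le_ofReal hM.le hle
  have hin : totalMass (VlasovPoisson.cut s g) = ENNReal.ofReal (x * M) := by
    rw [totalMass_cut hs hg.measurable, hx, div_mul_cancel₀ _ hM.ne', ENNReal.ofReal_toReal hne]
  have hout : totalMass (VlasovPoisson.cut sᶜ g) = ENNReal.ofReal ((1 - x) * M) := by
    have h1 := totalMass_cut_add_compl (f := g) hs
    rw [hin, hgM] at h1
    have h2 := ENNReal.eq_sub_of_add_eq ENNReal.ofReal_ne_top ((add_comm _ _).trans h1)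
    rw [h2, ← ENNReal.ofReal_sub _ (by positivity)]
    ring_nf
  have e1 := rpow_mul_le_energy hQ hh (hg.cut hQ hs) hx0 hx1 hin
  have e2 := rpow_mul_le_energy hQ hh (hg.cut hQ hs.compl) (sub_nonneg.2 hx1) (by linarith) hout
  rw [hg.energy_eq_cut hQ hs]
  linarith

theorem exists_forall_fourThirds_le (hQ : CasimirAssumptions Q C₁ C₂ F₀ k₁ k₂ k₃) {m P : ℝ≥0∞}
    (hm : m < ⊤) (hP : P < ⊤) : ∃ A : ℝ≥0∞, A < ⊤ ∧ ∀ g, Admissible Q g → totalMass g ≤ m →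
      positivePart Q g ≤ P → fourThirds (spatialDensity g) ≤ A := by
  obtain ⟨K, -, hK⟩ := hQ.exists_fourThirds_le one_pos
  refine ⟨ENNReal.ofReal 1 * P + ENNReal.ofReal K * m, ENNReal.add_lt_top.2
    ⟨ENNReal.mul_lt_top ENNReal.ofReal_lt_top hP, ENNReal.mul_lt_top ENNReal.ofReal_lt_top hm⟩,
    fun g hg hgm hgP => (hK g hg.measurable hg.nonneg).trans ?_⟩
  gcongr

theorem exists_forall_positivePart_le (hQ : CasimirAssumptions Q C₁ C₂ F₀ k₁ k₂ k₃) (hM : 0 < M)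
    (hf : ∀ n, Admissible Q (f n)) (hfM : ∀ n, totalMass (f n) = ENNReal.ofReal M)
    (hlim : Tendsto (fun n => energy Q (f n)) atTop (𝓝 h)) :
    ∃ P : ℝ≥0∞, P < ⊤ ∧ ∀ n, positivePart Q (f n) ≤ P := by
  obtain ⟨K, -, hK⟩ := Admissible.exists_le_energy hQ hM
  obtain ⟨B, hB⟩ := hlim.bddAbove_range
  refine ⟨ENNReal.ofReal (2 * (B + K)), ENNReal.ofReal_lt_top, fun n => ?_⟩
  have h1 := hK (f n) (hf n) (hfM n).le
  have h2 : energy Q (f n) ≤ B := hB ⟨n, rfl⟩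
  rw [← ENNReal.ofReal_toReal (hf n).positivePart_lt_top.ne]
  exact ENNReal.ofReal_le_ofReal (by linarith)

/-- A sequence of densities of mass `M` whose energies tend to `h`, together with a vague limit. -/
structure VagueLimit (Q : ℝ → ℝ) (M h : ℝ) (f : ℕ → Phase → ℝ) (f₀ : Phase → ℝ) : Prop where
  mass_pos : 0 < M
  admissible : ∀ n, Admissible Q (f n)
  totalMass_eq : ∀ n, totalMass (f n) = ENNReal.ofReal M
  tendsto_energy : Tendsto (fun n => energy Q (f n)) atTop (𝓝 h)
  measurable : Measurable f₀
  nonneg : ∀ z, 0 ≤ f₀ z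
  vagueTendsto : VagueTendsto (fun n z => ENNReal.ofReal (f n z)) fun z => ENNReal.ofReal (f₀ z)

namespace VagueLimit

theorem totalMass_le (H : VagueLimit Q M h f f₀) : totalMass f₀ ≤ ENNReal.ofReal M :=
  totalMass_le_of_vagueTendsto H.measurable H.vagueTendsto fun n => (H.totalMass_eq n).le

theorem limit_admissible (hQ : CasimirAssumptions Q C₁ C₂ F₀ k₁ k₂ k₃)
    (H : VagueLimit Q M h f f₀) : Admissible Q f₀ := by
  obtain ⟨P, hP, hfP⟩ := exists_forall_positivePart_le hQ H.mass_pos H.admissible H.totalMass_eq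
    H.tendsto_energy
  exact ⟨H.measurable, H.nonneg, H.totalMass_le.trans_lt ENNReal.ofReal_lt_top,
    (positivePart_le_of_vagueTendsto hQ (fun n => (H.admissible n).measurable)
      (fun n => (H.admissible n).nonneg) H.measurable H.nonneg H.vagueTendsto
      (.of_forall hfP)).trans_lt hP⟩

theorem exists_bounds (hQ : CasimirAssumptions Q C₁ C₂ F₀ k₁ k₂ k₃) (H : VagueLimit Q M h f f₀) :
    ∃ A : ℝ≥0∞, A < ⊤ ∧ (∀ n, fourThirds (spatialDensity (f n)) ≤ A) ∧
      fourThirds (spatialDensity f₀) ≤ A := by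
  obtain ⟨P, hP, hfP⟩ := exists_forall_positivePart_le hQ H.mass_pos H.admissible H.totalMass_eq
    H.tendsto_energy
  obtain ⟨A, hA, h1⟩ := exists_forall_fourThirds_le hQ
    (ENNReal.ofReal_lt_top (r := M)) (max_lt hP (H.limit_admissible hQ).positivePart_lt_top)
  exact ⟨A, hA, fun n => h1 _ (H.admissible n) (H.totalMass_eq n).le
    ((hfP n).trans (le_max_left _ _)), h1 _ (H.limit_admissible hQ) H.totalMass_le
    (le_max_right _ _)⟩

theorem vagueTendsto_spatialDensity (hQ : CasimirAssumptions Q C₁ C₂ F₀ k₁ k₂ k₃)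
    (H : VagueLimit Q M h f f₀) :
    VagueTendsto (fun n => spatialDensity (f n)) (spatialDensity f₀) := by
  obtain ⟨P, hP, hfP⟩ := exists_forall_positivePart_le hQ H.mass_pos H.admissible H.totalMass_eq
    H.tendsto_energy
  exact VlasovPoisson.vagueTendsto_spatialDensity (fun n => (H.admissible n).measurable)
    (fun n => (H.admissible n).nonneg) H.measurable H.nonneg H.vagueTendsto
    (max_lt hP (H.limit_admissible hQ).positivePart_lt_top)
    (fun n => le_add_self.trans ((hfP n).trans (le_max_left _ _)))
    (le_add_self.trans (le_max_right _ _))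

theorem lintegral_spatialDensity_le (H : VagueLimit Q M h f f₀) (n : ℕ) :
    ∫⁻ x, spatialDensity (f n) x ≤ ENNReal.ofReal M := by
  rw [lintegral_spatialDensity (H.admissible n).measurable, H.totalMass_eq]

theorem lintegral_spatialDensity_limit_le (H : VagueLimit Q M h f f₀) :
    ∫⁻ x, spatialDensity f₀ x ≤ ENNReal.ofReal M := by
  rw [lintegral_spatialDensity H.measurable]; exact H.totalMass_le

/-- Cut f_n at a fixed ball and let n → ∞. The cross term converges because one factor is supported
in the ball. The mass outside is M minus the mass inside, so it converges even if part of it escapes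
to infinity. -/
theorem rpow_add_rpow_mul_sub_le (hQ : CasimirAssumptions Q C₁ C₂ F₀ k₁ k₂ k₃)
    (H : VagueLimit Q M h f f₀)
    (hh : ∀ f, Admissible Q f → totalMass f = ENNReal.ofReal M → h ≤ energy Q f) (R : ℕ) {x : ℝ}
    (hx : x = (∫⁻ y in Metric.ball 0 (R : ℝ), spatialDensity f₀ y).toReal / M) :
    (x ^ (5 / 3 : ℝ) + (1 - x) ^ (5 / 3 : ℝ)) * h -
      2 * couplingConst * (coulombEnergy ((Metric.ball 0 (R : ℝ)).indicator (spatialDensity f₀))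
        ((Metric.ball 0 (R : ℝ))ᶜ.indicator (spatialDensity f₀))).toReal ≤ h := by
  obtain ⟨A, hA, hfA, hf₀A⟩ := H.exists_bounds hQ
  have hv := H.vagueTendsto_spatialDensity hQ
  have hρ := fun n => measurable_spatialDensity (H.admissible n).measurable
  have hρ₀ := measurable_spatialDensity H.measurable
  have hM := ENNReal.ofReal_lt_top (r := M)
  have hle : ∀ (t : Set E3) (τ : E3 → ℝ≥0∞), t.indicator τ ≤ τ := fun t τ => indicator_le_self _ _
  set s : Set E3 := Metric.ball 0 (R : ℝ)
  have hs : MeasurableSet s := Metric.isOpen_ball.measurableSet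
  have h0 := (H.limit_admissible hQ).selfEnergy_lt_top hQ
  have hD : Tendsto (fun n => (coulombEnergy (s.indicator (spatialDensity (f n)))
      (sᶜ.indicator (spatialDensity (f n)))).toReal) atTop (𝓝 (coulombEnergy
        (s.indicator (spatialDensity f₀)) (sᶜ.indicator (spatialDensity f₀))).toReal) := by
    refine (ENNReal.tendsto_toReal
      ((coulombEnergy_mono (hle _ _) (hle _ _)).trans_lt h0).ne).comp ?_
    exact tendsto_coulombEnergy (r := R) (hv.indicator hs) (hv.indicator hs.compl)
      (fun n => (hρ n).indicator hs) (fun n => (hρ n).indicator hs.compl) (hρ₀.indicator hs)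
      (hρ₀.indicator hs.compl) hM hA
      (fun n => (lintegral_mono (hle _ _)).trans (H.lintegral_spatialDensity_le n))
      (fun n => (lintegral_mono (hle _ _)).trans (H.lintegral_spatialDensity_le n))
      ((lintegral_mono (hle _ _)).trans H.lintegral_spatialDensity_limit_le)
      ((lintegral_mono (hle _ _)).trans H.lintegral_spatialDensity_limit_le)
      (fun n => (fourThirds_mono (hle _ _)).trans (hfA n))
      (fun n => (fourThirds_mono (hle _ _)).trans (hfA n))
      ((fourThirds_mono (hle _ _)).trans hf₀A) ((fourThirds_mono (hle _ _)).trans hf₀A)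
      (fun n x hx => indicator_of_notMem (by simpa [s] using hx) _)
      (fun x hx => indicator_of_notMem (by simpa [s] using hx) _)
  have hm : Tendsto (fun n => (∫⁻ y in s, spatialDensity (f n) y).toReal / M) atTop (𝓝 x) := by
    rw [hx]
    refine ((ENNReal.tendsto_toReal ?_).comp (hv.tendsto_setLIntegral R)).div_const M
    exact ((setLIntegral_le_lintegral _ _).trans_lt
      (H.lintegral_spatialDensity_limit_le.trans_lt hM)).ne
  have hlim := (((hm.rpow_const (p := 5 / 3) (Or.inr (by norm_num))).add
    ((tendsto_const_nhds (x := (1 : ℝ))).sub hm |>.rpow_const (p := 5 / 3)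
      (Or.inr (by norm_num)))).mul_const h).sub (hD.const_mul (2 * couplingConst))
  exact le_of_tendsto_of_tendsto' hlim H.tendsto_energy fun n =>
    (H.admissible n).rpow_add_rpow_mul_sub_le_energy hQ H.mass_pos hh (H.totalMass_eq n) hs rfl

/-- As R → ∞ the mass of f₀ outside the ball vanishes, and the cross term with it. What remains is
(x₀^(5/3) + (1 - x₀)^(5/3)) h ≤ h for the mass fraction x₀ > 0 of f₀, which is impossible for x₀ < 1
because h < 0. -/
theorem totalMass_limit_eq (hQ : CasimirAssumptions Q C₁ C₂ F₀ k₁ k₂ k₃)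
    (H : VagueLimit Q M h f f₀) (hneg : h < 0)
    (hh : ∀ f, Admissible Q f → totalMass f = ENNReal.ofReal M → h ≤ energy Q f)
    (hpos : 0 < totalMass f₀) : totalMass f₀ = ENNReal.ofReal M := by
  obtain ⟨A, hA, hfA, hf₀A⟩ := H.exists_bounds hQ
  have hρ₀ := measurable_spatialDensity H.measurable
  have hM := ENNReal.ofReal_lt_top (r := M)
  have hM0 := H.mass_pos
  have hm₀ := H.lintegral_spatialDensity_limit_le
  have hle : ∀ (t : Set E3) (τ : E3 → ℝ≥0∞), t.indicator τ ≤ τ := fun t τ => indicator_le_self _ _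
  set x₀ := (∫⁻ y, spatialDensity f₀ y).toReal / M with hx₀
  have hx : Tendsto (fun R : ℕ => (∫⁻ y in Metric.ball 0 (R : ℝ), spatialDensity f₀ y).toReal / M)
      atTop (𝓝 x₀) :=
    ((ENNReal.tendsto_toReal (hm₀.trans_lt hM).ne).comp
      (tendsto_setLIntegral_ball hρ₀ (hm₀.trans_lt hM))).div_const M
  have hD : Tendsto (fun R : ℕ => coulombEnergy
      ((Metric.ball 0 (R : ℝ)).indicator (spatialDensity f₀))
      ((Metric.ball 0 (R : ℝ))ᶜ.indicator (spatialDensity f₀))) atTop (𝓝 0) := by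
    rw [ENNReal.tendsto_nhds_zero]
    intro ε hε
    obtain ⟨δ, hδ, hsmall⟩ := exists_coulombEnergy_le_of_lintegral_le hM hA hε
    filter_upwards [(tendsto_setLIntegral_compl_ball hρ₀ (hm₀.trans_lt hM)).eventually
      (gt_mem_nhds hδ)] with R hR
    have hs : MeasurableSet (Metric.ball (0 : E3) (R : ℝ)) := Metric.isOpen_ball.measurableSet
    rw [coulombEnergy_comm (hρ₀.indicator hs) (hρ₀.indicator hs.compl)]
    refine hsmall _ _ (hρ₀.indicator hs.compl) (hρ₀.indicator hs)
      ((lintegral_mono (hle _ _)).trans hm₀) ((lintegral_mono (hle _ _)).trans hm₀)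
      ((fourThirds_mono (hle _ _)).trans hf₀A) ((fourThirds_mono (hle _ _)).trans hf₀A) ?_
    rw [lintegral_indicator hs.compl]
    exact hR.le
  have hlim := (((hx.rpow_const (p := 5 / 3) (Or.inr (by norm_num))).add
    ((tendsto_const_nhds (x := (1 : ℝ))).sub hx |>.rpow_const (p := 5 / 3)
      (Or.inr (by norm_num)))).mul_const h).sub
    (((ENNReal.tendsto_toReal ENNReal.zero_ne_top).comp hD).const_mul (2 * couplingConst))
  have key := le_of_tendsto' hlim fun R => H.rpow_add_rpow_mul_sub_le hQ hh R rfl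
  rw [ENNReal.toReal_zero, mul_zero, sub_zero] at key
  rw [lintegral_spatialDensity H.measurable] at hx₀ hm₀
  have hx0 : 0 < x₀ := by
    rw [hx₀]
    exact div_pos (ENNReal.toReal_pos hpos.ne' (hm₀.trans_lt hM).ne) hM0
  have hx1 : 1 ≤ x₀ := by
    by_contra! hlt
    nlinarith [rpow_five_thirds_add_lt_one hx0 hlt]
  refine le_antisymm H.totalMass_le ?_
  rw [hx₀, le_div_iff₀ hM0, one_mul] at hx1
  exact ENNReal.ofReal_le_of_le_toReal hx1

/-- The two alternatives for σ are the two terms that vary with n when the squared distance of the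
fields is expanded. -/
theorem tendsto_coulombEnergy_limit (hQ : CasimirAssumptions Q C₁ C₂ F₀ k₁ k₂ k₃)
    (H : VagueLimit Q M h f f₀) (hm : totalMass f₀ = ENNReal.ofReal M) {σ : ℕ → Phase → ℝ}
    (hσ : (∀ n, σ n = f n) ∨ ∀ n, σ n = f₀) :
    Tendsto (fun n => coulombEnergy (spatialDensity (f n)) (spatialDensity (σ n))) atTop
      (𝓝 (selfEnergy f₀)) := by
  obtain ⟨A, hA, hfA, hf₀A⟩ := H.exists_bounds hQ
  have hv := H.vagueTendsto_spatialDensity hQ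
  have hρ := fun n => measurable_spatialDensity (H.admissible n).measurable
  have hρ₀ := measurable_spatialDensity H.measurable
  have hmass : Tendsto (fun n => ∫⁻ x, spatialDensity (f n) x) atTop
      (𝓝 (∫⁻ x, spatialDensity f₀ x)) := by
    rw [lintegral_spatialDensity H.measurable, hm]
    simp_rw [fun n => lintegral_spatialDensity (H.admissible n).measurable, H.totalMass_eq]
    exact tendsto_const_nhds
  rcases hσ with hσ | hσ <;> simp_rw [hσ]
  · exact tendsto_coulombEnergy_of_tendsto_lintegral hv hv hρ hρ hρ₀ hρ₀ ENNReal.ofReal_lt_top hA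
      H.lintegral_spatialDensity_le H.lintegral_spatialDensity_le
      H.lintegral_spatialDensity_limit_le H.lintegral_spatialDensity_limit_le hfA hfA hf₀A hf₀A hmass
  · exact tendsto_coulombEnergy_of_tendsto_lintegral hv
      (fun ψ C R _ _ _ _ => tendsto_const_nhds) hρ (fun _ => hρ₀) hρ₀ hρ₀ ENNReal.ofReal_lt_top hA
      H.lintegral_spatialDensity_le (fun _ => H.lintegral_spatialDensity_limit_le)
      H.lintegral_spatialDensity_limit_le H.lintegral_spatialDensity_limit_le hfA (fun _ => hf₀A)
      hf₀A hf₀A hmass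

/-- Energies and self-energies converge, hence so does P(f_n); lower semicontinuity compares its
limit with P(f₀). -/
theorem energy_limit_le (hQ : CasimirAssumptions Q C₁ C₂ F₀ k₁ k₂ k₃)
    (H : VagueLimit Q M h f f₀) (hm : totalMass f₀ = ENNReal.ofReal M) : energy Q f₀ ≤ h := by
  have hD := (ENNReal.tendsto_toReal ((H.limit_admissible hQ).selfEnergy_lt_top hQ).ne).comp
    (H.tendsto_coulombEnergy_limit hQ hm (σ := f) (Or.inl fun _ => rfl))
  have hP := H.tendsto_energy.add (hD.const_mul couplingConst)
  have hP' : Tendsto (fun n => (positivePart Q (f n)).toReal) atTop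
      (𝓝 (h + couplingConst * (selfEnergy f₀).toReal)) := by
    refine hP.congr fun n => ?_
    simp [energy, selfEnergy]
  rw [energy, sub_le_iff_le_add]
  have hp0 := ge_of_tendsto' hP' fun n => ENNReal.toReal_nonneg
  refine le_of_forall_pos_le_add fun ε hε => ?_
  refine ENNReal.toReal_le_of_le_ofReal (by positivity) ?_
  refine positivePart_le_of_vagueTendsto hQ (fun n => (H.admissible n).measurable)
    (fun n => (H.admissible n).nonneg) H.measurable H.nonneg H.vagueTendsto ?_
  filter_upwards [hP'.eventually (gt_mem_nhds (lt_add_of_pos_right _ hε))] with n hn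
  rw [← ENNReal.ofReal_toReal (H.admissible n).positivePart_lt_top.ne]
  exact ENNReal.ofReal_le_ofReal hn.le

theorem stronglyConvergesInL2 (hQ : CasimirAssumptions Q C₁ C₂ F₀ k₁ k₂ k₃)
    (H : VagueLimit Q M h f f₀) (hm : totalMass f₀ = ENNReal.ofReal M) :
    StronglyConvergesInL2 (fun n => gradPotential (f n)) (gradPotential f₀) := by
  have hf := H.admissible
  have hf₀ := H.limit_admissible hQ
  have hG := fun n => (hf n).memLp_gradPotential hQ
  have hG₀ := hf₀.memLp_gradPotential hQ
  refine ⟨hG, hG₀, ?_⟩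
  have h0 := hf₀.selfEnergy_lt_top hQ
  have hnn := H.tendsto_coulombEnergy_limit hQ hm (σ := f) (Or.inl fun _ => rfl)
  have hn0 := H.tendsto_coulombEnergy_limit hQ hm (σ := fun _ => f₀) (Or.inr fun _ => rfl)
  -- Finiteness of the mixed energy is read off from its finite limit, so it is available for large
  -- n only.
  have hfin := hn0.eventually (gt_mem_nhds h0)
  have hlim : Tendsto (fun n => ENNReal.ofReal (fieldConst * ((selfEnergy (f n)).toReal -
      2 * (coulombEnergy (spatialDensity (f n)) (spatialDensity f₀)).toReal +
      (selfEnergy f₀).toReal)) ^ (1 / 2 : ℝ)) atTop (𝓝 0) := by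
    have h1 := ((((ENNReal.tendsto_toReal h0.ne).comp hnn).sub
      (((ENNReal.tendsto_toReal h0.ne).comp hn0).const_mul 2)).add_const
        (selfEnergy f₀).toReal).const_mul fieldConst
    have h2 := (ENNReal.tendsto_ofReal h1).ennrpow_const (1 / 2)
    have h3 : fieldConst * ((selfEnergy f₀).toReal - 2 * (selfEnergy f₀).toReal +
        (selfEnergy f₀).toReal) = 0 := by ring
    rw [h3, ENNReal.ofReal_zero, ENNReal.zero_rpow_of_pos (by norm_num)] at h2
    exact h2
  refine hlim.congr' ?_
  filter_upwards [hfin] with n hn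
  have hi1 : Integrable fun x => inner ℝ (gradPotential (f n) x) (gradPotential (f n) x) :=
    integrable_inner_of_memLp (hG n) (hG n)
  have hi2 : Integrable fun x => inner ℝ (gradPotential (f n) x) (gradPotential f₀ x) :=
    integrable_inner_of_memLp (hG n) hG₀
  have hi3 : Integrable fun x => inner ℝ (gradPotential f₀ x) (gradPotential f₀ x) :=
    integrable_inner_of_memLp hG₀ hG₀
  -- All three self and mixed energies tend to D(ρ₀, ρ₀), with coefficients 1 - 2 + 1 = 0.
  have hsq : ∫ x, ‖(gradPotential (f n) - gradPotential f₀) x‖ ^ 2 =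
      fieldConst * ((selfEnergy (f n)).toReal -
      2 * (coulombEnergy (spatialDensity (f n)) (spatialDensity f₀)).toReal +
      (selfEnergy f₀).toReal) := by
    have e : ∀ x, ‖(gradPotential (f n) - gradPotential f₀) x‖ ^ 2 =
        inner ℝ (gradPotential (f n) x) (gradPotential (f n) x) -
        2 * inner ℝ (gradPotential (f n) x) (gradPotential f₀ x) +
        inner ℝ (gradPotential f₀ x) (gradPotential f₀ x) := fun x => by
      rw [Pi.sub_apply, norm_sub_sq_real, real_inner_self_eq_norm_sq, real_inner_self_eq_norm_sq]
    simp_rw [e]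
    rw [integral_add (f := fun x => inner ℝ (gradPotential (f n) x) (gradPotential (f n) x) -
        2 * inner ℝ (gradPotential (f n) x) (gradPotential f₀ x)) (hi1.sub (hi2.const_mul 2)) hi3,
      integral_sub hi1 (hi2.const_mul 2),
      integral_const_mul, (hf n).integral_inner_gradPotential (hf n) ((hf n).selfEnergy_lt_top hQ),
      (hf n).integral_inner_gradPotential hf₀ hn, hf₀.integral_inner_gradPotential hf₀ h0,
      selfEnergy, selfEnergy]
    ring
  rw [← hsq, eLpNorm_eq_lintegral_rpow_enorm_toReal two_ne_zero ENNReal.ofNat_ne_top,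
    ENNReal.toReal_ofNat, ofReal_integral_eq_lintegral_ofReal
      ((memLp_two_iff_integrable_sq_norm ((hG n).sub hG₀).1).1 ((hG n).sub hG₀))
      (.of_forall fun x => by positivity)]
  congr 1
  refine lintegral_congr fun x => ?_
  rw [ENNReal.ofReal_pow (norm_nonneg _), ofReal_norm, ENNReal.rpow_ofNat]

end VagueLimit

/-! ### Weak convergence in L^(1+1/k₁). -/

/-- Cut ψ to where it is at most R inside the ball of radius R. What is cut off tends to zero in
L^q, and Hölder with the uniform L^p bound makes the error uniform in n. -/
theorem VagueTendsto.tendsto_lintegral_mul_of_rpow_le {α : Type*} [NormedAddCommGroup α]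
    [MeasureSpace α] [OpensMeasurableSpace α] {p q : ℝ} (hpq : p.HolderConjugate q)
    {ρ : ℕ → α → ℝ≥0∞} {ρ₀ : α → ℝ≥0∞} (h : VagueTendsto ρ ρ₀) (hρ : ∀ n, Measurable (ρ n))
    (hρ₀ : Measurable ρ₀) {B : ℝ≥0∞} (hB : B < ⊤) (hρB : ∀ n, ∫⁻ x, ρ n x ^ p ≤ B)
    (hρ₀B : ∫⁻ x, ρ₀ x ^ p ≤ B) {ψ : α → ℝ≥0∞} (hψ : Measurable ψ) (hψt : ∀ x, ψ x ≠ ⊤)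
    (hψq : ∫⁻ x, ψ x ^ q < ⊤) :
    Tendsto (fun n => ∫⁻ x, ρ n x * ψ x) atTop (𝓝 (∫⁻ x, ρ₀ x * ψ x)) := by
  have hp := hpq.pos
  have hq := hpq.symm.pos
  set S : ℕ → Set α := fun R => Metric.ball 0 (R : ℝ) ∩ {x | ψ x ≤ R}
  have hS : ∀ R, MeasurableSet (S R) := fun R =>
    Metric.isOpen_ball.measurableSet.inter (measurableSet_le hψ measurable_const)
  have hmem : ∀ x, ∀ᶠ R in atTop, x ∈ S R := fun x => by
    obtain ⟨N, hN⟩ := ENNReal.exists_nat_gt (hψt x)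
    filter_upwards [eventually_mem_ball x, eventually_ge_atTop N] with R h1 h2
    exact ⟨h1, hN.le.trans (by exact_mod_cast h2)⟩
  have htail : Tendsto (fun R => B ^ (1 / p) * (∫⁻ x, (S R)ᶜ.indicator ψ x ^ q) ^ (1 / q)) atTop
      (𝓝 0) := by
    have h1 : Tendsto (fun R => ∫⁻ x, (S R)ᶜ.indicator ψ x ^ q) atTop (𝓝 0) := by
      have h0 : (0 : ℝ≥0∞) = ∫⁻ x : α, 0 := by simp
      rw [h0]
      refine tendsto_lintegral_of_dominated_convergence (fun x => ψ x ^ q)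
        (fun R => (hψ.indicator (hS R).compl).pow_const q)
        (fun R => .of_forall fun x => ENNReal.rpow_le_rpow (indicator_le_self _ _ x) hq.le)
        hψq.ne (.of_forall fun x => ?_)
      refine tendsto_const_nhds.congr' ?_
      filter_upwards [hmem x] with R hR
      rw [indicator_of_notMem (notMem_compl_iff.2 hR), ENNReal.zero_rpow_of_pos hq]
    have h2 := ENNReal.Tendsto.const_mul (a := B ^ (1 / p)) (h1.ennrpow_const (1 / q))
      (Or.inr (ENNReal.rpow_lt_top_of_nonneg (by positivity) hB.ne).ne)
    rwa [ENNReal.zero_rpow_of_pos (by positivity), mul_zero] at h2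
  refine tendsto_of_approx fun ε hε => ?_
  obtain ⟨R, hR⟩ := (htail.eventually (gt_mem_nhds hε)).exists
  have happ : ∀ τ : α → ℝ≥0∞, Measurable τ → ∫⁻ x, τ x ^ p ≤ B →
      ∫⁻ x, τ x * (S R).indicator ψ x ≤ ∫⁻ x, τ x * ψ x ∧
      ∫⁻ x, τ x * ψ x ≤ (∫⁻ x, τ x * (S R).indicator ψ x) + ε := fun τ hτ hτB => by
    refine ⟨lintegral_mono fun x => by gcongr; exact indicator_le_self _ _ x, ?_⟩
    have hsplit : ∫⁻ x, τ x * ψ x = (∫⁻ x, τ x * (S R).indicator ψ x) +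
        ∫⁻ x, τ x * (S R)ᶜ.indicator ψ x := by
      rw [← lintegral_add_left (f := fun x => τ x * (S R).indicator ψ x)
        (hτ.mul (hψ.indicator (hS R)))]
      refine lintegral_congr fun x => ?_
      rw [← mul_add]
      congr 1
      exact (congrFun (indicator_self_add_compl (S R) ψ) x).symm
    rw [hsplit]
    gcongr
    calc ∫⁻ x, τ x * (S R)ᶜ.indicator ψ x
        ≤ (∫⁻ x, τ x ^ p) ^ (1 / p) * (∫⁻ x, (S R)ᶜ.indicator ψ x ^ q) ^ (1 / q) :=
          ENNReal.lintegral_mul_le_Lp_mul_Lq volume hpq hτ.aemeasurable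
            (hψ.indicator (hS R).compl).aemeasurable
      _ ≤ B ^ (1 / p) * (∫⁻ x, (S R)ᶜ.indicator ψ x ^ q) ^ (1 / q) := by gcongr
      _ ≤ ε := hR.le
  refine ⟨fun n => ∫⁻ x, ρ n x * (S R).indicator ψ x, ∫⁻ x, ρ₀ x * (S R).indicator ψ x, ?_,
    fun n => happ _ (hρ n) (hρB n), happ _ hρ₀ hρ₀B⟩
  refine h _ R R (hψ.indicator (hS R)) (ENNReal.natCast_lt_top R) (fun x => ?_) fun x hx => ?_
  · by_cases hx : x ∈ S R
    · rw [indicator_of_mem hx]; exact hx.2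
    · rw [indicator_of_notMem hx]; exact zero_le
  · exact indicator_of_notMem (fun hxS => absurd (mem_ball_zero_iff.1 hxS.1) (not_lt.2 hx)) _

variable {Q : ℝ → ℝ} {C₁ C₂ F₀ k₁ k₂ k₃ : ℝ} {f : ℕ → Phase → ℝ} {f₀ : Phase → ℝ} {M h : ℝ}

theorem CasimirAssumptions.rpow_le (hQ : CasimirAssumptions Q C₁ C₂ F₀ k₁ k₂ k₃) {s : ℝ}
    (hs : 0 ≤ s) : s ^ (1 + 1 / k₁) ≤ C₁⁻¹ * Q s + F₀ ^ (1 / k₁) * s := by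
  have hk := hQ.k₁_pos
  have hC := hQ.C₁_pos
  have hF := hQ.F₀_pos
  have h0 := hQ.nonneg s hs
  rcases le_total F₀ s with h | h
  · have h1 := hQ.growth_large s h
    have h2 : s ^ (1 + 1 / k₁) ≤ C₁⁻¹ * Q s := by
      rw [inv_mul_eq_div, le_div_iff₀ hC, mul_comm]; exact h1
    have h3 : 0 ≤ F₀ ^ (1 / k₁) * s := by positivity
    linarith
  · have h1 : s ^ (1 + 1 / k₁) = s ^ (1 / k₁) * s := by
      rw [add_comm, Real.rpow_add_one' hs (by positivity)]
    have h2 : s ^ (1 / k₁) * s ≤ F₀ ^ (1 / k₁) * s := by gcongr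
    have h3 : 0 ≤ C₁⁻¹ * Q s := by positivity
    linarith

theorem Admissible.lintegral_rpow_le (hQ : CasimirAssumptions Q C₁ C₂ F₀ k₁ k₂ k₃)
    {g : Phase → ℝ} (hg : Admissible Q g) : ∫⁻ z, ENNReal.ofReal (g z) ^ (1 + 1 / k₁) ≤
      ENNReal.ofReal C₁⁻¹ * positivePart Q g + ENNReal.ofReal (F₀ ^ (1 / k₁)) * totalMass g := by
  have hk := hQ.k₁_pos
  have hC := hQ.C₁_pos
  have hF := hQ.F₀_pos
  calc ∫⁻ z, ENNReal.ofReal (g z) ^ (1 + 1 / k₁)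
      ≤ ∫⁻ z, (ENNReal.ofReal C₁⁻¹ * ENNReal.ofReal (Q (g z)) +
          ENNReal.ofReal (F₀ ^ (1 / k₁)) * ENNReal.ofReal (g z)) := by
        refine lintegral_mono fun z => ?_
        have h1 := hQ.nonneg _ (hg.nonneg z)
        have h2 := hg.nonneg z
        rw [ENNReal.ofReal_rpow_of_nonneg h2 (by positivity), ← ENNReal.ofReal_mul (by positivity),
          ← ENNReal.ofReal_mul (by positivity), ← ENNReal.ofReal_add (by positivity) (by positivity)]
        exact ENNReal.ofReal_le_ofReal (hQ.rpow_le h2)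
    _ = ENNReal.ofReal C₁⁻¹ * casimir Q g + ENNReal.ofReal (F₀ ^ (1 / k₁)) * totalMass g := by
        have hm := hg.measurable
        rw [lintegral_add_right _ (by fun_prop), lintegral_const_mul' _ _ ENNReal.ofReal_ne_top,
          lintegral_const_mul' _ _ ENNReal.ofReal_ne_top, casimir, totalMass]
    _ ≤ _ := by
        gcongr
        exact le_self_add

theorem Admissible.memLp (hQ : CasimirAssumptions Q C₁ C₂ F₀ k₁ k₂ k₃)
    {g : Phase → ℝ} (hg : Admissible Q g) : MemLp g (ENNReal.ofReal (1 + 1 / k₁)) := by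
  have hk := hQ.k₁_pos
  have hp : 0 < 1 + 1 / k₁ := by positivity
  refine ⟨hg.measurable.aestronglyMeasurable, ?_⟩
  rw [eLpNorm_eq_lintegral_rpow_enorm_toReal (by simpa using hp) ENNReal.ofReal_ne_top,
    ENNReal.toReal_ofReal hp.le]
  refine ENNReal.rpow_lt_top_of_nonneg (by positivity) (ne_of_lt ?_)
  simp_rw [fun z => Real.enorm_of_nonneg (hg.nonneg z)]
  exact (hg.lintegral_rpow_le hQ).trans_lt (ENNReal.add_lt_top.2
    ⟨ENNReal.mul_lt_top ENNReal.ofReal_lt_top hg.positivePart_lt_top,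
      ENNReal.mul_lt_top ENNReal.ofReal_lt_top hg.totalMass_lt_top⟩)

theorem conjExponent_ofReal_one_add {k : ℝ} (hk : 0 < k) :
    (ENNReal.ofReal (1 + 1 / k)).conjExponent = ENNReal.ofReal (1 + k) := by
  rw [ENNReal.conjExponent, ENNReal.ofReal_add zero_le_one (by positivity), ENNReal.ofReal_one,
    ENNReal.add_sub_cancel_left ENNReal.one_ne_top, ENNReal.ofReal_add zero_le_one hk.le,
    ENNReal.ofReal_one, ← ENNReal.ofReal_inv_of_pos (by positivity), one_div, inv_inv]

theorem holderConjugate_one_add {k : ℝ} (hk : 0 < k) : (1 + 1 / k).HolderConjugate (1 + k) := by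
  rw [Real.holderConjugate_iff]
  refine ⟨lt_add_of_pos_right _ (by positivity), ?_⟩
  field_simp
  ring

theorem integral_mul_eq_sub_lintegral {g φ : Phase → ℝ} (hg : ∀ z, 0 ≤ g z)
    (h : Integrable fun z => g z * φ z) : ∫ z, g z * φ z =
      (∫⁻ z, ENNReal.ofReal (g z) * ENNReal.ofReal (φ z)).toReal -
      (∫⁻ z, ENNReal.ofReal (g z) * ENNReal.ofReal (-φ z)).toReal := by
  rw [integral_eq_lintegral_pos_part_sub_lintegral_neg_part h]
  simp_rw [← mul_neg, fun z => ENNReal.ofReal_mul (q := φ z) (hg z),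
    fun z => ENNReal.ofReal_mul (q := -φ z) (hg z)]

/-- Vague convergence only knows nonnegative test functions, so positive and negative parts of the
dual function are treated separately. -/
theorem VagueLimit.weaklyConvergesInLp (hQ : CasimirAssumptions Q C₁ C₂ F₀ k₁ k₂ k₃)
    (H : VagueLimit Q M h f f₀) : WeaklyConvergesInLp (ENNReal.ofReal (1 + 1 / k₁)) f f₀ := by
  have hk := hQ.k₁_pos
  have hf₀ := H.limit_admissible hQ
  refine ⟨fun n => (H.admissible n).memLp hQ, hf₀.memLp hQ, fun φ hφ => ?_⟩
  have hconj : (ENNReal.ofReal (1 + 1 / k₁)).HolderConjugate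
      (ENNReal.ofReal (1 + 1 / k₁)).conjExponent := .conjExponent (by
        rw [ENNReal.one_le_ofReal]; exact le_add_of_nonneg_right (by positivity))
  obtain ⟨φ', hφ'm, hφφ'⟩ := hφ.1.aemeasurable
  have hcongr : ∀ g : Phase → ℝ, ∫ z, g z * φ z = ∫ z, g z * φ' z := fun g => by
    refine integral_congr_ae ?_
    filter_upwards [hφφ'] with z hz
    rw [hz]
  simp_rw [hcongr]
  replace hφ := (memLp_congr_ae hφφ').1 hφ
  have hint : ∀ g, Admissible Q g → Integrable fun z => g z * φ' z := fun g hg =>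
    (hg.memLp hQ).integrable_mul hφ
  have hφq : ∫⁻ z, ‖φ' z‖ₑ ^ (1 + k₁) < ⊤ := by
    have h1 := hφ.2
    rw [conjExponent_ofReal_one_add hk] at h1
    have h2 := lintegral_rpow_enorm_lt_top_of_eLpNorm_lt_top
      (ENNReal.ofReal_pos.2 (by positivity)).ne' ENNReal.ofReal_ne_top h1
    rwa [ENNReal.toReal_ofReal (by positivity)] at h2
  obtain ⟨P, hP, hfP⟩ := exists_forall_positivePart_le hQ H.mass_pos H.admissible H.totalMass_eq
    H.tendsto_energy
  set B : ℝ≥0∞ := ENNReal.ofReal C₁⁻¹ * max P (positivePart Q f₀) +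
    ENNReal.ofReal (F₀ ^ (1 / k₁)) * ENNReal.ofReal M
  have hB : B < ⊤ := ENNReal.add_lt_top.2 ⟨ENNReal.mul_lt_top ENNReal.ofReal_lt_top
    (max_lt hP hf₀.positivePart_lt_top),
    ENNReal.mul_lt_top ENNReal.ofReal_lt_top ENNReal.ofReal_lt_top⟩
  have hfB : ∀ n, ∫⁻ z, ENNReal.ofReal (f n z) ^ (1 + 1 / k₁) ≤ B := fun n => by
    refine ((H.admissible n).lintegral_rpow_le hQ).trans ?_
    rw [H.totalMass_eq]
    simp only [B]
    gcongr
    exact (hfP n).trans (le_max_left _ _)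
  have hf₀B : ∫⁻ z, ENNReal.ofReal (f₀ z) ^ (1 + 1 / k₁) ≤ B := by
    refine (hf₀.lintegral_rpow_le hQ).trans ?_
    simp only [B]
    gcongr
    · exact le_max_right _ _
    · exact H.totalMass_le
  have key : ∀ ψ : Phase → ℝ, Measurable ψ → (∀ z, ‖ψ z‖ₑ = ‖φ' z‖ₑ) →
      Tendsto (fun n => (∫⁻ z, ENNReal.ofReal (f n z) * ENNReal.ofReal (ψ z)).toReal) atTop
        (𝓝 (∫⁻ z, ENNReal.ofReal (f₀ z) * ENNReal.ofReal (ψ z)).toReal) := fun ψ hψ hψφ => by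
    have hψq : ∫⁻ z, ENNReal.ofReal (ψ z) ^ (1 + k₁) < ⊤ := by
      refine (lintegral_mono fun z => ?_).trans_lt hφq
      rw [← hψφ]
      exact ENNReal.rpow_le_rpow (Real.ofReal_le_enorm _) (by positivity)
    refine (ENNReal.tendsto_toReal (ne_of_lt ?_)).comp
      (H.vagueTendsto.tendsto_lintegral_mul_of_rpow_le (holderConjugate_one_add hk)
      (fun n => (H.admissible n).measurable.ennreal_ofReal) H.measurable.ennreal_ofReal hB hfB hf₀B
      hψ.ennreal_ofReal (fun _ => ENNReal.ofReal_ne_top) hψq)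
    refine (lintegral_mono fun z => ?_).trans_lt (hint f₀ hf₀).2
    rw [enorm_mul, ← hψφ]
    gcongr <;> exact Real.ofReal_le_enorm _
  rw [integral_mul_eq_sub_lintegral H.nonneg (hint f₀ hf₀)]
  simp_rw [fun n => integral_mul_eq_sub_lintegral (H.admissible n).nonneg (hint _ (H.admissible n))]
  exact (key φ' hφ'm fun _ => rfl).sub (key (fun z => -φ' z) hφ'm.neg fun z => enorm_neg _)

/-! ### Extraction of a nonzero limit and conclusion. -/

/-- Once the energy is below h/2 < 0, P ≥ 0 forces a self-energy of at least -h/2 divided by the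
coupling constant. Nonvanishing then yields a ball with mass at least δ; centred at the origin by
the shift, it keeps this mass in the limit. -/
theorem exists_vagueLimit_shift (hQ : CasimirAssumptions Q C₁ C₂ F₀ k₁ k₂ k₃) (hM : 0 < M)
    (hneg : h < 0) (hf : ∀ n, Admissible Q (f n)) (hfM : ∀ n, totalMass (f n) = ENNReal.ofReal M)
    (hlim : Tendsto (fun n => energy Q (f n)) atTop (𝓝 h)) :
    ∃ (f₀ : Phase → ℝ) (φ : ℕ → ℕ) (a : ℕ → E3), StrictMono φ ∧
      VagueLimit Q M h (fun k => shift (a k) (f (φ k))) f₀ ∧ 0 < totalMass f₀ := by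
  have hκ := couplingConst_pos
  obtain ⟨P, hP, hfP⟩ := exists_forall_positivePart_le hQ hM hf hfM hlim
  obtain ⟨A, hA, hfA⟩ := exists_forall_fourThirds_le hQ (ENNReal.ofReal_lt_top (r := M)) hP
  have hd0 : 0 < -h / 2 / couplingConst := div_pos (by linarith) hκ
  obtain ⟨L, δ, hδ, hball⟩ := exists_ball_lintegral_ge (ENNReal.ofReal_lt_top (r := M)) hA
    (ENNReal.ofReal_pos.2 hd0) ENNReal.ofReal_lt_top
  have hex : ∀ n, ∃ a : E3, energy Q (f n) < h / 2 →
      δ ≤ ∫⁻ x in Metric.ball a L, spatialDensity (f n) x := fun n => by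
    by_cases hn : energy Q (f n) < h / 2
    · obtain ⟨a, ha⟩ := hball (spatialDensity (f n)) (measurable_spatialDensity (hf n).measurable)
        (by rw [lintegral_spatialDensity (hf n).measurable, hfM])
        (hfA _ (hf n) (hfM n).le (hfP n)) (by
          refine ENNReal.ofReal_le_of_le_toReal ?_
          rw [div_le_iff₀ hκ]
          have h0 : 0 ≤ (positivePart Q (f n)).toReal := ENNReal.toReal_nonneg
          rw [energy, selfEnergy] at hn
          linarith)
      exact ⟨a, fun _ => ha⟩
    -- A default centre; only finitely many n are affected.
    · exact ⟨0, fun h => absurd h hn⟩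
  choose a ha using hex
  obtain ⟨f₀, φ, hf₀m, hf₀0, hφ, hv⟩ := exists_subseq_vagueTendsto_of_admissible hQ
    (f := fun n => shift (a n) (f n)) (fun n => (hf n).shift (a n)) ENNReal.ofReal_lt_top hP
    (fun n => (totalMass_shift _ _).trans_le (hfM n).le)
    (fun n => (positivePart_shift _ _).trans_le (hfP n))
  have H : VagueLimit Q M h (fun k => shift (a (φ k)) (f (φ k))) f₀ :=
    { mass_pos := hM
      admissible := fun n => (hf _).shift _
      totalMass_eq := fun n => (totalMass_shift _ _).trans (hfM _)
      tendsto_energy := by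
        simp_rw [energy_shift]
        exact hlim.comp hφ.tendsto_atTop
      measurable := hf₀m
      nonneg := hf₀0
      vagueTendsto := hv }
  refine ⟨f₀, φ, fun k => a (φ k), hφ, H, hδ.trans_le ?_⟩
  rw [← lintegral_spatialDensity hf₀m]
  refine le_trans ?_ (setLIntegral_le_lintegral (Metric.ball 0 L) _)
  refine ge_of_tendsto ((H.vagueTendsto_spatialDensity hQ).tendsto_setLIntegral L) ?_
  filter_upwards [(hlim.comp hφ.tendsto_atTop).eventually (gt_mem_nhds (by linarith : h < h / 2))]
    with n hn
  rw [setLIntegral_ball_spatialDensity_shift]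
  exact ha _ hn

theorem WeaklyConvergesInLp.congr_ae {p : ℝ≥0∞} {g g' : ℕ → Phase → ℝ} {g₀ : Phase → ℝ}
    (h : WeaklyConvergesInLp p g g₀) (hg : ∀ k, g k =ᵐ[volume] g' k) :
    WeaklyConvergesInLp p g' g₀ := by
  refine ⟨fun k => (memLp_congr_ae (hg k)).1 (h.1 k), h.2.1, fun φ hφ => ?_⟩
  refine (h.2.2 φ hφ).congr fun k => integral_congr_ae ?_
  filter_upwards [hg k] with z hz
  rw [hz]

end

end VlasovPoisson

theorem mainTheorem1 (Q : ℝ → ℝ) (C₁ C₂ F₀ k₁ k₂ k₃ : ℝ)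
    (hQ : VlasovPoisson.CasimirAssumptions Q C₁ C₂ F₀ k₁ k₂ k₃)
    (M : ℝ) (hM : 0 < M)
    (f : ℕ → VlasovPoisson.Phase → ℝ)
    (hf : ∀ n, f n ∈ VlasovPoisson.constraintSet Q M)
    (hmin : Tendsto (fun n => VlasovPoisson.energyCasimir Q (f n)) atTop
      (𝓝 (VlasovPoisson.minEnergy Q M))) :
    (∀ g ∈ VlasovPoisson.constraintSet Q M, VlasovPoisson.PotentialWellDefined g) ∧
    ∃ f₀ ∈ VlasovPoisson.constraintSet Q M, ∃ n : ℕ → ℕ, StrictMono n ∧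
      ∃ a : ℕ → VlasovPoisson.E3,
        VlasovPoisson.energyCasimir Q f₀ = VlasovPoisson.minEnergy Q M ∧
        VlasovPoisson.WeaklyConvergesInLp (ENNReal.ofReal (1 + 1 / k₁))
          (fun k => VlasovPoisson.shift (a k) (f (n k))) f₀ ∧
        VlasovPoisson.StronglyConvergesInL2
          (fun k => VlasovPoisson.gradPotential (VlasovPoisson.shift (a k) (f (n k))))
          (VlasovPoisson.gradPotential f₀) := by
  refine ⟨fun g hg => ?_, ?_⟩
  · obtain ⟨g', hgg', hg', -⟩ := VlasovPoisson.exists_admissible_ae_eq hg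
    exact (hg'.potentialWellDefined hQ).congr_ae hgg'.symm
  obtain ⟨h, hh, hneg, hle⟩ := VlasovPoisson.exists_minEnergy_eq hQ hM
  -- Everywhere measurable, nonnegative representatives; each conclusion is carried back to f along
  -- almost-everywhere equality.
  choose g hfg hg hgM using fun n => VlasovPoisson.exists_admissible_ae_eq (hf n)
  have hlim : Tendsto (fun n => VlasovPoisson.energy Q (g n)) atTop (𝓝 h) := by
    rw [← EReal.tendsto_coe, ← hh]
    refine hmin.congr fun n => ?_
    rw [VlasovPoisson.energyCasimir_congr_ae (hfg n), (hg n).energyCasimir_eq hQ]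
  obtain ⟨f₀, n, a, hn, H, hpos⟩ :=
    VlasovPoisson.exists_vagueLimit_shift hQ hM hneg hg hgM hlim
  have hm := H.totalMass_limit_eq hQ hneg hle hpos
  have hf₀ := H.limit_admissible hQ
  have hae := fun k => VlasovPoisson.shift_congr_ae (hfg (n k)) (a k)
  refine ⟨f₀, hf₀.mem_constraintSet hM.le hm, n, hn, a, ?_, ?_, ?_⟩
  · rw [hf₀.energyCasimir_eq hQ, hh, le_antisymm (H.energy_limit_le hQ hm) (hle f₀ hf₀ hm)]
  · exact (H.weaklyConvergesInLp hQ).congr_ae fun k => (hae k).symm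
  · simp_rw [fun k => VlasovPoisson.gradPotential_congr_ae (hae k)]
    exact H.stronglyConvergesInL2 hQ hm
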